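/- Let $k$ be an algebraically closed field of characteristic $0$, let $\ell\ge 1$, and let $\bar G$ be one of $\mathrm{SL}(\ell+1)$, $\mathrm{SO}(2\ell+1)$, $\mathrm{Sp}(2\ell)$ (types A, B, C), with natural module $V$. Let $\Lambda$ be the weight lattice of the universal cover of $\bar G$, with fundamental weights $\omega_1,\dots,\omega_\ell$ and simple reflections $s_1,\dots,s_\ell$ numbered as in Bourbaki, and let $W$ be the Weyl group. Put $\varepsilon_i=\omega_i$ for $1\le i\le \ell$, except that $\varepsilon_\ell=2\omega_\ell$ in type B. For a dominant weight $\lambda$ let $V_\lambda$ denote the irreducible module of highest weight $\lambda$. Let $X=\bar G/\bar H$ be the model variety given by the following subgroup $\bar H$. * Type A, $\ell+1=2n+1$: $V=U\oplus U^*\oplus k v$ with $\dim U=n$ and $v\neq 0$, and $\bar H$ is the stabilizer in $\mathrm{SL}(V)$ of $v$ and of the standard symplectic bivector $a\in\bigwedge^2(U\oplus U^*)\subset\bigwedge^2V$. * Type A, $\ell+1=2n$: $\bar H$ is the stabilizer in $\mathrm{SL}(V)$ of a nonzero vector $v\in V$ and of a nondegenerate bivector $a\in\bigwedge^2V$. *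 Type B: $V=U\oplus U^*\oplus kv$ with $\dim U=\ell$, with the symmetric form that is the pairing on $U\oplus U^*$, and for which $v$ is non-isotropic and orthogonal to $U\oplus U^*$; $\bar H=\mathrm{GL}(U)$ acts naturally on $U\oplus U^*$ and trivially on $v$. * Type C: $V=W_1\oplus W_2$ is an orthogonal sum of symplectic spaces, of dimensions $(\ell,\ell)$ if $\ell$ is even and $(\ell+1,\ell-1)$ if $\ell$ is odd; $\bar H=H_1\times H_2$, where $H_1$ is the stabilizer in $\mathrm{Sp}(W_1)$ of a nonzero vector $v\in W_1$ and $H_2=\mathrm{Sp}(W_2)$. Let $A=k[X]$ be the coordinate ring, that is, the ring of regular functions on $\bar G$ invariant under right translation by $\bar H$, with $\bar G$ acting by left translation. For subspaces $M,N\subset A$ let $M\cdot N$ be the span of the products $mn$ with $m\in M$, $n\in N$. Then: 0. For $1\le i\le\ell$, the submodule of $\bigwedge^iV$ generated by the vector $e_1\wedge\dots\wedge e_i$, where $e_1,\dots,e_i\in V$ are weight vectors such that $e_1\wedge\dots\wedge e_j$ is a highest weight vector for each $j\le i$, is irreducible of highest weight $\varepsilon_i$, so it is $V_{\varepsilon_i}$;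 and $A$ contains exactly one submodule isomorphic to $V_{\varepsilon_i}^*$, which is again denoted by $V_{\varepsilon_i}^*$. 1. For $1\le i\le \ell$, $V_{\varepsilon_i}$ occurs in $V_{\varepsilon_1}^{\otimes i}$ with multiplicity one, and it does not occur in $V_{\varepsilon_1}^{\otimes j}$ for $0\le j<i$. 2. In $A$, one has $V_{\varepsilon_{i+2}}^*\subset V_{\varepsilon_2}^*\cdot V_{\varepsilon_i}^*$ for all $i\ge1$ with $i+2\le\ell$, and $V_{\varepsilon_{2i+1}}^*\subset V_{\varepsilon_1}^*\cdot V_{\varepsilon_{2i}}^*$ for all $i\ge 1$ with $2i+1\le\ell$. 3. For $1\le i\le \ell-1$, the element $u_i=s_1s_2\cdots s_i$ of $W$ satisfies $u_i\varepsilon_i=\varepsilon_{i+1}-\varepsilon_1$. -/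

import Mathlib

open scoped Matrix TensorProduct

noncomputable section

namespace ModelVariety

/-- The three families: `A` is `SL(ℓ+1)`, `B` is `SO(2ℓ+1)`, `C` is `Sp(2ℓ)`. -/
inductive CType
  | A | B | C

/-- The dimension of the natural module `V`. -/
abbrev dim : CType → ℕ → ℕ
  | .A, l => l + 1
  | .B, l => 2 * l + 1
  | .C, l => 2 * l

/-! ### The weight lattice and the Weyl group

The weight lattice `Λ` of the simply connected group is `Fin ℓ → ℤ`, in the coordinates given by the
fundamental weights (numbered as in Bourbaki): `λ` has coordinates `⟨α_j^∨, λ⟩`, and `ω_j` is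
the `j`-th standard basis vector. Indices of simple roots in `Fin ℓ` start at `0`. -/

/-- The weight lattice. -/
abbrev Weight (l : ℕ) : Type := Fin l → ℤ

/-- The Cartan matrix; its entry `(i, j)` is `⟨α_i, α_j^∨⟩`. -/
def cartan : CType → (l : ℕ) → Matrix (Fin l) (Fin l) ℤ
  | .A, l => CartanMatrix.A l
  | .B, l => CartanMatrix.B l
  | .C, l => CartanMatrix.C l

/-- The simple root `α_i` as an element of the weight lattice. -/
def simpleRoot (X : CType) (l : ℕ) (i : Fin l) : Weight l := fun j => cartan X l i j

theorem simpleRoot_self (X : CType) (l : ℕ) (i : Fin l) :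
    (LinearMap.proj i : Weight l →ₗ[ℤ] ℤ) (simpleRoot X l i) = 2 := by
  cases X <;> simp [simpleRoot, cartan, CartanMatrix.A, CartanMatrix.B, CartanMatrix.C]

/-- The simple reflection `s_i : λ ↦ λ - ⟨α_i^∨, λ⟩ α_i`. -/
def simpleReflection (X : CType) (l : ℕ) (i : Fin l) : Weight l ≃ₗ[ℤ] Weight l :=
  Module.reflection (simpleRoot_self X l i)

/-- The Weyl group, acting on the weight lattice. -/
def weylGroup (X : CType) (l : ℕ) : Subgroup (Weight l ≃ₗ[ℤ] Weight l) :=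
  Subgroup.closure (Set.range (simpleReflection X l))

/-- The product `s_1 s_2 ⋯ s_i` of the first `i` simple reflections. -/
def weylWord (X : CType) (l i : ℕ) : Weight l ≃ₗ[ℤ] Weight l :=
  (((List.finRange l).take i).map (simpleReflection X l)).prod

/-- The weights `ε_i`, `1 ≤ i ≤ ℓ`: `ε_i = ω_i`, except `ε_ℓ = 2 ω_ℓ` in type `B`. -/
def eps (X : CType) (l i : ℕ) : Weight l := fun j =>
  if (j : ℕ) + 1 = i then
    match X with
    | .A => 1
    | .B => if i = l then 2 else 1
    | .C => 1
  else 0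

/-! ### The groups

The natural module is `k ^ N` with standard basis `e_0, …, e_{N-1}`. In type `B` (resp. `C`) the
form pairs `e_p` with `e_{N-1-p}`, so that the upper triangular matrices form a Borel subgroup in
all three cases. -/

variable (X : CType) (l : ℕ) (k : Type*) [Field k]

/-- The natural module `V`. -/
abbrev Std : Type _ := Fin (dim X l) → k

/-- The standard basis vector `e_p` of `V` (zero if `p` is out of range). -/
def e (p : ℕ) : Std X l k := fun q => if (q : ℕ) = p then 1 else 0

/-- The symmetric form with `b(e_p, e_{N-1-p}) = 1` and all other values zero. -/
def symForm (N : ℕ) : Matrix (Fin N) (Fin N) k :=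
  Matrix.of fun p q => if q = p.rev then 1 else 0

/-- The alternating form with `a(e_p, e_{N-1-p}) = 1 = - a(e_{N-1-p}, e_p)` for `p < N-1-p` and
all other values zero (for `N` even). -/
def altForm (N : ℕ) : Matrix (Fin N) (Fin N) k :=
  Matrix.of fun p q => if q = p.rev then (if p < q then 1 else -1) else 0

/-- The matrices of determinant one that preserve the bilinear form with Gram matrix `J`. -/
def preserving {N : ℕ} (J : Matrix (Fin N) (Fin N) k) :
    Subgroup (Matrix.SpecialLinearGroup (Fin N) k) where
  carrier := {g | (g : Matrix (Fin N) (Fin N) k)ᵀ * J * (g : Matrix (Fin N) (Fin N) k) = J}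
  one_mem' := by simp
  mul_mem' := by
    intro a b ha hb
    simp only [Set.mem_ofPred_eq, Matrix.SpecialLinearGroup.coe_mul, Matrix.transpose_mul] at *
    calc _ = (b : Matrix (Fin N) (Fin N) k)ᵀ *
          ((a : Matrix (Fin N) (Fin N) k)ᵀ * J * (a : Matrix (Fin N) (Fin N) k)) *
          (b : Matrix (Fin N) (Fin N) k) := by simp only [Matrix.mul_assoc]
      _ = J := by rw [ha, hb]
  inv_mem' := by
    intro a ha
    simp only [Set.mem_ofPred_eq] at *
    have h : (a : Matrix (Fin N) (Fin N) k) * ((a⁻¹ : Matrix.SpecialLinearGroup (Fin N) k) :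
        Matrix (Fin N) (Fin N) k) = 1 := by
      rw [← Matrix.SpecialLinearGroup.coe_mul, mul_inv_cancel, Matrix.SpecialLinearGroup.coe_one]
    have h' := congrArg Matrix.transpose h
    rw [Matrix.transpose_mul, Matrix.transpose_one] at h'
    generalize ((a⁻¹ : Matrix.SpecialLinearGroup (Fin N) k) : Matrix (Fin N) (Fin N) k) = b at *
    generalize (a : Matrix (Fin N) (Fin N) k) = a at *
    calc bᵀ * J * b = bᵀ * (aᵀ * J * a) * b := by rw [ha]
      _ = (bᵀ * aᵀ) * J * (a * b) := by simp only [Matrix.mul_assoc]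
      _ = J := by rw [h, h']; simp

/-- The group `SL(ℓ+1)`, `SO(2ℓ+1)` or `Sp(2ℓ)`. -/
def group : (X : CType) → (l : ℕ) → Subgroup (Matrix.SpecialLinearGroup (Fin (dim X l)) k)
  | .A, _ => ⊤
  | .B, l => preserving k (symForm k (dim .B l))
  | .C, l => preserving k (altForm k (dim .C l))

/-- The group as a type. -/
abbrev Gp : Type _ := group k X l

/-- The natural representation on `V`. -/
def stdRep : Representation k (Gp X l k) (Std X l k) where
  toFun g := Matrix.toLin' (g.1 : Matrix (Fin (dim X l)) (Fin (dim X l)) k)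
  map_one' := by simp; rfl
  map_mul' a b := by simp [Matrix.toLin'_mul]; rfl

/-- The representation on `⋀ ^ i V`. -/
def extRep (i : ℕ) : Representation k (Gp X l k) (⋀[k]^i (Std X l k)) where
  toFun g := exteriorPower.map i (stdRep X l k g)
  map_one' := by rw [map_one]; exact exteriorPower.map_id
  map_mul' a b := by rw [map_mul]; exact exteriorPower.map_comp _ _

/-! ### Highest weights -/

/-- The simple coroot `α_j^∨` as a cocharacter `t ↦ diag (t ^ m_p)`: this is the vector `m`. -/
def corootExp (j : Fin l) (p : Fin (dim X l)) : ℤ :=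
  match X with
  | .A => s p
  | .B => if (j : ℕ) + 1 = l then 2 * (d j p - d j p.rev) else s p - s p.rev
  | .C => if (j : ℕ) + 1 = l then d j p - d j p.rev else s p - s p.rev
where
  /-- Kronecker delta. -/
  d {N : ℕ} (a : ℕ) (p : Fin N) : ℤ := if (p : ℕ) = a then 1 else 0
  /-- The exponents of `diag (…, t, t⁻¹, …)`, with `t` in position `j`. -/
  s {N : ℕ} (p : Fin N) : ℤ := d j p - d ((j : ℕ) + 1) p

theorem corootExp_rev (h : X ≠ .A) (j : Fin l) (p : Fin (dim X l)) :
    corootExp X l j p.rev = - corootExp X l j p := by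
  cases X
  · exact absurd rfl h
  all_goals simp only [corootExp, Fin.rev_rev]; split_ifs <;> ring

theorem sum_delta {N a : ℕ} (ha : a < N) : ∑ p : Fin N, corootExp.d a p = 1 := by
  rw [Finset.sum_eq_single (⟨a, ha⟩ : Fin N)]
  · simp [corootExp.d]
  · intro b _ hb
    exact if_neg fun h => hb (Fin.ext h)
  · simp

theorem sum_corootExp (j : Fin l) : ∑ p, corootExp X l j p = 0 := by
  by_cases h : X = .A
  · subst h
    have hj := j.2
    change ∑ p : Fin (l + 1), (corootExp.d (j : ℕ) p - corootExp.d ((j : ℕ) + 1) p) = 0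
    rw [Finset.sum_sub_distrib, sum_delta (by omega), sum_delta (by omega), sub_self]
  · have h1 : ∑ p, corootExp X l j p = ∑ p, corootExp X l j (Fin.rev p) :=
      (Equiv.sum_comp Fin.revPerm (corootExp X l j)).symm
    simp only [corootExp_rev X l h, Finset.sum_neg_distrib] at h1
    omega

theorem prod_zpow_eq {G ι : Type*} [CommGroup G] (t : G) (s : Finset ι) (f : ι → ℤ) :
    ∏ p ∈ s, t ^ f p = t ^ ∑ p ∈ s, f p := by
  classical
  induction s using Finset.induction_on with
  | empty => simp
  | insert a s ha ih => rw [Finset.prod_insert ha, Finset.sum_insert ha, ih, zpow_add]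

/-- The diagonal matrix `α_j^∨(t)`. -/
def corootSL (j : Fin l) (t : kˣ) : Matrix.SpecialLinearGroup (Fin (dim X l)) k :=
  ⟨Matrix.diagonal fun p => ((t ^ corootExp X l j p : kˣ) : k), by
    rw [Matrix.det_diagonal, ← Units.coe_prod, prod_zpow_eq, sum_corootExp]
    simp⟩

theorem diagonal_mem {N : ℕ} (d : Fin N → kˣ) (hd : ∀ p, d p * d p.rev = 1)
    (c : Fin N → Fin N → k) :
    (Matrix.diagonal fun p => (d p : k))ᵀ *
      (Matrix.of fun p q => if q = p.rev then c p q else 0) *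
      (Matrix.diagonal fun p => (d p : k)) =
      Matrix.of fun p q => if q = p.rev then c p q else 0 := by
  ext p q
  simp only [Matrix.diagonal_transpose, Matrix.mul_diagonal, Matrix.diagonal_mul, Matrix.of_apply]
  split_ifs with h
  · subst h
    have h1 : (d p : k) * (d p.rev : k) = 1 := by rw [← Units.val_mul, hd, Units.val_one]
    calc (d p : k) * c p p.rev * (d p.rev : k) = (d p : k) * (d p.rev : k) * c p p.rev := by ring
      _ = c p p.rev := by rw [h1, one_mul]
  · simp

theorem corootSL_mem (j : Fin l) (t : kˣ) : corootSL X l k j t ∈ group k X l := by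
  have key : X ≠ .A → ∀ p, t ^ corootExp X l j p * t ^ corootExp X l j p.rev = 1 := by
    intro h p
    rw [← zpow_add, corootExp_rev X l h]
    simp
  cases X
  · exact Subgroup.mem_top _
  · exact diagonal_mem k _ (key (by simp)) _
  · exact diagonal_mem k _ (key (by simp)) _

/-- The element `α_j^∨(t)` of the group, for the simple coroot `α_j^∨`. -/
def coroot (j : Fin l) (t : kˣ) : Gp X l k := ⟨corootSL X l k j t, corootSL_mem X l k j t⟩

variable {X l k} in
/-- The upper unitriangular elements: the unipotent radical of the Borel subgroup. -/
def IsUnipotentUpper (g : Gp X l k) : Prop :=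
  (∀ p, (g.1 : Matrix (Fin (dim X l)) (Fin (dim X l)) k) p p = 1) ∧
    ∀ p q, q < p → (g.1 : Matrix (Fin (dim X l)) (Fin (dim X l)) k) p q = 0

variable {X l k} in
/-- `v` is a highest weight vector of weight `wt`: it is nonzero, it is fixed by the unipotent
radical of the Borel subgroup, and `α_j^∨(t)` acts on it by `t ^ ⟨α_j^∨, wt⟩`. -/
def IsHighestWeightVector {M : Type*} [AddCommMonoid M] [Module k M]
    (ρ : Representation k (Gp X l k) M) (wt : Weight l) (v : M) : Prop :=
  v ≠ 0 ∧ (∀ g, IsUnipotentUpper g → ρ g v = v) ∧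
    ∀ j t, ρ (coroot X l k j t) v = ((t ^ wt j : kˣ) : k) • v

variable {X l k} in
/-- The subrepresentation generated by a vector. -/
def generatedBy {M : Type*} [AddCommMonoid M] [Module k M]
    (ρ : Representation k (Gp X l k) M) (v : M) : Subrepresentation ρ where
  toSubmodule := Submodule.span k (Set.range fun g => ρ g v)
  apply_mem_toSubmodule g w hw := by
    have h : Submodule.span k (Set.range fun g => ρ g v) ≤
        (Submodule.span k (Set.range fun g => ρ g v)).comap (ρ g) := by
      rw [Submodule.span_le]
      rintro _ ⟨h, rfl⟩
      refine Submodule.subset_span ⟨g * h, ?_⟩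
      simp
    exact h hw

/-- The vector `e_0 ∧ e_1 ∧ ⋯ ∧ e_{i-1}` of `⋀ ^ i V`. -/
def topVector (i : ℕ) : ⋀[k]^i (Std X l k) :=
  exteriorPower.ιMulti k i fun p : Fin i => e X l k p

/-- The module `V_{ε_i}`, realised as the submodule of `⋀ ^ i V` generated by
`e_0 ∧ ⋯ ∧ e_{i-1}`. -/
def VepsSub (i : ℕ) : Subrepresentation (extRep X l k i) :=
  generatedBy (extRep X l k i) (topVector X l k i)

/-- The representation `V_{ε_i}`. -/
abbrev Veps (i : ℕ) : Representation k (Gp X l k) (VepsSub X l k i).toSubmodule :=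
  (VepsSub X l k i).toRepresentation

variable {X l k} in
/-- The `n`-th tensor power of a representation. -/
def tensorPow {M : Type*} [AddCommMonoid M] [Module k M]
    (ρ : Representation k (Gp X l k) M) (n : ℕ) :
    Representation k (Gp X l k) (⨂[k]^n M) where
  toFun g := PiTensorProduct.map fun _ => ρ g
  map_one' := by simp
  map_mul' a b := by rw [map_mul]; exact PiTensorProduct.map_mul _ _

/-! ### The subgroups `H` -/

variable {X l k} in
/-- The stabilizer of a vector. -/
def stabVec {M : Type*} [AddCommMonoid M] [Module k M]
    (ρ : Representation k (Gp X l k) M) (v : M) : Subgroup (Gp X l k) where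
  carrier := {g | ρ g v = v}
  one_mem' := by simp
  mul_mem' := by
    intro a b ha hb
    simp only [Set.mem_ofPred_eq] at *
    rw [map_mul, Module.End.mul_apply, hb, ha]
  inv_mem' := by
    intro a ha
    simp only [Set.mem_ofPred_eq] at *
    nth_rewrite 1 [← ha]
    simp

variable {X l k} in
/-- The stabilizer of a linear subspace. -/
def stabSub {M : Type*} [AddCommMonoid M] [Module k M]
    (ρ : Representation k (Gp X l k) M) (W : Submodule k M) : Subgroup (Gp X l k) where
  carrier := {g | W.map (ρ g) = W}
  one_mem' := by
    simp only [Set.mem_ofPred_eq, map_one]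
    exact Submodule.map_id W
  mul_mem' := by
    intro a b ha hb
    simp only [Set.mem_ofPred_eq] at *
    rw [map_mul, Module.End.mul_eq_comp, Submodule.map_comp, hb, ha]
  inv_mem' := by
    intro a ha
    simp only [Set.mem_ofPred_eq] at *
    nth_rewrite 1 [← ha]
    rw [← Submodule.map_comp, ← Module.End.mul_eq_comp, ← map_mul, inv_mul_cancel, map_one]
    exact Submodule.map_id W

/-- The span of the basis vectors `e_p` with `P p`. -/
def coordSpan (P : ℕ → Prop) : Submodule k (Std X l k) :=
  Submodule.span k (e X l k '' {p | P p})

/-- In type `A`, with `N = ℓ + 1`: the bivector `∑ e_{2j} ∧ e_{2j+1}`, over `0 ≤ j < ⌊N / 2⌋`. It is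
nondegenerate if `N` is even, and is the standard bivector of `span (e_0, …, e_{N-2})` if `N` is
odd. -/
def bivector : ⋀[k]^2 (Std X l k) :=
  ∑ j ∈ Finset.range (dim X l / 2), exteriorPower.ιMulti k 2 ![e X l k (2 * j), e X l k (2 * j + 1)]

/-- The subgroup `H` such that `G / H` is the model variety.
* Type `A`: the stabilizer of the vector `e_{N-1}` and of the bivector above.
* Type `B`: `V = W ⊕ k v ⊕ W^*` with `W = span (e_0, …, e_{ℓ-1})`, `v = e_ℓ`,
  `W^* = span (e_{ℓ+1}, …, e_{2ℓ})`; `H ≃ GL(W)` is the subgroup fixing `v` and stabilizing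
  `W` and `W^*`.
* Type `C`: `V = W₁ ⊕ W₂`, where `W₁` is spanned by the `e_p` and `e_{2ℓ-1-p}` with
  `p < m = ⌈ℓ / 2⌉`, so that `W₁` has dimension `ℓ` or `ℓ + 1`, and `W₂` is its orthogonal, spanned
  by the other basis vectors; `H` is the subgroup stabilizing `W₁` and `W₂` and fixing the vector
  `e_0` of `W₁`. -/
def modelSubgroup : (X : CType) → (l : ℕ) → Subgroup (Gp X l k)
  | .A, l => stabVec (stdRep .A l k) (e .A l k l) ⊓ stabVec (extRep .A l k 2) (bivector .A l k)
  | .B, l => stabVec (stdRep .B l k) (e .B l k l) ⊓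
      stabSub (stdRep .B l k) (coordSpan .B l k fun p => p < l) ⊓
      stabSub (stdRep .B l k) (coordSpan .B l k fun p => l < p)
  | .C, l => stabVec (stdRep .C l k) (e .C l k 0) ⊓
      stabSub (stdRep .C l k)
        (coordSpan .C l k fun p => p < (l + 1) / 2 ∨ 2 * l ≤ p + (l + 1) / 2) ⊓
      stabSub (stdRep .C l k)
        (coordSpan .C l k fun p => (l + 1) / 2 ≤ p ∧ p + (l + 1) / 2 < 2 * l)

/-! ### The coordinate ring -/

/-- The regular functions on the group: the polynomials in the matrix entries. -/
def regularFunctions : Subalgebra k (Gp X l k → k) :=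
  (MvPolynomial.aeval (R := k) fun (c : Fin (dim X l) × Fin (dim X l)) (g : Gp X l k) =>
    (g.1 : Matrix (Fin (dim X l)) (Fin (dim X l)) k) c.1 c.2).range

/-- The functions invariant under right translation by a subgroup. -/
def rightInvariants (H : Subgroup (Gp X l k)) : Subalgebra k (Gp X l k → k) where
  carrier := {f | ∀ g, ∀ h ∈ H, f (g * h) = f g}
  mul_mem' := by
    intro a b ha hb g h hh
    simp [ha g h hh, hb g h hh]
  add_mem' := by
    intro a b ha hb g h hh
    simp [ha g h hh, hb g h hh]
  algebraMap_mem' := by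
    intro r g h _
    rfl

/-- The coordinate ring `A = k[G / H]` of the model variety: the regular functions on `G` that are
invariant under right translation by `H`. -/
def coordinateRing : Subalgebra k (Gp X l k → k) :=
  regularFunctions X l k ⊓ rightInvariants X l k (modelSubgroup k X l)

theorem translate_mem (x : Gp X l k) {f : Gp X l k → k} (hf : f ∈ coordinateRing X l k) :
    (fun g => f (x⁻¹ * g)) ∈ coordinateRing X l k := by
  refine ⟨?_, fun g h hh => ?_⟩
  · obtain ⟨P, rfl⟩ := hf.1
    let c : Fin (dim X l) × Fin (dim X l) → MvPolynomial (Fin (dim X l) × Fin (dim X l)) k :=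
      fun pq => ∑ r, MvPolynomial.C (((x⁻¹ : Gp X l k).1 :
        Matrix (Fin (dim X l)) (Fin (dim X l)) k) pq.1 r) * MvPolynomial.X (r, pq.2)
    refine ⟨MvPolynomial.bind₁ c P, ?_⟩
    funext g
    have ev : ∀ (v : Fin (dim X l) × Fin (dim X l) → Gp X l k → k)
        (Q : MvPolynomial (Fin (dim X l) × Fin (dim X l)) k) (y : Gp X l k),
        (MvPolynomial.aeval v Q) y = MvPolynomial.aeval (fun i => v i y) Q := by
      intro v Q y
      have := MvPolynomial.comp_aeval_apply (f := v) (Pi.evalAlgHom k (fun _ => k) y) Q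
      exact this
    let co : Fin (dim X l) × Fin (dim X l) → Gp X l k → k := fun c g =>
      (g.1 : Matrix (Fin (dim X l)) (Fin (dim X l)) k) c.1 c.2
    change (MvPolynomial.aeval co (MvPolynomial.bind₁ c P)) g = (MvPolynomial.aeval co P) (x⁻¹ * g)
    rw [ev, ev, MvPolynomial.aeval_bind₁]
    congr 1
    congr 1
    funext i
    simp [c, co, Matrix.mul_apply]
  · have := hf.2 (x⁻¹ * g) h hh
    simpa [mul_assoc] using this

/-- The action of `G` on the coordinate ring by left translation, `(x f)(g) = f(x⁻¹ g)`. -/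
def coordRep : Representation k (Gp X l k) (coordinateRing X l k) where
  toFun x :=
    { toFun := fun f => ⟨fun g => f.1 (x⁻¹ * g), translate_mem X l k x f.2⟩
      map_add' := fun _ _ => rfl
      map_smul' := fun _ _ => rfl }
  map_one' := by
    ext f g
    simp
  map_mul' a b := by
    ext f g
    simp [mul_assoc]

/-- `S` is a copy of `V_{ε_i}^*` in the coordinate ring. -/
def IsDualCopy (i : ℕ) (S : Subrepresentation (coordRep X l k)) : Prop :=
  Nonempty ((Veps X l k i).dual.Equiv S.toRepresentation)

/-- The subspace `V_{ε_i}^*` of the coordinate ring: the isotypic component of this type. -/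
def dualComponent (i : ℕ) : Submodule k (coordinateRing X l k) :=
  ⨆ S : {S : Subrepresentation (coordRep X l k) // IsDualCopy X l k i S}, S.1.toSubmodule

end ModelVariety

end

/-!
All the modules are realised in spaces of tensors with coordinates: a tensor of degree `i` is a
function on the tuples `Fin i → Fin N`, and `phi` embeds `⋀ ^ i V` into these.

*The modules `V_{ε_i}`.* The skew tensors whose contractions with the invariant form vanish are
called primitive. A nonzero stable space of primitive tensors is stable under the root vectors of
the Lie algebra, since the action of `exp (t A)` is polynomial in `t`, and under the projections to
the weight spaces. Moving indices by root vectors, one reaches `e_0 ∧ ⋯ ∧ e_{i-1}`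
(`wedge_std_mem`). So the space of primitive tensors is irreducible and `V_{ε_i}` is all of it:
since the groups are closed under transposition, the orthogonal of `V_{ε_i}` for the dot product is
stable too, and it does not contain `e_0 ∧ ⋯ ∧ e_{i-1}` (`map_phi_vepsSub`).

*Tensor powers.* A map from `V_{ε_i}` to the tensors of degree `j` is determined by the image of
`e_0 ∧ ⋯ ∧ e_{i-1}`. The torus shows that each of the indices `0, …, i - 1` occurs in this
image, so it is zero if `j < i`; if `j = i`, it is determined by one coordinate, because the
root vectors that fix `e_0 ∧ ⋯ ∧ e_{i-1}` force it to be alternating.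

*The coordinate ring.* In all types the subgroup `H` is the stabilizer of a basis vector `v` and of
an alternating tensor `K` of degree two (`mem_modelSubgroup_iff`), which pairs the indices of the
basis. Hence `w = K ⊗ K ⊗ ⋯`, followed by `v` in odd degree, is an invariant tensor, and
`y ↦ (g ↦ y ⬝ᵥ g w)` maps the primitive tensors to a copy of the dual module in the coordinate
ring, provided that the map is not zero (`exists_coef_ne_zero`). This holds because in the
alternating sum of `w` over a tuple of pairs all terms have the same sign.

A copy of the dual module in the coordinate ring comes from an `H`-invariant vector of `V_{ε_i}`, so
uniqueness says that the space of these vectors has dimension at most one. A tuple on which an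
invariant tensor does not vanish consists of pairs and possibly of the index of `v`, by invariance
under a torus of `H` and one root vector. The root vectors in the Lie algebra of `H` exchange two
pairs, and in type `C` the vanishing of the contractions moves the pairs to the part of `V` where
`K` is nondegenerate. Thus an invariant primitive tensor is determined by its coordinate at any one
such tuple of pairs (`eq_zero_of_invariant`).

*Products.* The alternating sum of `w` in degree `2 n + i` expands as a sum of products of
alternating sums in the degrees `2 n` and `i` (`altSum_mul`). Therefore the product of the
components of these degrees contains the function of `e_0 ∧ ⋯ ∧ e_{2n+i-1}`, and as it is stable
under the group it contains the whole component (`dualComponent_le_mul`).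
-/

open scoped Matrix TensorProduct

noncomputable section

namespace ModelVariety

/-! ### The Weyl group -/

section Weyl

variable (X : CType) (l : ℕ)

theorem eps_zero : eps X l 0 = 0 := by
  funext j
  simp [eps]

theorem simpleReflection_apply (i : Fin l) (x : Weight l) :
    simpleReflection X l i x = x - x i • simpleRoot X l i := by
  simp [simpleReflection, Module.reflection_apply]

theorem simpleRoot_eq_eps (i : Fin l) (hi : (i : ℕ) + 1 < l) :
    simpleRoot X l i = 2 • eps X l (i + 1) - eps X l (i + 2) - eps X l i := by
  funext j
  have hj := j.2
  cases X <;> simp [simpleRoot, cartan, CartanMatrix.A, CartanMatrix.B, CartanMatrix.C, eps,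
    Fin.ext_iff] <;> split_ifs <;> omega

theorem take_finRange_succ (r : Fin l) :
    (List.finRange l).take (r + 1) = (List.finRange l).take r ++ [r] := by
  rw [List.take_add_one]
  simp

/-- In the usual coordinates `ε_r = δ_1 + ⋯ + δ_r`, the vector on the left is
`δ_1 + ⋯ + δ_r + δ_{r+2} + ⋯ + δ_{i+1}`, and `s_r` shifts its gap one step to the left. -/
theorem weylWord_gap (i : ℕ) (hil : i + 1 ≤ l) (r : ℕ) (hr : r ≤ i) :
    weylWord X l r (eps X l r + eps X l (i + 1) - eps X l (r + 1)) =
      eps X l (i + 1) - eps X l 1 := by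
  induction r with
  | zero => simp [weylWord, eps_zero]
  | succ r ih =>
    have hrl : r < l := by omega
    have h1 : weylWord X l (r + 1) = weylWord X l r * simpleReflection X l ⟨r, hrl⟩ := by
      have := take_finRange_succ l ⟨r, hrl⟩
      simp only at this
      simp [weylWord, this]
    rw [h1, LinearEquiv.mul_apply, ← ih (by omega)]
    congr 1
    rw [simpleReflection_apply, simpleRoot_eq_eps X l ⟨r, hrl⟩ (by simp; omega)]
    have h2 : (eps X l (r + 1) + eps X l (i + 1) - eps X l (r + 1 + 1)) ⟨r, hrl⟩ = 1 := by
      have : r ≠ i := by omega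
      have : r + 1 ≠ l := by omega
      cases X <;> simp [eps, *]
    rw [h2]
    simp only [one_smul]
    module

theorem weylWord_mem (i : ℕ) : weylWord X l i ∈ weylGroup X l := by
  refine Subgroup.list_prod_mem _ fun x hx => ?_
  obtain ⟨j, -, rfl⟩ := List.mem_map.1 hx
  exact Subgroup.subset_closure ⟨j, rfl⟩

theorem weylWord_eps (i : ℕ) (hil : i + 1 ≤ l) :
    weylWord X l i (eps X l i) = eps X l (i + 1) - eps X l 1 := by
  simpa using weylWord_gap X l i hil i le_rfl

end Weyl

/-! ### Tensors as functions on tuples -/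

section Tuples

variable {k : Type*} [Field k] {N i : ℕ}

/-- Tensors of degree `i` on `k ^ N`, given by their coordinates. -/
abbrev Tup (k : Type*) (N i : ℕ) : Type _ := (Fin i → Fin N) → k

/-- The action of a matrix on tensors. -/
def tact (g : Matrix (Fin N) (Fin N) k) : Tup k N i →ₗ[k] Tup k N i where
  toFun y f := ∑ h : Fin i → Fin N, (∏ j, g (f j) (h j)) * y h
  map_add' y z := by
    funext f
    simp [mul_add, Finset.sum_add_distrib]
  map_smul' c y := by
    funext f
    simp only [Pi.smul_apply, smul_eq_mul, RingHom.id_apply, Finset.mul_sum]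
    exact Finset.sum_congr rfl fun h _ => by ring

theorem tact_apply (g : Matrix (Fin N) (Fin N) k) (y : Tup k N i) (f : Fin i → Fin N) :
    tact g y f = ∑ h : Fin i → Fin N, (∏ j, g (f j) (h j)) * y h := rfl

theorem tact_mul (g g' : Matrix (Fin N) (Fin N) k) (y : Tup k N i) :
    tact (g * g') y = tact g (tact g' y) := by
  funext f
  simp only [tact_apply, Matrix.mul_apply, Finset.prod_univ_sum, Fintype.piFinset_univ,
    Finset.mul_sum, Finset.sum_mul, Finset.prod_mul_distrib]
  rw [Finset.sum_comm]
  exact Finset.sum_congr rfl fun h _ => Finset.sum_congr rfl fun h' _ => by ring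

theorem tact_diagonal (d : Fin N → k) (y : Tup k N i) (f : Fin i → Fin N) :
    tact (Matrix.diagonal d) y f = (∏ j, d (f j)) * y f := by
  rw [tact_apply, Finset.sum_eq_single f]
  · simp
  · intro h _ hh
    obtain ⟨j, hj⟩ := Function.ne_iff.1 hh
    rw [Finset.prod_eq_zero (Finset.mem_univ j), zero_mul]
    exact Matrix.diagonal_apply_ne _ (Ne.symm hj)
  · simp

theorem tact_dotProduct (g : Matrix (Fin N) (Fin N) k) (y z : Tup k N i) :
    tact g y ⬝ᵥ z = y ⬝ᵥ tact gᵀ z := by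
  simp only [dotProduct, tact_apply, Finset.sum_mul, Finset.mul_sum, Matrix.transpose_apply]
  rw [Finset.sum_comm]
  exact Finset.sum_congr rfl fun h _ => Finset.sum_congr rfl fun h' _ => by ring

/-- The action of a matrix on tensors as a derivation: the sum over the tensor factors of its
action on a single factor. -/
def derAct (A : Matrix (Fin N) (Fin N) k) (y : Tup k N i) : Tup k N i := fun f =>
  ∑ j, ∑ x, A (f j) x * y (Function.update f j x)

/-- The exponential `exp (t A)` of a matrix with `A ^ 3 = 0`. -/
def uexp (A : Matrix (Fin N) (Fin N) k) (t : k) : Matrix (Fin N) (Fin N) k :=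
  1 + t • A + (t ^ 2 / 2) • (A * A)

/-- The matrix `exp (T A)`, over the polynomials in `T`. -/
def uexpPoly (A : Matrix (Fin N) (Fin N) k) : Matrix (Fin N) (Fin N) (Polynomial k) :=
  Matrix.of fun a b => Polynomial.C ((1 : Matrix (Fin N) (Fin N) k) a b) +
    Polynomial.C (A a b) * Polynomial.X + Polynomial.C ((A * A) a b / 2) * Polynomial.X ^ 2

theorem eval_uexpPoly (A : Matrix (Fin N) (Fin N) k) (t : k) (a b : Fin N) :
    (uexpPoly A a b).eval t = uexp A t a b := by
  simp [uexpPoly, uexp]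
  ring

/-- The derivative at `t = 0` of the action of `exp (t A)` is the derivation action of `A`. -/
theorem exists_poly_tact (A : Matrix (Fin N) (Fin N) k) (y : Tup k N i) (f : Fin i → Fin N) :
    ∃ q : Polynomial k, (∀ t, q.eval t = tact (uexp A t) y f) ∧
      q.derivative.eval 0 = derAct A y f := by
  refine ⟨∑ h : Fin i → Fin N, (∏ j, uexpPoly A (f j) (h j)) * Polynomial.C (y h),
    fun t => ?_, ?_⟩
  · simp only [Polynomial.eval_finsetSum, Polynomial.eval_mul, Polynomial.eval_prod,
      eval_uexpPoly, Polynomial.eval_C, tact_apply]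
  · have h0 : ∀ a b, (uexpPoly A a b).eval 0 = if a = b then 1 else 0 := fun a b => by
      simp [eval_uexpPoly, uexp, Matrix.one_apply]
    have h1 : ∀ a b, (uexpPoly A a b).derivative.eval 0 = A a b := fun a b => by
      simp [uexpPoly]
    simp only [Polynomial.derivative_sum, Polynomial.derivative_mul, Polynomial.derivative_C,
      mul_zero, add_zero, Polynomial.derivative_prod_finset, Polynomial.eval_finsetSum,
      Polynomial.eval_mul, Polynomial.eval_prod, h0, h1, Polynomial.eval_C, derAct,
      Finset.sum_mul]
    rw [Finset.sum_comm]
    refine Finset.sum_congr rfl fun j _ => ?_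
    rw [← Finset.sum_subset (Finset.subset_univ
      (Finset.univ.image fun x => Function.update f j x))]
    · rw [Finset.sum_image]
      · refine Finset.sum_congr rfl fun x _ => ?_
        rw [Finset.prod_eq_one]
        · simp
        · intro b hb
          simp [Function.update_of_ne (Finset.ne_of_mem_erase hb)]
      · intro x _ x' _ h
        simpa using congrFun h j
    · intro h _ hh
      have : ∃ b ∈ Finset.univ.erase j, f b ≠ h b := by
        by_contra! hc
        refine hh (Finset.mem_image.2 ⟨h j, Finset.mem_univ _, funext fun b => ?_⟩)
        by_cases hb : b = j
        · subst hb; simp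
        · rw [Function.update_of_ne hb, hc b (Finset.mem_erase.2 ⟨hb, Finset.mem_univ _⟩)]
      obtain ⟨b, hb, hne⟩ := this
      rw [Finset.prod_eq_zero hb (if_neg hne)]
      simp

theorem derAct_eq_zero [Infinite k] (A : Matrix (Fin N) (Fin N) k) (y : Tup k N i)
    (h : ∀ t, tact (uexp A t) y = y) : derAct A y = 0 := by
  funext f
  obtain ⟨q, hq, hd⟩ := exists_poly_tact A y f
  have : q = Polynomial.C (y f) := Polynomial.funext fun t => by simp [hq, h]
  rw [← hd, this]
  simp

theorem derAct_mem [Infinite k] (A : Matrix (Fin N) (Fin N) k) (S : Submodule k (Tup k N i))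
    (y : Tup k N i) (h : ∀ t, tact (uexp A t) y ∈ S) : derAct A y ∈ S := by
  by_contra hc
  obtain ⟨φ, hφ, hS⟩ := Submodule.exists_le_ker_of_notMem hc
  choose q hq hd using exists_poly_tact A y
  have hsum : ∀ z : Tup k N i, φ z = ∑ f, φ (Pi.single f 1) * z f := fun z => by
    conv_lhs => rw [← Finset.univ_sum_single z]
    rw [map_sum]
    refine Finset.sum_congr rfl fun f _ => ?_
    rw [mul_comm, ← smul_eq_mul, ← map_smul, ← Pi.single_smul, smul_eq_mul, mul_one]
  have h0 : ∑ f, Polynomial.C (φ (Pi.single f 1)) * q f = 0 := Polynomial.funext fun t => by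
    simp only [Polynomial.eval_finsetSum, Polynomial.eval_mul, Polynomial.eval_C, hq,
      Polynomial.eval_zero]
    rw [← hsum]
    exact hS (h t)
  have h1 := congrArg (fun p => p.derivative.eval 0) h0
  simp [Polynomial.eval_finsetSum, hd] at h1
  exact hφ ((hsum _).trans h1)

/-! ### Skew tensors -/

/-- Skew-symmetric tensors. -/
def IsSkew (y : Tup k N i) : Prop :=
  ∀ (τ : Equiv.Perm (Fin i)) (f : Fin i → Fin N), y (f ∘ τ) = ((Equiv.Perm.sign τ : ℤ) : k) * y f

theorem IsSkew.eq_zero [CharZero k] {y : Tup k N i} (hy : IsSkew y) {f : Fin i → Fin N}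
    {a b : Fin i} (hab : a ≠ b) (h : f a = f b) : y f = 0 := by
  have h1 := hy (Equiv.swap a b) f
  have h2 : f ∘ Equiv.swap a b = f := by
    funext c
    simp only [Function.comp_apply, Equiv.swap_apply_def]
    split_ifs with h3 h4
    · rw [h3, h]
    · rw [h4, h]
    · rfl
  rw [h2, Equiv.Perm.sign_swap hab] at h1
  have h3 : (2 : k) * y f = 0 := by
    push_cast at h1
    linear_combination h1
  simpa using h3

theorem IsSkew.injective [CharZero k] {y : Tup k N i} (hy : IsSkew y) {f : Fin i → Fin N}
    (h : y f ≠ 0) : Function.Injective f := fun a b hab => by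
  by_contra hne
  exact h (hy.eq_zero hne hab)

theorem IsSkew.swap {y : Tup k N i} (hy : IsSkew y) {f : Fin i → Fin N} {a b : Fin i}
    (hab : a ≠ b) (u v : Fin N) :
    y (Function.update (Function.update f a u) b v) =
      - y (Function.update (Function.update f a v) b u) := by
  have h1 := hy (Equiv.swap a b) (Function.update (Function.update f a v) b u)
  rw [Equiv.Perm.sign_swap hab] at h1
  have h2 : Function.update (Function.update f a v) b u ∘ Equiv.swap a b =
      Function.update (Function.update f a u) b v := by
    funext c
    simp only [Function.comp_apply, Equiv.swap_apply_def, Function.update_apply]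
    split_ifs <;> simp_all
  rw [h2] at h1
  rw [h1]
  simp

theorem isSkew_tact {y : Tup k N i} (hy : IsSkew y) (g : Matrix (Fin N) (Fin N) k) :
    IsSkew (tact g y) := fun τ f => by
  rw [tact_apply, tact_apply, Finset.mul_sum,
    ← Equiv.sum_comp (Equiv.arrowCongr τ.symm (Equiv.refl (Fin N)))]
  refine Finset.sum_congr rfl fun h _ => ?_
  have h1 : (Equiv.arrowCongr τ.symm (Equiv.refl (Fin N))) h = h ∘ τ := by
    funext a
    simp [Equiv.arrowCongr]
  rw [h1, hy τ h]
  have h2 : ∏ j, g ((f ∘ τ) j) ((h ∘ τ) j) = ∏ j, g (f j) (h j) :=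
    Equiv.prod_comp τ fun j => g (f j) (h j)
  rw [h2]
  ring

/-- Two injective tuples with the same values differ by a permutation of the positions. -/
theorem exists_perm {α : Type*} {f f₀ : Fin i → α} (hf : Function.Injective f)
    (h : ∀ j, f j ∈ Set.range f₀) : ∃ τ : Equiv.Perm (Fin i), f = f₀ ∘ τ := by
  choose t ht using h
  have : Function.Injective t := fun a b hab => hf (by rw [← ht a, ← ht b, hab])
  exact ⟨Equiv.ofBijective t (Finite.injective_iff_bijective.1 this),
    funext fun j => (ht j).symm⟩

/-- The alternating sum of a tensor over all permutations of the factors. -/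
def altSum (w : Tup k N i) (f : Fin i → Fin N) : k :=
  ∑ τ : Equiv.Perm (Fin i), ((Equiv.Perm.sign τ : ℤ) : k) * w (f ∘ τ)

/-- The tensor `e_{f 0} ∧ e_{f 1} ∧ ⋯`. -/
def wedge (k : Type*) [Field k] (f : Fin i → Fin N) : Tup k N i := fun h =>
  Matrix.det (Matrix.of fun a b => if h b = f a then (1 : k) else 0)

theorem wedge_skew (f : Fin i → Fin N) : IsSkew (wedge k f) := fun τ h => by
  unfold wedge
  rw [← Matrix.det_permute']
  rfl

theorem wedge_self {f : Fin i → Fin N} (hf : Function.Injective f) : wedge k f f = 1 := by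
  unfold wedge
  rw [← Matrix.det_one (n := Fin i)]
  congr 1
  ext a b
  simp [Matrix.one_apply, hf.eq_iff, eq_comm]

theorem mem_range_of_wedge_ne_zero {f h : Fin i → Fin N} (hh : wedge k f h ≠ 0) (b : Fin i) :
    h b ∈ Set.range f := by
  by_contra hc
  exact hh (Matrix.det_eq_zero_of_column_eq_zero b fun a => if_neg fun h' => hc ⟨a, h'.symm⟩)

theorem wedge_dotProduct (f : Fin i → Fin N) (w : Tup k N i) :
    wedge k f ⬝ᵥ w = altSum w f := by
  have h1 : ∀ h : Fin i → Fin N, wedge k f h =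
      ∑ τ : Equiv.Perm (Fin i), ((Equiv.Perm.sign τ : ℤ) : k) * if h = f ∘ τ then 1 else 0 := by
    intro h
    unfold wedge
    rw [Matrix.det_apply']
    refine Finset.sum_congr rfl fun τ _ => ?_
    congr 1
    simp only [Matrix.of_apply]
    split_ifs with h2
    · exact Finset.prod_eq_one fun b _ => if_pos (congrFun h2 b)
    · obtain ⟨b, hb⟩ := Function.ne_iff.1 h2
      exact Finset.prod_eq_zero (Finset.mem_univ b) (if_neg hb)
  simp only [dotProduct, h1, Finset.sum_mul, altSum]
  rw [Finset.sum_comm]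
  refine Finset.sum_congr rfl fun τ _ => ?_
  rw [Finset.sum_eq_single (f ∘ τ)]
  · simp
  · intro h _ hh
    simp [hh]
  · simp

end Tuples

/-! ### Coordinates on exterior powers -/

section Coordinates

variable {k : Type*} [Field k] {N i : ℕ}

/-- The embedding of `⋀ ^ i (k ^ N)` into the tensors of degree `i`, with
`v 0 ∧ ⋯ ∧ v (i-1) ↦ ∑ τ, sign τ • v (τ 0) ⊗ ⋯ ⊗ v (τ (i-1))`. -/
def phi (k : Type*) [Field k] (N i : ℕ) : ⋀[k]^i (Fin N → k) →ₗ[k] Tup k N i :=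
  LinearMap.pi fun f => exteriorPower.alternatingMapLinearEquiv
    (Matrix.detRowAlternating.compLinearMap (LinearMap.funLeft k k f))

theorem phi_ιMulti (v : Fin i → Fin N → k) (f : Fin i → Fin N) :
    phi k N i (exteriorPower.ιMulti k i v) f = Matrix.det (Matrix.of fun a b => v a (f b)) := by
  simp only [phi, LinearMap.pi_apply, exteriorPower.alternatingMapLinearEquiv_apply_ιMulti]
  rfl

theorem phi_map (g : Matrix (Fin N) (Fin N) k) (x : ⋀[k]^i (Fin N → k)) :
    phi k N i (exteriorPower.map i (Matrix.toLin' g) x) = tact g (phi k N i x) := by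
  have : phi k N i ∘ₗ exteriorPower.map i (Matrix.toLin' g) = tact g ∘ₗ phi k N i := by
    refine exteriorPower.linearMap_ext (AlternatingMap.ext fun v => ?_)
    funext f
    simp only [LinearMap.compAlternatingMap_apply, LinearMap.comp_apply,
      exteriorPower.map_apply_ιMulti, phi_ιMulti, tact_apply]
    have h1 : (Matrix.of fun a b => (Matrix.toLin' g ∘ v) a (f b))ᵀ =
        fun b => ∑ x, g (f b) x • fun a => v a x := by
      ext b a
      simp [Matrix.mulVec, dotProduct]
    rw [← Matrix.det_transpose, h1]
    have h2 := (Matrix.detRowAlternating (R := k) (n := Fin i)).toMultilinearMap.map_sum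
      (fun b x => g (f b) x • fun a => v a x)
    refine h2.trans (Finset.sum_congr rfl fun h _ => ?_)
    rw [MultilinearMap.map_smul_univ, smul_eq_mul]
    congr 1
    rw [← Matrix.det_transpose]
    rfl
  exact LinearMap.congr_fun this x

theorem phi_injective : Function.Injective (phi k N i) := by
  rw [injective_iff_map_eq_zero]
  intro x hx
  refine ((Pi.basisFun k (Fin N)).exteriorPower (n := i)).ext_elem fun s => ?_
  rw [map_zero, Finsupp.zero_apply, exteriorPower.basis_repr_apply]
  have : exteriorPower.ιMultiDual k i (Pi.basisFun k (Fin N)) s =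
      LinearMap.proj (Set.powersetCard.ofFinEmbEquiv.symm s : Fin i → Fin N) ∘ₗ phi k N i := by
    refine exteriorPower.linearMap_ext (AlternatingMap.ext fun v => ?_)
    simp only [LinearMap.compAlternatingMap_apply, LinearMap.comp_apply, LinearMap.proj_apply,
      phi_ιMulti, exteriorPower.ιMultiDual_apply_ιMulti]
    congr 1
  rw [this, LinearMap.comp_apply, hx]
  rfl

theorem phi_skew (x : ⋀[k]^i (Fin N → k)) : IsSkew (phi k N i x) := fun τ f => by
  have : LinearMap.proj (f ∘ τ) ∘ₗ phi k N i =
      ((Equiv.Perm.sign τ : ℤ) : k) • (LinearMap.proj f ∘ₗ phi k N i) := by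
    refine exteriorPower.linearMap_ext (AlternatingMap.ext fun v => ?_)
    simp only [LinearMap.compAlternatingMap_apply, LinearMap.comp_apply, LinearMap.proj_apply,
      phi_ιMulti, LinearMap.smul_apply, smul_eq_mul]
    rw [← Matrix.det_permute']
    rfl
  exact LinearMap.congr_fun this x

end Coordinates

/-! ### Elements of the groups -/

section Groups

variable (X : CType) (l : ℕ) (k : Type*) [Field k]

/-- The Gram matrix of the invariant bilinear form, with the convention that it is zero in
type `A`, so that in all types the group consists of the `g` of determinant one with
`gᵀ * form * g = form`. -/
def form : (X : CType) → (l : ℕ) → Matrix (Fin (dim X l)) (Fin (dim X l)) k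
  | .A, _ => 0
  | .B, l => symForm k (dim .B l)
  | .C, l => altForm k (dim .C l)

/-- The nonzero entry of the Gram matrix in row `p`. -/
def formSign : (X : CType) → (l : ℕ) → Fin (dim X l) → k
  | .A, _, _ => 0
  | .B, _, _ => 1
  | .C, l, p => if (p : ℕ) < l then 1 else -1

theorem form_apply (p q : Fin (dim X l)) :
    form k X l p q = if q = p.rev then formSign k X l p else 0 := by
  cases X
  · simp [form, formSign]
  · simp [form, formSign, symForm]
  · simp only [form, formSign, altForm, Matrix.of_apply]
    split_ifs with h1 h2 h3 h3
    · rfl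
    · exfalso
      subst h1
      rw [Fin.lt_def, Fin.val_rev] at h2
      simp only [dim] at *
      omega
    · exfalso
      subst h1
      rw [Fin.lt_def, Fin.val_rev] at h2
      simp only [dim] at *
      omega
    · rfl
    · rfl

/-- The sign of the bilinear form: symmetric in type `B`, alternating in type `C`. -/
def formParity (k : Type*) [Field k] : CType → k
  | .C => -1
  | _ => 1

theorem formParity_mul_self : formParity k X * formParity k X = 1 := by
  cases X <;> simp [formParity]

theorem formSign_rev (hX : X ≠ .A) (p : Fin (dim X l)) :
    formSign k X l p * formSign k X l p.rev = formParity k X := by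
  cases X
  · exact absurd rfl hX
  · simp [formSign, formParity]
  · simp only [formSign, Fin.val_rev, dim, formParity]
    have := p.2
    simp only [dim] at this
    split_ifs <;> first | omega | simp

theorem formSign_mul_self (hX : X ≠ .A) (p : Fin (dim X l)) :
    formSign k X l p * formSign k X l p = 1 := by
  cases X
  · exact absurd rfl hX
  · simp [formSign]
  · simp only [formSign]
    split_ifs <;> simp

theorem mem_group_iff (g : Matrix.SpecialLinearGroup (Fin (dim X l)) k) :
    g ∈ group k X l ↔ (g : Matrix (Fin (dim X l)) (Fin (dim X l)) k)ᵀ * form k X l *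
      (g : Matrix (Fin (dim X l)) (Fin (dim X l)) k) = form k X l := by
  cases X
  · simp [group, form]
  · rfl
  · rfl

theorem form_mul_form (hX : X ≠ .A) :
    form k X l * form k X l = formParity k X • 1 := by
  ext p q
  rw [Matrix.mul_apply, Finset.sum_eq_single p.rev]
  · rw [form_apply, if_pos rfl, form_apply, Fin.rev_rev]
    simp only [Matrix.smul_apply, Matrix.one_apply, smul_eq_mul]
    by_cases h : q = p
    · rw [if_pos h, if_pos h.symm, formSign_rev X l k hX, mul_one]
    · rw [if_neg h, if_neg (Ne.symm h), mul_zero, mul_zero]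
  · intro r _ hr
    rw [form_apply, if_neg hr, zero_mul]
  · simp

variable {X l k}

/-- The matrix of an element of the group. -/
abbrev mat (g : Gp X l k) : Matrix (Fin (dim X l)) (Fin (dim X l)) k := g.1

theorem mat_form (g : Gp X l k) : (mat g)ᵀ * form k X l * mat g = form k X l :=
  (mem_group_iff X l k g.1).1 g.2

theorem mat_mul (g h : Gp X l k) : mat (g * h) = mat g * mat h := rfl

theorem mat_one : mat (1 : Gp X l k) = 1 := rfl

theorem mat_form' (g : Gp X l k) : mat g * form k X l * (mat g)ᵀ = form k X l := by
  by_cases hX : X = .A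
  · subst hX
    simp [form]
  · have hc := formParity_mul_self X k
    have h1 := form_mul_form X l k hX
    have h2 := mat_form g
    set J := form k X l
    set c := formParity k X
    have h3 : (c • (J * (mat g)ᵀ * J)) * mat g = 1 := by
      calc (c • (J * (mat g)ᵀ * J)) * mat g = c • (J * ((mat g)ᵀ * J * mat g)) := by
            simp only [smul_mul_assoc, Matrix.mul_assoc]
        _ = 1 := by rw [h2, h1, smul_smul, hc, one_smul]
    have h4 : mat g * (c • (J * (mat g)ᵀ * J)) = 1 := mul_eq_one_comm.1 h3
    calc mat g * J * (mat g)ᵀ = mat g * J * (mat g)ᵀ * (c • (J * J)) := by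
          rw [h1, smul_smul, hc, one_smul, mul_one]
      _ = (mat g * (c • (J * (mat g)ᵀ * J))) * J := by
          simp only [mul_smul_comm, smul_mul_assoc, Matrix.mul_assoc]
      _ = J := by rw [h4, one_mul]

/-- The groups are closed under transposition. -/
def transp (g : Gp X l k) : Gp X l k :=
  ⟨⟨(mat g)ᵀ, by rw [Matrix.det_transpose]; exact g.1.2⟩,
    (mem_group_iff X l k _).2 (by simpa using mat_form' g)⟩

theorem mat_transp (g : Gp X l k) : mat (transp g) = (mat g)ᵀ := rfl

/-- The nilpotent elements of the Lie algebra of the group whose exponential is quadratic. -/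
structure IsRootLike (X : CType) (l : ℕ) {k : Type*} [Field k]
    (A : Matrix (Fin (dim X l)) (Fin (dim X l)) k) : Prop where
  cube : A * (A * A) = 0
  lie : Aᵀ * form k X l = - (form k X l * A)

theorem uexp_mul_neg {N : ℕ} [CharZero k] {A : Matrix (Fin N) (Fin N) k} (h : A * (A * A) = 0)
    (t : k) : uexp A (-t) * uexp A t = 1 := by
  have h1 : A * A * A = 0 := by rw [Matrix.mul_assoc, h]
  have h2 : A * A * (A * A) = 0 := by rw [Matrix.mul_assoc, h, mul_zero]
  simp only [uexp, mul_add, add_mul, smul_mul_assoc, mul_smul_comm, one_mul, mul_one, h, h1, h2,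
    smul_zero, add_zero]
  match_scalars <;> field_simp <;> ring

theorem det_uexp {N : ℕ} [CharZero k] {A : Matrix (Fin N) (Fin N) k} (h : A * (A * A) = 0)
    (t : k) : (uexp A t).det = 1 := by
  have hev : ∀ t : k, (uexpPoly A).det.eval t = (uexp A t).det := fun t => by
    rw [← Polynomial.coe_evalRingHom, RingHom.map_det]
    congr 1
    ext a b
    exact eval_uexpPoly A t a b
  set P := (uexpPoly A).det
  have h1 : P.comp (-Polynomial.X) * P = 1 := Polynomial.funext fun t => by
    simp only [Polynomial.eval_mul, Polynomial.eval_comp, Polynomial.eval_neg, Polynomial.eval_X,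
      Polynomial.eval_one, hev]
    rw [← Matrix.det_mul, uexp_mul_neg h, Matrix.det_one]
  obtain ⟨c, -, hc⟩ := Polynomial.isUnit_iff.1 (IsUnit.of_mul_eq_one_right _ h1)
  have h0 := hev 0
  have ht := hev t
  rw [← hc, Polynomial.eval_C] at h0 ht
  rw [← ht, h0]
  simp [uexp]

/-- The element `exp (t A)` of the group. -/
def expEl [CharZero k] {A : Matrix (Fin (dim X l)) (Fin (dim X l)) k} (h : IsRootLike X l A)
    (t : k) : Gp X l k :=
  ⟨⟨uexp A t, det_uexp h.cube t⟩, (mem_group_iff X l k _).2 (by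
    have h2 : (A * A)ᵀ * form k X l = form k X l * (A * A) := by
      rw [Matrix.transpose_mul, Matrix.mul_assoc, h.lie, mul_neg, ← Matrix.mul_assoc, h.lie,
        neg_mul, neg_neg, Matrix.mul_assoc]
    have h3 : (uexp A t)ᵀ * form k X l = form k X l * uexp A (-t) := by
      simp only [uexp, Matrix.transpose_add, Matrix.transpose_smul, add_mul, mul_add,
        Matrix.transpose_one, one_mul, mul_one, smul_mul_assoc, mul_smul_comm, h.lie, h2]
      module
    rw [Matrix.SpecialLinearGroup.coe_mk, h3, Matrix.mul_assoc, uexp_mul_neg h.cube, mul_one])⟩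

theorem mat_expEl [CharZero k] {A : Matrix (Fin (dim X l)) (Fin (dim X l)) k}
    (h : IsRootLike X l A) (t : k) : mat (expEl h t) = uexp A t := rfl

/-- The root vector that maps `e_b` to `e_a`: the sum of a matrix unit and of the one
determined by it through the invariance of the form. -/
def rootMat (a b : Fin (dim X l)) : Matrix (Fin (dim X l)) (Fin (dim X l)) k :=
  Matrix.of fun x y => (if x = a ∧ y = b then 1 else 0) -
    if x = b.rev ∧ y = a.rev then formSign k X l a * formSign k X l b else 0

theorem rootMat_eq (a b : Fin (dim X l)) : rootMat (k := k) a b = Matrix.single a b 1 -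
    Matrix.single b.rev a.rev (formSign k X l a * formSign k X l b) := by
  ext x y
  simp [rootMat, Matrix.single_apply, eq_comm]

theorem rootMat_sq {a b : Fin (dim X l)} (hab : a ≠ b)
    (h : X ≠ .A → a.rev ≠ a ∧ b.rev ≠ b) : rootMat (k := k) a b * rootMat a b = 0 := by
  rw [rootMat_eq]
  by_cases hX : X = .A
  · subst hX
    simp [formSign, hab.symm]
  · obtain ⟨h1, h2⟩ := h hX
    have h3 : a.rev ≠ b.rev := fun h => hab (Fin.rev_injective h)
    simp [sub_mul, mul_sub, hab.symm, h1, h2.symm, h3]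

theorem rootMat_isRootLike {a b : Fin (dim X l)} (hab : a ≠ b)
    (h : X ≠ .A → a.rev ≠ a ∧ b.rev ≠ b) : IsRootLike X l (rootMat (k := k) a b) := by
  refine ⟨by rw [rootMat_sq hab h, mul_zero], ?_⟩
  by_cases hX : X = .A
  · subst hX
    simp [form]
  ext x y
  rw [Matrix.neg_apply, Matrix.mul_apply, Matrix.mul_apply, Finset.sum_eq_single y.rev,
    Finset.sum_eq_single x.rev]
  · have ha := formSign_mul_self X l k hX a
    have hb := formSign_mul_self X l k hX b
    have ha' := formSign_rev X l k hX a
    have hb' := formSign_rev X l k hX b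
    simp only [form_apply, Fin.rev_rev, Matrix.transpose_apply, rootMat, Matrix.of_apply, if_true,
      Fin.rev_eq_iff (i := x), Fin.rev_eq_iff (i := y), Fin.rev_rev]
    have hP : y = a.rev ∧ x = b →
        formSign k X l y.rev = formSign k X l a ∧ formSign k X l x = formSign k X l b := by
      rintro ⟨rfl, rfl⟩
      simp
    have hQ : x = a.rev ∧ y = b → formSign k X l y.rev = formSign k X l b.rev ∧
        formSign k X l x = formSign k X l a.rev := by
      rintro ⟨rfl, rfl⟩
      simp
    have e1 : (y = b ∧ x = a.rev) = (x = a.rev ∧ y = b) := propext and_comm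
    have e2 : (x = b ∧ y = a.rev) = (y = a.rev ∧ x = b) := propext and_comm
    simp only [e1, e2]
    set sa := formSign k X l a
    set sb := formSign k X l b
    have hsa : formSign k X l a.rev = formParity k X * sa := by
      linear_combination sa * ha' - formSign k X l a.rev * ha
    have hsb : formSign k X l b.rev = formParity k X * sb := by
      linear_combination sb * hb' - formSign k X l b.rev * hb
    by_cases g1 : y = a.rev ∧ x = b <;> by_cases g2 : x = a.rev ∧ y = b
    · simp only [if_pos g1, if_pos g2, (hP g1).1, (hP g1).2]
      linear_combination (-sb) * ha - sa * hb
    · simp only [if_pos g1, if_neg g2, (hP g1).1, (hP g1).2]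
      linear_combination (-sa) * hb
    · simp only [if_neg g1, if_pos g2, (hQ g2).1, (hQ g2).2, hsa, hsb]
      linear_combination (-formParity k X * sa) * hb
    · simp only [if_neg g1, if_neg g2]
      ring
  · intro r _ hr
    rw [form_apply, if_neg hr, zero_mul]
  · simp
  · intro r _ hr
    rw [form_apply, if_neg (fun h => hr (by rw [h, Fin.rev_rev])), mul_zero]
  · simp

end Groups

/-! ### Root vectors, tori and stable spaces of tensors -/

section Stable

variable {X : CType} {l : ℕ} {k : Type*} [Field k] {i : ℕ}

/-- The index of the middle basis vector in type `B`. -/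
def mid (l : ℕ) : Fin (dim .B l) := ⟨l, by simp only [dim]; omega⟩

theorem rev_mid (l : ℕ) : (mid l).rev = mid l := by
  apply Fin.ext
  simp only [mid, Fin.val_rev, dim]
  omega

theorem rev_ne_self_iff {p : Fin (dim .B l)} : p.rev ≠ p ↔ p ≠ mid l := by
  have := p.2
  simp only [dim] at this
  rw [Ne, Ne, Fin.ext_iff, Fin.ext_iff, Fin.val_rev]
  simp only [mid, dim]
  omega

/-- The root vector of type `B` with `e_l ↦ e_p` and `e_{N-1-p} ↦ - e_l`. -/
def shortMat (p : Fin (dim .B l)) : Matrix (Fin (dim .B l)) (Fin (dim .B l)) k :=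
  Matrix.single p (mid l) 1 - Matrix.single (mid l) p.rev 1

theorem shortMat_isRootLike {p : Fin (dim .B l)} (hp : p ≠ mid l) :
    IsRootLike .B l (shortMat (k := k) p) := by
  have h1 : p.rev ≠ p := rev_ne_self_iff.2 hp
  have h2 : p.rev ≠ mid l := fun h => hp (by rw [← Fin.rev_rev p, h, rev_mid])
  constructor
  · simp [shortMat, mul_sub, sub_mul, hp.symm, h1, h2]
  · ext x y
    rw [Matrix.neg_apply, Matrix.mul_apply, Matrix.mul_apply, Finset.sum_eq_single y.rev,
      Finset.sum_eq_single x.rev]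
    · simp only [form_apply, formSign, Fin.rev_rev, if_true, Matrix.transpose_apply, shortMat,
        Matrix.sub_apply, Matrix.single_apply, mul_one, one_mul, neg_sub]
      have e1 : ∀ z : Fin (dim .B l), p = z.rev ↔ p.rev = z := fun z =>
        ⟨fun h => by rw [h, Fin.rev_rev], fun h => by rw [← h, Fin.rev_rev]⟩
      have e2 : ∀ z : Fin (dim .B l), mid l = z.rev ↔ mid l = z := fun z =>
        ⟨fun h => by rw [← rev_mid, h, Fin.rev_rev], fun h => by rw [← h, rev_mid]⟩
      simp only [e1, e2, and_comm]
    · intro r _ hr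
      rw [form_apply, if_neg hr, zero_mul]
    · simp
    · intro r _ hr
      rw [form_apply, if_neg (fun h => hr (by rw [h, Fin.rev_rev])), mul_zero]
    · simp

/-- The entries of the diagonal matrix with `t` in position `p` and `t⁻¹` in position `q`. -/
def torusEntry {N : ℕ} (p q : Fin N) (t : k) (x : Fin N) : k :=
  (if x = p then t else 1) * (if x = q then t⁻¹ else 1)

/-- The pairs `(p, q)` for which the group contains the diagonal matrices with entries `t` and
`t⁻¹` in the positions `p` and `q`. -/
def IsToral (X : CType) (l : ℕ) (p q : Fin (dim X l)) : Prop :=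
  p ≠ q ∧ (X ≠ .A → q = p.rev)

/-- The diagonal matrix with `t` in position `p` and `t⁻¹` in position `q`, as an element of the
group. -/
def torusEl {p q : Fin (dim X l)} (h : IsToral X l p q) {t : k} (ht : t ≠ 0) : Gp X l k :=
  ⟨⟨Matrix.diagonal (torusEntry p q t), by
    rw [Matrix.det_diagonal]
    simp only [torusEntry, Finset.prod_mul_distrib, Finset.prod_ite_eq', Finset.mem_univ, if_true]
    exact mul_inv_cancel₀ ht⟩, (mem_group_iff X l k _).2 (by
    ext x y
    rw [Matrix.SpecialLinearGroup.coe_mk, Matrix.diagonal_transpose, Matrix.mul_diagonal,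
      Matrix.diagonal_mul, form_apply]
    by_cases hX : X = .A
    · subst hX
      simp [formSign]
    have hq := h.2 hX
    have hpq := h.1
    subst hq
    split_ifs with hy
    · subst hy
      simp only [torusEntry, Fin.rev_eq_iff (i := x)]
      by_cases h1 : x = p
      · subst h1
        simp only [hpq, Fin.rev_rev, if_true, if_false, mul_one, one_mul]
        field_simp
      · by_cases h2 : x = p.rev
        · subst h2
          simp only [hpq.symm, Fin.rev_rev, if_true, if_false, mul_one, one_mul]
          field_simp
        · simp [h1, h2]
    · simp)⟩

theorem mat_torusEl {p q : Fin (dim X l)} (h : IsToral X l p q) {t : k} (ht : t ≠ 0) :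
    mat (torusEl h ht) = Matrix.diagonal (torusEntry p q t) := rfl

theorem prod_ite_eq_of_injective {N : ℕ} {f : Fin i → Fin N} (hf : Function.Injective f)
    (p : Fin N) (t : k) :
    ∏ j, (if f j = p then t else 1) = if p ∈ Set.range f then t else 1 := by
  classical
  split_ifs with h
  · obtain ⟨a, rfl⟩ := h
    simp [hf.eq_iff]
  · exact Finset.prod_eq_one fun j _ => if_neg fun hj => h ⟨j, hj⟩

theorem prod_torusEntry {N : ℕ} {f : Fin i → Fin N} (hf : Function.Injective f)
    (p q : Fin N) (t : k) : ∏ j, torusEntry p q t (f j) =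
      (if p ∈ Set.range f then t else 1) * (if q ∈ Set.range f then t⁻¹ else 1) := by
  simp only [torusEntry, Finset.prod_mul_distrib, prod_ite_eq_of_injective hf]

/-- A space of tensors of degree `i` on the natural module that is stable under the group. -/
def GStable (X : CType) (l : ℕ) (S : Submodule k (Tup k (dim X l) i)) : Prop :=
  ∀ g : Gp X l k, ∀ y ∈ S, tact (mat g) y ∈ S

theorem GStable.derAct_mem [CharZero k] {S : Submodule k (Tup k (dim X l) i)} (hS : GStable X l S)
    {A : Matrix (Fin (dim X l)) (Fin (dim X l)) k} (hA : IsRootLike X l A) {y} (hy : y ∈ S) :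
    derAct A y ∈ S :=
  ModelVariety.derAct_mem A S y fun t => hS (expEl hA t) y hy

/-- The torus projects a stable space of skew tensors to the tensors that involve `e_p` and do
not involve `e_q`. -/
theorem GStable.proj_mem [CharZero k] {S : Submodule k (Tup k (dim X l) i)} (hS : GStable X l S)
    {p q : Fin (dim X l)} (h : IsToral X l p q) {y} (hy : y ∈ S) (hsk : IsSkew y) :
    (open scoped Classical in fun f => if p ∈ Set.range f ∧ q ∉ Set.range f then y f else 0) ∈ S := by
  classical
  have h2 : (2 : k) ≠ 0 := two_ne_zero
  set g := torusEl h h2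
  have hz : ∀ z ∈ S, tact (mat g) z - z ∈ S := fun z hz => S.sub_mem (hS g z hz) hz
  have hz' : ∀ z ∈ S, (2 : k) • tact (mat g) z - z ∈ S := fun z hz =>
    S.sub_mem (S.smul_mem _ (hS g z hz)) hz
  have hev : ∀ (z : Tup k (dim X l) i) (f : Fin i → Fin (dim X l)), Function.Injective f →
      tact (mat g) z f = (if p ∈ Set.range f then 2 else 1) *
        (if q ∈ Set.range f then 2⁻¹ else 1) * z f := fun z f hf => by
    rw [mat_torusEl, tact_diagonal, prod_torusEntry hf]
  -- the eigenvalues are `2`, `1` and `1 / 2`; the polynomial `(T - 1) (2 T - 1) / 3` singles out `2`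
  have := S.smul_mem (3 : k)⁻¹ (hz _ (hz' y hy))
  convert this using 1
  funext f
  by_cases hf : Function.Injective f
  · simp only [map_sub, map_smul, Pi.smul_apply, Pi.sub_apply, hev _ f hf, smul_eq_mul]
    split_ifs <;> first | (exfalso; tauto) | (field_simp; ring)
  · have h0 : ∀ z : Tup k (dim X l) i, IsSkew z → z f = 0 := fun z hz => by
      by_contra hc
      exact hf (hz.injective hc)
    have h1 := isSkew_tact hsk (mat g)
    have h2 := isSkew_tact h1 (mat g)
    simp [h0 _ hsk, h0 _ h1, h0 _ h2]

end Stable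

/-! ### Primitive tensors -/

section Primitive

theorem sum_update {i N : ℕ} {k : Type*} [Field k] (G : (Fin i → Fin N) → k) (a : Fin i) :
    ∑ h : Fin i → Fin N, ∑ x, G (Function.update h a x) = N * ∑ h, G h := by
  -- `(h, x) ↦ (h[a := x], h a)` is an involution
  let φ : (Fin i → Fin N) × Fin N → (Fin i → Fin N) × Fin N := fun hx =>
    (Function.update hx.1 a hx.2, hx.1 a)
  have hφ : Function.Involutive φ := fun hx => by simp [φ]
  have := Equiv.sum_comp hφ.toPerm fun hx => G hx.1
  simp only [Fintype.sum_prod_type, Finset.sum_const, Finset.card_univ, Fintype.card_fin,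
    nsmul_eq_mul] at this
  rw [Finset.mul_sum, ← this]
  rfl

variable (X : CType) (l : ℕ) (k : Type*) [Field k] (i : ℕ)

/-- The skew tensors all of whose contractions with the invariant bilinear form vanish. In types
`A` and `B` the second condition is void. -/
def prim : Submodule k (Tup k (dim X l) i) where
  carrier := {y | IsSkew y ∧ ∀ (f : Fin i → Fin (dim X l)) (a b : Fin i), a ≠ b →
    ∑ x, ∑ z, form k X l x z * y (Function.update (Function.update f a x) b z) = 0}
  zero_mem' := ⟨fun τ f => by simp, fun f a b _ => by simp⟩
  add_mem' := fun {y z} hy hz => ⟨fun τ f => by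
      simp only [Pi.add_apply, hy.1 τ f, hz.1 τ f, mul_add], fun f a b hab => by
      simp only [Pi.add_apply, mul_add, Finset.sum_add_distrib, hy.2 f a b hab, hz.2 f a b hab,
        add_zero]⟩
  smul_mem' := fun c y hy => ⟨fun τ f => by
      simp only [Pi.smul_apply, smul_eq_mul, hy.1 τ f]
      ring, fun f a b hab => by
      simp only [Pi.smul_apply, smul_eq_mul, mul_left_comm _ c, ← Finset.mul_sum, hy.2 f a b hab,
        mul_zero]⟩

variable {X l k i}

theorem prim_skew {y : Tup k (dim X l) i} (hy : y ∈ prim X l k i) : IsSkew y := hy.1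

theorem prim_contraction {y : Tup k (dim X l) i} (hy : y ∈ prim X l k i)
    (f : Fin i → Fin (dim X l)) {a b : Fin i} (hab : a ≠ b) :
    ∑ x, formSign k X l x * y (Function.update (Function.update f a x) b x.rev) = 0 := by
  rw [← hy.2 f a b hab]
  refine Finset.sum_congr rfl fun x _ => ?_
  simp [form_apply]

theorem prim_stable [CharZero k] : GStable X l (prim X l k i) := by
  intro g y hy
  refine ⟨isSkew_tact hy.1 _, fun f a b hab => ?_⟩
  set J := form k X l
  let R : (Fin i → Fin (dim X l)) → k := fun h =>
    ∏ j ∈ (Finset.univ.erase a).erase b, mat g (f j) (h j)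
  have hmem : b ∈ Finset.univ.erase a := Finset.mem_erase.2 ⟨hab.symm, Finset.mem_univ _⟩
  have h1 : ∑ x, ∑ z, J x z * tact (mat g) y (Function.update (Function.update f a x) b z) =
      ∑ h, R h * J (h a) (h b) * y h := by
    simp only [tact_apply, Finset.mul_sum]
    rw [Finset.sum_congr rfl fun x _ => Finset.sum_comm, Finset.sum_comm]
    refine Finset.sum_congr rfl fun h _ => ?_
    have h2 : ∀ x z, ∏ j, mat g (Function.update (Function.update f a x) b z j) (h j) =
        mat g x (h a) * (mat g z (h b) * R h) := fun x z => by
      rw [← Finset.mul_prod_erase _ _ (Finset.mem_univ a), ← Finset.mul_prod_erase _ _ hmem]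
      congr 1
      · rw [Function.update_of_ne hab, Function.update_self]
      congr 1
      · rw [Function.update_self]
      · refine Finset.prod_congr rfl fun j hj => ?_
        rw [Function.update_of_ne (Finset.ne_of_mem_erase hj),
          Function.update_of_ne (Finset.ne_of_mem_erase (Finset.mem_of_mem_erase hj))]
    have h3 : J (h a) (h b) = ∑ x, ∑ z, mat g x (h a) * J x z * mat g z (h b) := by
      have hJ : (mat g)ᵀ * J * mat g = J := mat_form g
      nth_rewrite 1 [← hJ]
      rw [Matrix.mul_apply, Finset.sum_comm]
      refine Finset.sum_congr rfl fun z _ => ?_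
      rw [Matrix.mul_apply, Finset.sum_mul]
      rfl
    rw [h3]
    simp only [h2, Finset.mul_sum, Finset.sum_mul]
    exact Finset.sum_congr rfl fun x _ => Finset.sum_congr rfl fun z _ => by ring
  rw [h1]
  -- it suffices that the sum over `h a` and `h b` alone vanishes
  have hN : ((dim X l : ℕ) : k) ≠ 0 := by
    have := (f a).pos
    exact_mod_cast this.ne'
  have h4 := sum_update (fun h => R h * J (h a) (h b) * y h) b
  have h5 := sum_update (fun h => ∑ z, R (Function.update h b z) *
    J (Function.update h b z a) (Function.update h b z b) * y (Function.update h b z)) a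
  rw [h4] at h5
  have h6 : ∀ h : Fin i → Fin (dim X l), ∑ x, ∑ z, R (Function.update (Function.update h a x) b z) *
      J (Function.update (Function.update h a x) b z a)
        (Function.update (Function.update h a x) b z b) *
      y (Function.update (Function.update h a x) b z) = 0 := fun h => by
    have h7 : ∀ x z, R (Function.update (Function.update h a x) b z) = R h := fun x z =>
      Finset.prod_congr rfl fun j hj => by
        rw [Function.update_of_ne (Finset.ne_of_mem_erase hj),
          Function.update_of_ne (Finset.ne_of_mem_erase (Finset.mem_of_mem_erase hj))]
    simp only [h7, Function.update_self, Function.update_of_ne hab, mul_assoc, ← Finset.mul_sum]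
    exact mul_eq_zero_of_right _ (hy.2 h a b hab)
  rw [Finset.sum_congr rfl fun h _ => h6 h, Finset.sum_const_zero] at h5
  have h8 := (mul_eq_zero.1 h5.symm).resolve_left hN
  exact (mul_eq_zero.1 h8).resolve_left hN

/-- The tensors `e_{f 0} ∧ e_{f 1} ∧ ⋯` with all indices less than `ℓ` are primitive, since the
span of the `e_p` with `p < ℓ` is isotropic. -/
theorem wedge_mem_prim {f : Fin i → Fin (dim X l)} (hf : ∀ a, (f a : ℕ) < l) :
    wedge k f ∈ prim X l k i := by
  refine ⟨wedge_skew f, fun h a b hab => Finset.sum_eq_zero fun x _ =>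
    Finset.sum_eq_zero fun z _ => ?_⟩
  by_contra hne
  have hJ := left_ne_zero_of_mul hne
  have hw := right_ne_zero_of_mul hne
  obtain ⟨c, hc⟩ := mem_range_of_wedge_ne_zero hw a
  obtain ⟨d, hd⟩ := mem_range_of_wedge_ne_zero hw b
  rw [Function.update_of_ne hab, Function.update_self] at hc
  rw [Function.update_self] at hd
  have hx := hf c
  have hz := hf d
  rw [hc] at hx
  rw [hd] at hz
  rw [form_apply] at hJ
  have h1 : z = x.rev := by
    by_contra h
    exact hJ (if_neg h)
  rw [if_pos h1] at hJ
  cases X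
  · exact hJ rfl
  all_goals
    subst h1
    rw [Fin.val_rev] at hz
    simp only [dim] at *
    omega

theorem le_dim (X : CType) (l : ℕ) : l ≤ dim X l := by
  cases X <;> simp only [dim] <;> omega

/-- The tuple `(0, 1, …, i - 1)`. -/
def stdTuple (X : CType) {l i : ℕ} (hi : i ≤ l) : Fin i → Fin (dim X l) :=
  fun a => ⟨a, a.2.trans_le (hi.trans (le_dim X l))⟩

theorem stdTuple_injective (hi : i ≤ l) : Function.Injective (stdTuple X hi) := fun a b h => by
  simpa [stdTuple, Fin.ext_iff] using h

theorem mem_range_stdTuple (hi : i ≤ l) (x : Fin (dim X l)) :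
    x ∈ Set.range (stdTuple X hi) ↔ (x : ℕ) < i :=
  ⟨fun ⟨a, ha⟩ => by rw [← ha]; exact a.2, fun h => ⟨⟨x, h⟩, rfl⟩⟩

theorem phi_topVector (hi : i ≤ l) :
    phi k (dim X l) i (topVector X l k i) = wedge k (stdTuple X hi) := by
  funext h
  rw [topVector, phi_ιMulti, wedge]
  simp [e, stdTuple, Fin.ext_iff]

theorem wedge_dotProduct_self [CharZero k] {f : Fin i → Fin (dim X l)}
    (hf : Function.Injective f) : wedge k f ⬝ᵥ wedge k f ≠ 0 := by
  rw [wedge_dotProduct, altSum]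
  have : ∀ τ : Equiv.Perm (Fin i),
      ((Equiv.Perm.sign τ : ℤ) : k) * wedge k f (f ∘ τ) = 1 := fun τ => by
    rw [wedge_skew f τ f, wedge_self hf, mul_one]
    rcases Int.units_eq_one_or (Equiv.Perm.sign τ) with h | h <;> simp [h]
  simp only [this, Finset.sum_const, Finset.card_univ, nsmul_eq_mul, mul_one]
  exact_mod_cast Fintype.card_ne_zero

/-- A skew tensor that involves only one set of indices is a multiple of a wedge. -/
theorem eq_smul_wedge [CharZero k] {y : Tup k (dim X l) i} (hy : IsSkew y)
    {f : Fin i → Fin (dim X l)} (hf : Function.Injective f)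
    (h : ∀ h, y h ≠ 0 → ∀ j, h j ∈ Set.range f) : y = y f • wedge k f := by
  funext g
  rw [Pi.smul_apply, smul_eq_mul]
  by_cases hg : ∃ τ : Equiv.Perm (Fin i), g = f ∘ τ
  · obtain ⟨τ, rfl⟩ := hg
    rw [hy τ f, wedge_skew f τ f, wedge_self hf, mul_one, mul_comm]
  · have h1 : ∀ z : Tup k (dim X l) i, IsSkew z → (∀ h, z h ≠ 0 → ∀ j, h j ∈ Set.range f) →
        z g = 0 := fun z hz hzr => by
      by_contra hne
      exact hg (exists_perm (hz.injective hne) (hzr g hne))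
    rw [h1 y hy h, h1 _ (wedge_skew f) fun h hh => mem_range_of_wedge_ne_zero hh, mul_zero]

end Primitive

/-! ### Highest weight vectors in stable spaces of primitive tensors -/

section Highest

variable {X : CType} {l : ℕ} {k : Type*} [Field k] {i : ℕ}

theorem exists_of_derAct_ne_zero {N : ℕ} {A : Matrix (Fin N) (Fin N) k} {y : Tup k N i}
    {f : Fin i → Fin N} (h : derAct A y f ≠ 0) :
    ∃ j x, A (f j) x ≠ 0 ∧ y (Function.update f j x) ≠ 0 := by
  obtain ⟨j, -, hj⟩ := Finset.exists_ne_zero_of_sum_ne_zero h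
  obtain ⟨x, -, hx⟩ := Finset.exists_ne_zero_of_sum_ne_zero hj
  exact ⟨j, x, left_ne_zero_of_mul hx, right_ne_zero_of_mul hx⟩

theorem derAct_sub {N : ℕ} (A B : Matrix (Fin N) (Fin N) k) (y : Tup k N i) :
    derAct (A - B) y = derAct A y - derAct B y := by
  funext f
  simp [derAct, sub_mul, Finset.sum_sub_distrib]

theorem derAct_single_of_mem {N : ℕ} {a b : Fin N} {c : k} (y : Tup k N i)
    {f : Fin i → Fin N} (hf : Function.Injective f) (j : Fin i) (hj : f j = a) :
    derAct (Matrix.single a b c) y f = c * y (Function.update f j b) := by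
  rw [derAct, Finset.sum_eq_single j, Finset.sum_eq_single b]
  · simp [hj]
  · intro x _ hx
    simp [hx.symm]
  · simp
  · intro j' _ hj'
    refine Finset.sum_eq_zero fun x _ => ?_
    have : a ≠ f j' := fun h => hj' (hf (by rw [hj, h]))
    simp [this]
  · simp

theorem derAct_single_of_notMem {N : ℕ} {a b : Fin N} {c : k} (y : Tup k N i)
    {f : Fin i → Fin N} (hf : a ∉ Set.range f) :
    derAct (Matrix.single a b c) y f = 0 := by
  refine Finset.sum_eq_zero fun j _ => Finset.sum_eq_zero fun x _ => ?_
  have : a ≠ f j := fun h => hf ⟨j, h.symm⟩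
  simp [this]

theorem update_injective {N : ℕ} {f : Fin i → Fin N} (hf : Function.Injective f) (j : Fin i)
    {x : Fin N} (hx : x ∉ Set.range f) : Function.Injective (Function.update f j x) := by
  intro a b hab
  by_cases ha : a = j <;> by_cases hb : b = j
  · rw [ha, hb]
  · subst ha
    rw [Function.update_self, Function.update_of_ne hb] at hab
    exact absurd ⟨b, hab.symm⟩ hx
  · subst hb
    rw [Function.update_self, Function.update_of_ne ha] at hab
    exact absurd ⟨a, hab⟩ hx
  · rw [Function.update_of_ne ha, Function.update_of_ne hb] at hab
    exact hf hab

/-- `S` contains a nonzero tensor all of whose nonzero coordinates are at tuples with set of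
values `I`. -/
def HasExact {N : ℕ} (S : Submodule k (Tup k N i)) (I : Finset (Fin N)) : Prop :=
  ∃ y ∈ S, y ≠ 0 ∧ ∀ f, y f ≠ 0 → ∀ x, x ∈ Set.range f ↔ x ∈ I

/-- A root vector `A` with `e_b ↦ c e_a`, `c ≠ 0`, that does not change the other indices in `I`
replaces the index `b` in `I` by `a`. -/
theorem HasExact.move [CharZero k] {S : Submodule k (Tup k (dim X l) i)} (hS : GStable X l S)
    (hsk : ∀ y ∈ S, IsSkew y) {I : Finset (Fin (dim X l))} (hI : HasExact S I)
    {A : Matrix (Fin (dim X l)) (Fin (dim X l)) k} (hA : IsRootLike X l A)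
    {a b : Fin (dim X l)} (hb : b ∈ I) (ha : a ∉ I) (hab : A a b ≠ 0)
    (hA' : ∀ x z, A x z ≠ 0 → x = a ∧ z = b ∨ z ∉ I) : HasExact S (insert a (I.erase b)) := by
  obtain ⟨y, hy, hy0, hyI⟩ := hI
  have key : ∀ f j x, A (f j) x ≠ 0 → y (Function.update f j x) ≠ 0 → f j = a ∧ x = b :=
    fun f j x h1 h2 => (hA' _ _ h1).resolve_right fun h3 =>
      h3 ((hyI _ h2 x).1 ⟨j, Function.update_self _ _ _⟩)
  refine ⟨derAct A y, hS.derAct_mem hA hy, ?_, fun f hf x => ?_⟩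
  · obtain ⟨f, hf⟩ := Function.ne_iff.1 hy0
    rw [Pi.zero_apply] at hf
    obtain ⟨j, hj⟩ := (hyI f hf b).2 hb
    have haf : a ∉ Set.range f := fun h => ha ((hyI f hf a).1 h)
    refine Function.ne_iff.2 ⟨Function.update f j a, ?_⟩
    have h1 : derAct A y (Function.update f j a) = A a b * y f := by
      rw [derAct, Finset.sum_eq_single j, Finset.sum_eq_single b]
      · rw [Function.update_self, Function.update_idem, ← hj, Function.update_eq_self]
      · intro x _ hx
        by_contra hne
        exact hx (key _ _ _ (left_ne_zero_of_mul hne) (right_ne_zero_of_mul hne)).2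
      · simp
      · intro j' _ hj'
        refine Finset.sum_eq_zero fun x _ => ?_
        by_contra hne
        have := (key _ _ _ (left_ne_zero_of_mul hne) (right_ne_zero_of_mul hne)).1
        rw [Function.update_of_ne hj'] at this
        exact haf ⟨j', this⟩
      · simp
    rw [h1]
    exact mul_ne_zero hab hf
  · obtain ⟨j, z, h1, h2⟩ := exists_of_derAct_ne_zero hf
    obtain ⟨hja, rfl⟩ := key _ _ _ h1 h2
    have hinj := (hsk y hy).injective h2
    have hr := hyI _ h2
    rw [Finset.mem_insert, Finset.mem_erase]
    constructor
    · rintro ⟨j', rfl⟩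
      by_cases hj : j' = j
      · rw [hj]
        exact Or.inl hja
      · refine Or.inr ⟨fun h => hj (hinj ?_), (hr _).1 ⟨j', Function.update_of_ne hj _ _⟩⟩
        rw [Function.update_of_ne hj, Function.update_self, h]
    · rintro (rfl | ⟨hne, hx⟩)
      · exact ⟨j, hja⟩
      · obtain ⟨j', hj'⟩ := (hr x).2 hx
        by_cases hj : j' = j
        · rw [hj, Function.update_self] at hj'
          exact absurd hj'.symm hne
        · rw [Function.update_of_ne hj] at hj'
          exact ⟨j', hj'⟩

/-- A set of indices without a pair of opposite indices (no condition in type `A`). -/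
def IsIsotropic (X : CType) (l : ℕ) (I : Finset (Fin (dim X l))) : Prop :=
  X ≠ .A → ∀ a ∈ I, a.rev ∉ I

theorem rev_ge_of_lt (hX : X ≠ .A) {p : Fin (dim X l)} (hp : (p : ℕ) < l) :
    l ≤ (p.rev : ℕ) := by
  rw [Fin.val_rev]
  cases X
  · exact absurd rfl hX
  all_goals
    simp only [dim] at *
    omega

theorem rev_ne_self (hX : X ≠ .A) {p : Fin (dim X l)} (hp : (p : ℕ) < l) : p.rev ≠ p := fun h => by
  have := rev_ge_of_lt hX hp
  rw [h] at this
  omega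

/-- Replacing an index outside `{0, …, i - 1}` by an index in this set. -/
theorem HasExact.exists_move [CharZero k] (hi : i ≤ l) {S : Submodule k (Tup k (dim X l) i)}
    (hS : GStable X l S) (hsk : ∀ y ∈ S, IsSkew y) {I : Finset (Fin (dim X l))}
    (hI : HasExact S I) (hiso : IsIsotropic X l I) {a b : Fin (dim X l)} (ha : a ∉ I)
    (hai : (a : ℕ) < i) (hb : b ∈ I) (hbi : ¬ (b : ℕ) < i) :
    ∃ b ∈ I, ¬ (b : ℕ) < i ∧ HasExact S (insert a (I.erase b)) ∧
      IsIsotropic X l (insert a (I.erase b)) := by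
  by_cases h : X ≠ .A ∧ a.rev ∈ I
  · obtain ⟨hX, har⟩ := h
    have h1 := rev_ge_of_lt hX (hai.trans_le hi)
    have h2 := rev_ne_self hX (hai.trans_le hi)
    refine ⟨a.rev, har, by omega, ?_, fun _ z hz hz' => ?_⟩
    · cases X
      · exact absurd rfl hX
      · have hm : a ≠ mid l := rev_ne_self_iff.1 h2
        have hm' : a.rev ≠ mid l := fun h => hm (by rw [← Fin.rev_rev a, h, rev_mid])
        have hmI : mid l ∉ I := fun h => by
          have := hiso hX _ h
          rw [rev_mid] at this
          exact this h
        have hR := shortMat_isRootLike (k := k) hm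
        have s1 := hI.move hS hsk hR har hmI (by simp [shortMat, hm])
          fun x z hxz => by
            by_cases hz : z = a.rev
            · subst hz
              refine Or.inl ⟨?_, rfl⟩
              by_contra hx
              exact hxz (by simp [shortMat, hm'.symm, Ne.symm hx])
            · by_cases hz' : z = mid l
              · exact Or.inr (hz' ▸ hmI)
              · exact absurd (by simp [shortMat, Ne.symm hz, Ne.symm hz']) hxz
        have s2 := s1.move hS hsk hR (a := a) (b := mid l) (Finset.mem_insert_self _ _)
          (by simp [hm, ha]) (by simp [shortMat, hm'])
          fun x z hxz => by
            by_cases hz : z = a.rev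
            · subst hz
              exact Or.inr (by simp [hm'])
            · by_cases hz' : z = mid l
              · subst hz'
                refine Or.inl ⟨?_, rfl⟩
                by_contra hx
                exact hxz (by simp [shortMat, hm', Ne.symm hx])
              · exact absurd (by simp [shortMat, Ne.symm hz, Ne.symm hz']) hxz
        rwa [Finset.erase_insert (by simp [hmI])] at s2
      · refine hI.move hS hsk (rootMat_isRootLike (a := a) (b := a.rev) h2.symm fun _ =>
          ⟨h2, by rw [Fin.rev_rev]; exact h2.symm⟩) har ha ?_ fun x z hxz => ?_
        · have := formSign_rev .C l k hX a
          simp only [rootMat, Matrix.of_apply, Fin.rev_rev, and_self, if_true, this, formParity]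
          norm_num
        · refine Or.inl ?_
          by_contra hc
          exact hxz (by simp [rootMat, hc])
    · rw [Finset.mem_insert, Finset.mem_erase] at hz hz'
      rcases hz with rfl | ⟨hz1, hz2⟩
      · rcases hz' with hz' | ⟨hz', -⟩
        · exact h2 hz'
        · exact hz' rfl
      · rcases hz' with hz' | ⟨-, hz'⟩
        · exact hz1 (by rw [← hz', Fin.rev_rev])
        · exact hiso hX z hz2 hz'
  · have har : X ≠ .A → a.rev ∉ I := fun hX h' => h ⟨hX, h'⟩
    have hab : a ≠ b := fun h => ha (h ▸ hb)
    refine ⟨b, hb, hbi, ?_, fun hX z hz hz' => ?_⟩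
    · refine hI.move hS hsk (rootMat_isRootLike hab fun hX => ⟨rev_ne_self hX (hai.trans_le hi),
        fun h' => hiso hX b hb (h'.symm ▸ hb)⟩) hb ha ?_ fun x z hxz => ?_
      · by_cases hX : X = .A
        · subst hX
          simp [rootMat, formSign]
        · have : b ≠ a.rev := fun h => har hX (h ▸ hb)
          simp [rootMat, this]
      · by_cases hX : X = .A
        · subst hX
          refine Or.inl ?_
          by_contra hc
          exact hxz (by simp [rootMat, formSign, hc])
        · by_cases hc : x = a ∧ z = b
          · exact Or.inl hc
          · refine Or.inr fun hz => hxz ?_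
            have : z ≠ a.rev := fun h => har hX (h ▸ hz)
            simp [rootMat, hc, this]
    · rw [Finset.mem_insert, Finset.mem_erase] at hz hz'
      rcases hz with rfl | ⟨hz1, hz2⟩
      · rcases hz' with hz' | ⟨-, hz'⟩
        · exact rev_ne_self hX (hai.trans_le hi) hz'
        · exact har hX hz'
      · rcases hz' with hz' | ⟨-, hz'⟩
        · exact har hX (by rw [← hz', Fin.rev_rev]; exact hz2)
        · exact hiso hX z hz2 hz'

/-- Among the isotropic sets `I` of size `i` with `HasExact S I`, one that meets `{0, …, i - 1}` in as
many elements as possible is equal to it. -/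
theorem HasExact.wedge_mem [CharZero k] (hi : i ≤ l) {S : Submodule k (Tup k (dim X l) i)}
    (hS : GStable X l S) (hsk : ∀ y ∈ S, IsSkew y) {I : Finset (Fin (dim X l))}
    (hI : HasExact S I) (hiso : IsIsotropic X l I) (hcard : I.card = i) :
    wedge k (stdTuple X hi) ∈ S := by
  classical
  set F : Finset (Fin (dim X l)) := Finset.univ.filter fun x => (x : ℕ) < i with hF
  have hFcard : F.card = i := by
    have : F = Finset.univ.image (stdTuple X hi) := by
      ext x
      have := mem_range_stdTuple hi x
      simp only [Set.mem_range] at this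
      simp [hF, this]
    rw [this, Finset.card_image_of_injective _ (stdTuple_injective hi), Finset.card_univ,
      Fintype.card_fin]
  obtain ⟨I, hI, hmax⟩ := (Finset.univ.filter fun I : Finset (Fin (dim X l)) =>
    HasExact S I ∧ IsIsotropic X l I ∧ I.card = i).exists_max_image (fun I => (I ∩ F).card)
    ⟨I, by simp [hI, hiso, hcard]⟩
  simp only [Finset.mem_filter, Finset.mem_univ, true_and] at hI hmax
  obtain ⟨hI, hiso, hcard⟩ := hI
  have hIF : I = F := by
    by_contra hne
    have h1 : ¬ F ⊆ I := fun h => hne (Finset.eq_of_subset_of_card_le h (by omega)).symm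
    have h2 : ¬ I ⊆ F := fun h => hne (Finset.eq_of_subset_of_card_le h (by omega))
    obtain ⟨a, haF, haI⟩ := Finset.not_subset.1 h1
    obtain ⟨b, hbI, hbF⟩ := Finset.not_subset.1 h2
    simp only [hF, Finset.mem_filter, Finset.mem_univ, true_and] at haF hbF
    obtain ⟨b, hbI, hbF, h3, h4⟩ := hI.exists_move hi hS hsk hiso haI haF hbI hbF
    have h5 := hmax _ ⟨h3, h4, by
      rw [Finset.card_insert_of_notMem (by simp [haI]), Finset.card_erase_of_mem hbI, hcard]
      have := a.2
      omega⟩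
    have haF' : a ∈ F := by simp [hF, haF]
    have hbF' : b ∉ F := by simp [hF, not_lt.1 hbF]
    rw [Finset.insert_inter_of_mem haF', Finset.erase_inter,
      Finset.erase_eq_of_notMem (by simp [hbF']), Finset.card_insert_of_notMem (by simp [haI])] at h5
    omega
  obtain ⟨y, hy, hy0, hyI⟩ := hI
  have h6 := eq_smul_wedge (hsk y hy) (stdTuple_injective hi) fun h hh j => by
    rw [mem_range_stdTuple]
    have := (hyI h hh (h j)).1 ⟨j, rfl⟩
    rw [hIF] at this
    simpa [hF] using this
  have h7 : y (stdTuple X hi) ≠ 0 := fun h => hy0 (by rw [h6, h, zero_smul])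
  have h8 : wedge k (stdTuple X hi) = (y (stdTuple X hi))⁻¹ • y :=
    (eq_inv_smul_iff₀ h7).2 h6.symm
  rw [h8]
  exact S.smul_mem _ hy

end Highest

/-! ### Tensors with a single set of indices -/

section Isolate

variable {X : CType} {l : ℕ} {k : Type*} [Field k] {i : ℕ}

/-- In type `A`, the torus separates a set `I` of indices from all the others of the same size: the
indices of `I` are paired with an index `q` outside of `I`. -/
theorem hasExact_typeA [CharZero k] (hi : i ≤ l) {S : Submodule k (Tup k (dim .A l) i)}
    (hS : GStable .A l S) (hsk : ∀ y ∈ S, IsSkew y) (h0 : S ≠ ⊥) :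
    ∃ I : Finset (Fin (dim .A l)), I.card = i ∧ HasExact S I := by
  classical
  obtain ⟨y, hy, hy0⟩ := S.ne_bot_iff.1 h0
  obtain ⟨f, hf⟩ := Function.ne_iff.1 hy0
  rw [Pi.zero_apply] at hf
  have hinj := (hsk y hy).injective hf
  set I := Finset.univ.image f with hI
  have hIcard : I.card = i := by
    rw [hI, Finset.card_image_of_injective _ hinj, Finset.card_univ, Fintype.card_fin]
  obtain ⟨q, hq⟩ : ∃ q, q ∉ I := by
    by_contra! hc
    have h1 := Finset.card_le_card (fun x _ => hc x : Finset.univ ⊆ I)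
    rw [Finset.card_univ, Fintype.card_fin, hIcard] at h1
    simp only [dim] at h1
    omega
  have key : ∀ J ⊆ I, ∃ y ∈ S, y f ≠ 0 ∧ ∀ g, y g ≠ 0 → ∀ p ∈ J, p ∈ Set.range g := by
    intro J
    induction J using Finset.induction_on with
    | empty => exact fun _ => ⟨y, hy, hf, by simp⟩
    | insert p J hp ih =>
      intro hJ
      rw [Finset.insert_subset_iff] at hJ
      obtain ⟨z, hz, hzf, hzJ⟩ := ih hJ.2
      have hpq : p ≠ q := fun h => hq (h ▸ hJ.1)
      refine ⟨_, hS.proj_mem (p := p) (q := q) ⟨hpq, by simp⟩ hz (hsk z hz), ?_, ?_⟩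
      · rw [if_pos]
        · exact hzf
        · simpa [hI] using And.intro hJ.1 hq
      · intro g hg
        split_ifs at hg with hc
        · intro p' hp'
          rcases Finset.mem_insert.1 hp' with rfl | hp'
          · exact hc.1
          · exact hzJ g hg p' hp'
        · exact absurd rfl hg
  obtain ⟨z, hz, hzf, hzI⟩ := key I subset_rfl
  refine ⟨I, hIcard, z, hz, fun h => hzf (by rw [h]; rfl), fun g hg x => ?_⟩
  have h1 : I ⊆ Finset.univ.image g := fun p hp => by
    simpa using hzI g hg p hp
  have h2 : I = Finset.univ.image g := by
    refine Finset.eq_of_subset_of_card_le h1 ?_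
    rw [hIcard]
    exact Finset.card_image_le.trans (by simp)
  rw [h2]
  simp

/-- The nonzero coordinates of `y` are at tuples that contain the indices in `A`, and not
the opposite ones. -/
def SupportedOver {N : ℕ} (y : Tup k N i) (A : Finset (Fin N)) : Prop :=
  ∀ f, y f ≠ 0 → ∀ a ∈ A, a ∈ Set.range f ∧ a.rev ∉ Set.range f

theorem SupportedOver.derAct {N : ℕ} {y : Tup k N i} {A : Finset (Fin N)}
    (hy : SupportedOver y A) {R : Matrix (Fin N) (Fin N) k}
    (hR : ∀ x z, R x z ≠ 0 → x.rev ∉ A ∧ z ∉ A) : SupportedOver (derAct R y) A := by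
  intro f hf a ha
  obtain ⟨j, x, h1, h2⟩ := exists_of_derAct_ne_zero hf
  obtain ⟨h3, h4⟩ := hR _ _ h1
  obtain ⟨⟨j', hj'⟩, h6⟩ := hy _ h2 a ha
  constructor
  · by_cases h : j' = j
    · rw [h, Function.update_self] at hj'
      exact absurd (hj' ▸ ha) h4
    · exact ⟨j', by rwa [Function.update_of_ne h] at hj'⟩
  · rintro ⟨c, hc⟩
    by_cases h : c = j
    · rw [← h, hc, Fin.rev_rev] at h3
      exact h3 ha
    · exact h6 ⟨c, by rwa [Function.update_of_ne h]⟩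

/-- In types `B` and `C` there is a set `A` of maximal size over which a nonzero tensor in `S` is
supported. By maximality, if such a tensor has a nonzero coordinate at a tuple that contains `p` and
does not contain the opposite index, then `p ∈ A`. -/
theorem exists_maximal_supportedOver [CharZero k]
    {S : Submodule k (Tup k (dim X l) i)} (hS : GStable X l S) (hsk : ∀ y ∈ S, IsSkew y)
    (h0 : S ≠ ⊥) : ∃ A : Finset (Fin (dim X l)), (∃ y ∈ S, y ≠ 0 ∧ SupportedOver y A) ∧
      ∀ y ∈ S, SupportedOver y A → ∀ f, y f ≠ 0 → ∀ p ∈ Set.range f, p.rev ∉ Set.range f →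
        p ∈ A := by
  classical
  obtain ⟨y, hy, hy0⟩ := S.ne_bot_iff.1 h0
  obtain ⟨A, hA, hmax⟩ := (Finset.univ.filter fun A : Finset (Fin (dim X l)) =>
    ∃ y ∈ S, y ≠ 0 ∧ SupportedOver y A).exists_max_image Finset.card
    ⟨∅, by simpa using ⟨y, hy, hy0, by simp [SupportedOver]⟩⟩
  simp only [Finset.mem_filter, Finset.mem_univ, true_and] at hA hmax
  refine ⟨A, hA, fun y hy hyA f hf p hp hp' => ?_⟩
  by_contra hpA
  have hpp : p ≠ p.rev := fun h => hp' (h ▸ hp)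
  have h1 := hmax (insert p A) ⟨_, hS.proj_mem (p := p) (q := p.rev) ⟨hpp, fun _ => rfl⟩ hy
    (hsk y hy), ?_, fun g hg a ha => ?_⟩
  · rw [Finset.card_insert_of_notMem hpA] at h1
    omega
  · refine Function.ne_iff.2 ⟨f, ?_⟩
    rw [if_pos ⟨hp, hp'⟩]
    exact hf
  · dsimp only at hg
    split_ifs at hg with hc
    · rcases Finset.mem_insert.1 ha with rfl | ha
      · exact hc
      · exact hyA g hg a ha
    · exact absurd rfl hg

/-- If the tuples with nonzero coordinates contain no index outside of `A`, the set of their values is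
`A`. -/
theorem hasExact_of_supportedOver [CharZero k] {S : Submodule k (Tup k (dim X l) i)}
    (hsk : ∀ y ∈ S, IsSkew y) {A : Finset (Fin (dim X l))} {y : Tup k (dim X l) i} (hy : y ∈ S)
    (hy0 : y ≠ 0) (hyA : SupportedOver y A)
    (h : ∀ f, y f ≠ 0 → ∀ x ∈ Set.range f, x ∈ A) :
    ∃ I : Finset (Fin (dim X l)), I.card = i ∧ IsIsotropic X l I ∧ HasExact S I := by
  classical
  obtain ⟨f, hf⟩ := Function.ne_iff.1 hy0
  rw [Pi.zero_apply] at hf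
  have h1 : ∀ g, y g ≠ 0 → ∀ x, x ∈ Set.range g ↔ x ∈ A := fun g hg x =>
    ⟨h g hg x, fun hx => (hyA g hg x hx).1⟩
  refine ⟨A, ?_, fun _ a ha ha' => (hyA f hf a ha).2 ((h1 f hf _).2 ha'), y, hy, hy0, h1⟩
  have : A = Finset.univ.image f := by
    ext x
    rw [← h1 f hf]
    simp
  rw [this, Finset.card_image_of_injective _ ((hsk y hy).injective hf), Finset.card_univ,
    Fintype.card_fin]

/-- Since `i ≤ ℓ`, a tuple of degree `i` with the middle index misses one of the `ℓ` pairs of opposite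
indices. -/
theorem exists_avoiding_pair {f : Fin i → Fin (dim .B l)} (hi : i ≤ l)
    (hm : mid l ∈ Set.range f) : ∃ p, p ≠ mid l ∧ p ∉ Set.range f ∧ p.rev ∉ Set.range f := by
  by_contra! hc
  have hdim : dim .B l = 2 * l + 1 := rfl
  have hsurj : Function.Surjective fun j : Fin i =>
      (⟨min (f j : ℕ) ((f j).rev : ℕ), by
        have := (f j).2
        rw [Fin.val_rev]
        omega⟩ : Fin (l + 1)) := by
    intro n
    have hn := n.2
    let p : Fin (dim .B l) := ⟨n, by omega⟩
    have hp : p ∈ Set.range f ∨ p.rev ∈ Set.range f := by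
      by_cases h1 : p = mid l
      · exact Or.inl (h1 ▸ hm)
      · by_cases h2 : p ∈ Set.range f
        · exact Or.inl h2
        · exact Or.inr (hc p h1 h2)
    rcases hp with ⟨j, hj⟩ | ⟨j, hj⟩
    · refine ⟨j, Fin.ext ?_⟩
      simp only [hj, Fin.val_rev, p]
      omega
    · refine ⟨j, Fin.ext ?_⟩
      simp only [hj, Fin.val_rev, p]
      omega
  have := Fintype.card_le_of_surjective _ hsurj
  simp only [Fintype.card_fin] at this
  omega

theorem shortMat_ne_zero {p x z : Fin (dim .B l)} (h : shortMat (k := k) p x z ≠ 0) :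
    (x = p ∨ x = mid l) ∧ (z = p.rev ∨ z = mid l) := by
  by_contra hc
  apply h
  rw [shortMat, Matrix.sub_apply, Matrix.single_apply, Matrix.single_apply, if_neg, if_neg,
    sub_zero]
  · rintro ⟨rfl, rfl⟩
    simp at hc
  · rintro ⟨rfl, rfl⟩
    simp at hc

/-- In type `B`, choose a tensor supported over a set `A` of maximal size. If it involved the middle
index, or two opposite indices `x` and `x.rev`, the root vector `shortMat` would give a tensor
supported over a larger set. -/
theorem hasExact_typeB [CharZero k] (hi : i ≤ l) {S : Submodule k (Tup k (dim .B l) i)}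
    (hS : GStable .B l S) (hsk : ∀ y ∈ S, IsSkew y) (h0 : S ≠ ⊥) :
    ∃ I : Finset (Fin (dim .B l)), I.card = i ∧ IsIsotropic .B l I ∧ HasExact S I := by
  obtain ⟨A, ⟨y, hy, hy0, hyA⟩, hmax⟩ := exists_maximal_supportedOver hS hsk h0
  have hmA : mid l ∉ A := fun h => by
    obtain ⟨f, hf⟩ := Function.ne_iff.1 hy0
    obtain ⟨h1, h2⟩ := hyA f hf _ h
    rw [rev_mid] at h2
    exact h2 h1
  have hmA' : (mid l).rev ∉ A := by rwa [rev_mid]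
  have hm : ∀ f, y f ≠ 0 → mid l ∉ Set.range f := by
    rintro f hf ⟨m, hm⟩
    obtain ⟨p, hp, hpf, hpf'⟩ := exists_avoiding_pair hi ⟨m, hm⟩
    have hinj := update_injective ((hsk y hy).injective hf) m hpf
    have hpA : p ∉ A := fun h => hpf (hyA f hf _ h).1
    have hpA' : p.rev ∉ A := fun h => hpf' (hyA f hf _ h).1
    have hnot : ∀ x, x ∉ Set.range f → x ≠ p → x ∉ Set.range (Function.update f m p) := by
      rintro x hx hxp ⟨j, hj⟩
      by_cases hjm : j = m
      · rw [hjm, Function.update_self] at hj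
        exact hxp hj.symm
      · rw [Function.update_of_ne hjm] at hj
        exact hx ⟨j, hj⟩
    refine hpA (hmax (derAct (shortMat p) y) (hS.derAct_mem (shortMat_isRootLike hp) hy)
      (hyA.derAct fun x z hxz => ?_) (Function.update f m p) ?_ p
      ⟨m, Function.update_self _ _ _⟩ (hnot _ hpf' (rev_ne_self_iff.2 hp)))
    · obtain ⟨rfl | rfl, rfl | rfl⟩ := shortMat_ne_zero hxz <;> simp [*]
    · rw [shortMat, derAct_sub, Pi.sub_apply,
        derAct_single_of_mem y hinj m (Function.update_self _ _ _), derAct_single_of_notMem,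
        Function.update_idem, ← hm, Function.update_eq_self]
      · simpa using hf
      · rintro ⟨j, hj⟩
        by_cases hjm : j = m
        · rw [hjm, Function.update_self] at hj
          exact hp hj
        · rw [Function.update_of_ne hjm, ← hm] at hj
          exact hjm ((hsk y hy).injective hf hj)
  refine hasExact_of_supportedOver hsk hy hy0 hyA fun f hf x hx => ?_
  by_contra hxA
  have hx' : x.rev ∈ Set.range f := by
    by_contra h
    exact hxA (hmax y hy hyA f hf x hx h)
  have hxm : x ≠ mid l := fun h => hm f hf (h ▸ hx)
  have hxA' : x.rev ∉ A := fun h => (hyA f hf _ h).2 (by rwa [Fin.rev_rev])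
  have hfinj := (hsk y hy).injective hf
  obtain ⟨b, hb⟩ := hx'
  obtain ⟨a, ha⟩ := hx
  have hab : a ≠ b := fun h => rev_ne_self_iff.2 hxm (by rw [← hb, ← h, ha])
  have hinj := update_injective hfinj b (hm f hf)
  refine hxA (hmax (derAct (shortMat x) y) (hS.derAct_mem (shortMat_isRootLike hxm) hy)
    (hyA.derAct fun u v huv => ?_) (Function.update f b (mid l)) ?_ x
    ⟨a, by rw [Function.update_of_ne hab, ha]⟩ ?_)
  · obtain ⟨rfl | rfl, rfl | rfl⟩ := shortMat_ne_zero huv <;> simp [*]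
  · rw [shortMat, derAct_sub, Pi.sub_apply,
      derAct_single_of_mem y hinj a (by rw [Function.update_of_ne hab, ha]),
      derAct_single_of_mem y hinj b (Function.update_self _ _ _), Function.update_idem, ← hb,
      Function.update_eq_self, (hsk y hy).eq_zero hab]
    · simpa using hf
    · rw [Function.update_self, Function.update_of_ne hab.symm, Function.update_self]
  · rintro ⟨j, hj⟩
    by_cases hjb : j = b
    · rw [hjb, Function.update_self] at hj
      exact hxm (by rw [← Fin.rev_rev x, ← hj, rev_mid])
    · rw [Function.update_of_ne hjb, ← hb] at hj
      exact hjb (hfinj hj)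

/-- In type `C`, choose a tensor supported over a set `A` of maximal size. If it involved two opposite
indices, then by maximality the root vectors would show that the nonzero terms in one of its
contractions with the form are all equal, so that the contraction would not vanish. -/
theorem hasExact_typeC [CharZero k] {S : Submodule k (Tup k (dim .C l) i)}
    (hS : GStable .C l S) (hprim : S ≤ prim .C l k i) (h0 : S ≠ ⊥) :
    ∃ I : Finset (Fin (dim .C l)), I.card = i ∧ IsIsotropic .C l I ∧ HasExact S I := by
  have hX : CType.C ≠ .A := by simp
  have hsk : ∀ y ∈ S, IsSkew y := fun y hy => (hprim hy).1
  obtain ⟨A, ⟨y, hy, hy0, hyA⟩, hmax⟩ := exists_maximal_supportedOver hS hsk h0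
  refine hasExact_of_supportedOver hsk hy hy0 hyA fun f hf x₀ hx₀ => ?_
  by_contra hx₀A
  have hx₀' : x₀.rev ∈ Set.range f := by
    by_contra h
    exact hx₀A (hmax y hy hyA f hf x₀ hx₀ h)
  have hx₀A' : x₀.rev ∉ A := fun h => (hyA f hf _ h).2 (by rwa [Fin.rev_rev])
  -- among the two indices of the pair, choose the one less than `ℓ`
  obtain ⟨x, hx, hx', hxA, hxA', hxl⟩ : ∃ x, x ∈ Set.range f ∧ x.rev ∈ Set.range f ∧ x ∉ A ∧
      x.rev ∉ A ∧ (x : ℕ) < l := by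
    by_cases h : (x₀ : ℕ) < l
    · exact ⟨x₀, hx₀, hx₀', hx₀A, hx₀A', h⟩
    · refine ⟨x₀.rev, hx₀', by rwa [Fin.rev_rev], hx₀A', by rwa [Fin.rev_rev], ?_⟩
      have := x₀.2
      rw [Fin.val_rev]
      simp only [dim] at *
      omega
  obtain ⟨a, ha⟩ := hx
  obtain ⟨b, hb⟩ := hx'
  have hfinj := (hsk y hy).injective hf
  have hxr := rev_ne_self hX hxl
  have hab : a ≠ b := fun h => hxr (by rw [← hb, ← h, ha])
  have key : ∀ q : Fin (dim .C l), (q : ℕ) < l →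
      y (Function.update (Function.update f a q) b q.rev) ≠ 0 →
      y (Function.update (Function.update f a q) b q.rev) = y f := by
    intro q hql hq
    have hqr := rev_ge_of_lt hX hql
    have hxr' := rev_ge_of_lt hX hxl
    by_cases hqx : q = x
    · rw [hqx, ← ha, Function.update_eq_self, ha, ← hb, Function.update_eq_self]
    have hginj := (hsk y hy).injective hq
    have hqf : q ∉ Set.range f := by
      rintro ⟨j, hj⟩
      have hja : j ≠ a := fun h => hqx (by rw [← hj, h, ha])
      have hjb : j ≠ b := fun h => by
        rw [h, hb] at hj
        rw [hj] at hxr'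
        omega
      refine hja (hginj ?_)
      rw [Function.update_of_ne hjb, Function.update_of_ne hja, Function.update_of_ne hab,
        Function.update_self, hj]
    have hqf' : q.rev ∉ Set.range f := by
      rintro ⟨j, hj⟩
      have hja : j ≠ a := fun h => by
        rw [h, ha] at hj
        rw [← hj] at hqr
        omega
      have hjb : j ≠ b := fun h => by
        rw [h, hb] at hj
        exact hqx (Fin.rev_injective hj.symm)
      refine hjb (hginj ?_)
      rw [Function.update_of_ne hjb, Function.update_of_ne hja, Function.update_self, hj]
    have hxq' : x ≠ q.rev := fun h => by
      rw [← h] at hqr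
      omega
    have hroot := rootMat_isRootLike (X := .C) (k := k) hxq' fun _ =>
      ⟨hxr, by rw [Fin.rev_rev]; exact (rev_ne_self hX hql).symm⟩
    have hinj := update_injective hfinj b hqf
    have hs : formSign k .C l x * formSign k .C l q.rev = -1 := by
      simp only [formSign]
      rw [if_pos hxl, if_neg (by omega), one_mul]
    have hval : derAct (rootMat x q.rev) y (Function.update f b q) =
        y f - y (Function.update (Function.update f a q) b q.rev) := by
      rw [rootMat_eq, derAct_sub, Pi.sub_apply, Fin.rev_rev,
        derAct_single_of_mem y hinj a (by rw [Function.update_of_ne hab, ha]),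
        derAct_single_of_mem y hinj b (Function.update_self _ _ _), Function.update_idem, ← hb,
        Function.update_eq_self, hs, Function.update_comm hab.symm, (hsk y hy).swap hab]
      ring
    by_contra hne
    refine hxA (hmax _ (hS.derAct_mem hroot hy) (hyA.derAct fun u v huv => ?_)
      (Function.update f b q) ?_ x ⟨a, by rw [Function.update_of_ne hab, ha]⟩ ?_)
    · have hqA : q ∉ A := fun h => hqf (hyA f hf _ h).1
      have hqA' : q.rev ∉ A := fun h => hqf' (hyA f hf _ h).1
      have : (u = x ∧ v = q.rev) ∨ (u = q ∧ v = x.rev) := by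
        by_contra hc
        rw [not_or] at hc
        exact huv (by simp [rootMat, hc.1, hc.2])
      rcases this with ⟨rfl, rfl⟩ | ⟨rfl, rfl⟩ <;> simp [*]
    · rw [hval]
      exact fun h => hne (sub_eq_zero.1 h).symm
    · rintro ⟨j, hj⟩
      by_cases hjb : j = b
      · rw [hjb, Function.update_self] at hj
        rw [← hj] at hxr'
        omega
      · rw [Function.update_of_ne hjb, ← hb] at hj
        exact hjb (hfinj hj)
  -- each term of the contraction is `0` or `y f`
  have hterm : ∀ q : Fin (dim .C l), formSign k .C l q *
      y (Function.update (Function.update f a q) b q.rev) ≠ 0 → formSign k .C l q *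
      y (Function.update (Function.update f a q) b q.rev) = y f := by
    intro q hq
    by_cases hql : (q : ℕ) < l
    · simp only [formSign, if_pos hql, one_mul] at hq ⊢
      exact key q hql hq
    · have hqr : (q.rev : ℕ) < l := by
        have := q.2
        rw [Fin.val_rev]
        simp only [dim] at *
        omega
      have h1 := key q.rev hqr
      rw [(hsk y hy).swap hab] at hq
      simp only [formSign, if_neg hql] at hq ⊢
      rw [(hsk y hy).swap hab]
      rw [Fin.rev_rev] at h1
      simp only [mul_neg, neg_mul, one_mul, neg_neg] at hq ⊢
      exact h1 hq
  have hsum := prim_contraction (hprim hy) f hab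
  classical
  rw [← Finset.sum_filter_ne_zero, Finset.sum_congr rfl fun q hq =>
    hterm q (Finset.mem_filter.1 hq).2, Finset.sum_const, nsmul_eq_mul] at hsum
  rcases mul_eq_zero.1 hsum with h | h
  · rw [Nat.cast_eq_zero, Finset.card_eq_zero] at h
    have : x ∈ (∅ : Finset (Fin (dim .C l))) := by
      rw [← h, Finset.mem_filter]
      refine ⟨Finset.mem_univ _, ?_⟩
      simp only [formSign, if_pos hxl, one_mul]
      rw [← ha, Function.update_eq_self, ha, ← hb, Function.update_eq_self]
      exact hf
    simp at this
  · exact hf h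

/-- A nonzero stable space of primitive tensors of degree `i ≤ ℓ` contains the highest weight
vector `e_0 ∧ ⋯ ∧ e_{i-1}`. -/
theorem wedge_std_mem [CharZero k] (hi : i ≤ l) {S : Submodule k (Tup k (dim X l) i)}
    (hS : GStable X l S) (hprim : S ≤ prim X l k i) (h0 : S ≠ ⊥) :
    wedge k (stdTuple X hi) ∈ S := by
  have hsk : ∀ y ∈ S, IsSkew y := fun y hy => (hprim hy).1
  have : ∃ I : Finset (Fin (dim X l)), I.card = i ∧ IsIsotropic X l I ∧ HasExact S I := by
    cases X
    · obtain ⟨I, h1, h2⟩ := hasExact_typeA hi hS hsk h0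
      exact ⟨I, h1, fun h => absurd rfl h, h2⟩
    · exact hasExact_typeB hi hS hsk h0
    · exact hasExact_typeC hS hprim h0
  obtain ⟨I, h1, h2, h3⟩ := this
  exact h3.wedge_mem hi hS hsk h2 h1

end Isolate

/-! ### The modules generated by the highest weight vectors -/

section Veps

variable {X : CType} {l : ℕ} {k : Type*} [Field k] {i : ℕ}

theorem map_eq_bot_iff_of_injective {M M' : Type*} [AddCommMonoid M] [Module k M]
    [AddCommMonoid M'] [Module k M'] {f : M →ₗ[k] M'} (hf : Function.Injective f)
    {p : Submodule k M} : p.map f = ⊥ ↔ p = ⊥ :=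
  (Submodule.map_injective_of_injective hf).eq_iff' (Submodule.map_bot f)

theorem mem_map_iff_of_injective {M M' : Type*} [AddCommMonoid M] [Module k M]
    [AddCommMonoid M'] [Module k M'] {f : M →ₗ[k] M'} (hf : Function.Injective f)
    {p : Submodule k M} {x : M} : f x ∈ p.map f ↔ x ∈ p :=
  hf.mem_set_image (s := (p : Set M))

theorem phi_extRep (g : Gp X l k) (x : ⋀[k]^i (Std X l k)) :
    phi k (dim X l) i (extRep X l k i g x) = tact (mat g) (phi k (dim X l) i x) :=
  phi_map _ _

theorem topVector_mem : topVector X l k i ∈ (VepsSub X l k i).toSubmodule :=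
  Submodule.subset_span ⟨1, by simp⟩

theorem vepsSub_induction {p : Submodule k (⋀[k]^i (Std X l k))}
    (h0 : topVector X l k i ∈ p) (h : ∀ g, ∀ x ∈ p, extRep X l k i g x ∈ p) :
    (VepsSub X l k i).toSubmodule ≤ p :=
  Submodule.span_le.2 (by rintro _ ⟨g, rfl⟩; exact h g _ h0)

/-- The image of a submodule of an exterior power in the tensors. -/
theorem map_phi_stable {p : Submodule k (⋀[k]^i (Std X l k))}
    (h : ∀ g, ∀ x ∈ p, extRep X l k i g x ∈ p) : GStable X l (p.map (phi k (dim X l) i)) := by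
  rintro g _ ⟨x, hx, rfl⟩
  exact ⟨_, h g x hx, phi_extRep g x⟩

/-- By `wedge_std_mem`, no nonzero primitive tensor is orthogonal to a stable space that contains
the highest weight vector, since this vector is not orthogonal to itself. -/
theorem eq_zero_of_orthogonal [CharZero k] (hi : i ≤ l) {S : Submodule k (Tup k (dim X l) i)}
    (hS : GStable X l S) (hSw : wedge k (stdTuple X hi) ∈ S) {y : Tup k (dim X l) i}
    (hy : y ∈ prim X l k i) (h : ∀ z ∈ S, y ⬝ᵥ z = 0) : y = 0 := by
  let U : Submodule k (Tup k (dim X l) i) :=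
    { carrier := {y | y ∈ prim X l k i ∧ ∀ z ∈ S, y ⬝ᵥ z = 0}
      zero_mem' := ⟨Submodule.zero_mem _, fun z _ => zero_dotProduct z⟩
      add_mem' := fun ha hb => ⟨Submodule.add_mem _ ha.1 hb.1, fun z hz => by
        rw [add_dotProduct, ha.2 z hz, hb.2 z hz, add_zero]⟩
      smul_mem' := fun c a ha => ⟨Submodule.smul_mem _ c ha.1, fun z hz => by
        rw [smul_dotProduct, ha.2 z hz, smul_zero]⟩ }
  have hU : GStable X l U := fun g a ha => ⟨prim_stable g _ ha.1, fun z hz => by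
    rw [tact_dotProduct]
    exact ha.2 _ (hS (transp g) z hz)⟩
  by_contra hne
  have h2 := wedge_std_mem hi hU (fun _ ha => ha.1)
    ((Submodule.ne_bot_iff _).2 ⟨y, ⟨hy, h⟩, hne⟩)
  exact wedge_dotProduct_self (stdTuple_injective hi) (h2.2 _ hSw)

/-- The module generated by the highest weight vector is the space of primitive tensors: no
nonzero primitive tensor is orthogonal to it. -/
theorem map_phi_vepsSub [CharZero k] (hi : i ≤ l) :
    (VepsSub X l k i).toSubmodule.map (phi k (dim X l) i) = prim X l k i := by
  set V := (VepsSub X l k i).toSubmodule.map (phi k (dim X l) i)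
  have hVs : GStable X l V := map_phi_stable (VepsSub X l k i).apply_mem_toSubmodule
  have hVtop : wedge k (stdTuple X hi) ∈ V := ⟨_, topVector_mem, phi_topVector hi⟩
  have hle : V ≤ prim X l k i := by
    rw [Submodule.map_le_iff_le_comap]
    refine vepsSub_induction ?_ fun g x hx => ?_
    · rw [Submodule.mem_comap, phi_topVector hi]
      exact wedge_mem_prim fun a => a.2.trans_le hi
    · rw [Submodule.mem_comap] at hx ⊢
      rw [phi_extRep]
      exact prim_stable g _ hx
  let β : prim X l k i →ₗ[k] Module.Dual k V :=
    LinearMap.mk₂ k (fun y z => y.1 ⬝ᵥ z.1) (fun _ _ _ => add_dotProduct _ _ _)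
      (fun _ _ _ => smul_dotProduct _ _ _) (fun _ _ _ => dotProduct_add _ _ _)
      (fun _ _ _ => dotProduct_smul _ _ _)
  have hβ : Function.Injective β := by
    rw [injective_iff_map_eq_zero]
    intro y hy
    exact Subtype.ext (eq_zero_of_orthogonal hi hVs hVtop y.2 fun z hz =>
      LinearMap.congr_fun hy ⟨z, hz⟩)
  refine Submodule.eq_of_le_of_finrank_le hle ?_
  rw [← Subspace.dual_finrank_eq (V := V)]
  exact LinearMap.finrank_le_finrank_of_injective hβ

theorem mem_vepsSub_iff [CharZero k] (hi : i ≤ l) (x : ⋀[k]^i (Std X l k)) :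
    x ∈ (VepsSub X l k i).toSubmodule ↔ phi k (dim X l) i x ∈ prim X l k i := by
  rw [← map_phi_vepsSub hi]
  exact (mem_map_iff_of_injective (f := phi k (dim X l) i) phi_injective).symm

theorem topVector_ne_zero (hi : i ≤ l) : topVector X l k i ≠ 0 := fun h => by
  have h1 := congrFun (phi_topVector (k := k) (X := X) hi) (stdTuple X hi)
  rw [h, map_zero, wedge_self (stdTuple_injective hi)] at h1
  exact zero_ne_one h1

theorem subrep_eq_top [CharZero k] (hi : i ≤ l) (T : Subrepresentation (Veps X l k i))
    (hT : T.toSubmodule ≠ ⊥) : T = ⊤ := by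
  have hinj : Function.Injective (VepsSub X l k i).toSubmodule.subtype :=
    Submodule.subtype_injective _
  set p := T.toSubmodule.map (VepsSub X l k i).toSubmodule.subtype
  have hp : ∀ g, ∀ x ∈ p, extRep X l k i g x ∈ p := by
    rintro g _ ⟨x, hx, rfl⟩
    exact ⟨_, T.apply_mem_toSubmodule g hx, rfl⟩
  have h1 := wedge_std_mem hi (map_phi_stable hp) (by
    rintro _ ⟨_, ⟨x, -, rfl⟩, rfl⟩
    exact (mem_vepsSub_iff hi _).1 x.2) (by
    rw [Ne, map_eq_bot_iff_of_injective (f := phi k (dim X l) i) phi_injective,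
      map_eq_bot_iff_of_injective hinj]
    exact hT)
  rw [← phi_topVector hi] at h1
  replace h1 := (mem_map_iff_of_injective (f := phi k (dim X l) i) phi_injective).1 h1
  refine Subrepresentation.toSubmodule_injective (top_unique fun x _ => ?_)
  have h2 := vepsSub_induction h1 hp x.2
  exact (mem_map_iff_of_injective hinj).1 h2

theorem veps_isIrreducible [CharZero k] (hi : i ≤ l) :
    Representation.IsIrreducible (V := (VepsSub X l k i).toSubmodule) (Veps X l k i) where
  exists_pair_ne := by
    refine ⟨⊥, ⊤, fun h => topVector_ne_zero (k := k) (X := X) hi ?_⟩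
    have h1 : (⟨_, topVector_mem⟩ : (VepsSub X l k i).toSubmodule) ∈
        (⊥ : Subrepresentation (Veps X l k i)).toSubmodule := by
      rw [h]
      exact Submodule.mem_top
    exact congrArg Subtype.val ((Submodule.mem_bot k).1 h1)
  eq_bot_or_eq_top T := by
    by_cases hT : T.toSubmodule = ⊥
    · exact Or.inl (Subrepresentation.toSubmodule_injective hT)
    · exact Or.inr (subrep_eq_top hi T hT)

/-- A matrix that preserves the span of `e_0, …, e_{i-1}` acts on `e_0 ∧ ⋯ ∧ e_{i-1}` by its
determinant on this span. -/
theorem tact_wedge_std [CharZero k] (hi : i ≤ l) (g : Matrix (Fin (dim X l)) (Fin (dim X l)) k)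
    (hg : ∀ p q : Fin (dim X l), ¬ (p : ℕ) < i → (q : ℕ) < i → g p q = 0) :
    tact g (wedge k (stdTuple X hi)) =
      (g.submatrix (stdTuple X hi) (stdTuple X hi)).det • wedge k (stdTuple X hi) := by
  have h1 := eq_smul_wedge (isSkew_tact (wedge_skew (k := k) (stdTuple X hi)) g)
    (stdTuple_injective hi) fun h hh j => by
      obtain ⟨h', -, hh'⟩ := Finset.exists_ne_zero_of_sum_ne_zero hh
      have h2 := mem_range_of_wedge_ne_zero (right_ne_zero_of_mul hh') j
      have h3 := Finset.prod_ne_zero_iff.1 (left_ne_zero_of_mul hh') j (Finset.mem_univ j)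
      rw [mem_range_stdTuple] at h2 ⊢
      by_contra hc
      exact h3 (hg _ _ hc h2)
  rw [h1]
  congr 1
  rw [tact_apply, ← Matrix.det_transpose, Matrix.det_apply']
  refine (dotProduct_comm _ _).trans ((wedge_dotProduct _ _).trans ?_)
  rfl

theorem extRep_topVector [CharZero k] (hi : i ≤ l) (g : Gp X l k)
    (hg : ∀ p q : Fin (dim X l), ¬ (p : ℕ) < i → (q : ℕ) < i → mat g p q = 0) :
    extRep X l k i g (topVector X l k i) =
      ((mat g).submatrix (stdTuple X hi) (stdTuple X hi)).det • topVector X l k i := by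
  apply phi_injective
  rw [phi_extRep, phi_topVector hi, tact_wedge_std hi _ hg, map_smul, phi_topVector hi]

theorem sum_corootExp_std (hi : i ≤ l) (j : Fin l) :
    ∑ a, corootExp X l j (stdTuple X hi a) = eps X l i j := by
  have hd : ∀ n : ℕ, ∑ a : Fin i, corootExp.d n (stdTuple X hi a) =
      if n < i then (1 : ℤ) else 0 := fun n => by
    split_ifs with h
    · rw [Finset.sum_eq_single ⟨n, h⟩]
      · simp [corootExp.d, stdTuple]
      · intro b _ hb
        exact if_neg fun h => hb (Fin.ext h)
      · simp
    · refine Finset.sum_eq_zero fun a _ => if_neg fun h' => h ?_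
      rw [← h']
      exact a.2
  have hr : X ≠ .A → ∀ n : ℕ, n < l ∨ (X = .B ∧ n = l ∧ i < l + 1) → ∀ a : Fin i,
      corootExp.d n (stdTuple X hi a).rev = (0 : ℤ) := fun hX n hn a => by
    have ha := a.2
    refine if_neg fun h' => ?_
    rw [Fin.val_rev] at h'
    cases X
    · exact hX rfl
    all_goals
      simp only [dim, stdTuple, reduceCtorEq, false_and, or_false, true_and] at *
      omega
  have hj := j.2
  cases X
  · simp only [corootExp, corootExp.s, Finset.sum_sub_distrib, hd, eps]
    split_ifs <;> omega
  · by_cases h : (j : ℕ) + 1 = l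
    · simp only [corootExp, if_pos h, ← Finset.mul_sum, Finset.sum_sub_distrib, hd,
        hr (by simp) j (Or.inl hj), eps, Finset.sum_const_zero]
      split_ifs <;> omega
    · simp only [corootExp, corootExp.s, if_neg h, Finset.sum_sub_distrib, hd,
        hr (by simp) j (Or.inl hj), hr (by simp) (j + 1) (Or.inl (by omega)), eps,
        Finset.sum_const_zero]
      split_ifs <;> omega
  · by_cases h : (j : ℕ) + 1 = l
    · simp only [corootExp, if_pos h, Finset.sum_sub_distrib, hd,
        hr (by simp) j (Or.inl hj), eps, Finset.sum_const_zero]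
      split_ifs <;> omega
    · simp only [corootExp, corootExp.s, if_neg h, Finset.sum_sub_distrib, hd,
        hr (by simp) j (Or.inl hj), hr (by simp) (j + 1) (Or.inl (by omega)), eps,
        Finset.sum_const_zero]
      split_ifs <;> omega

theorem exists_highestWeightVector [CharZero k] (hi : i ≤ l) :
    ∃ v, IsHighestWeightVector (Veps X l k i) (eps X l i) v := by
  refine ⟨⟨_, topVector_mem⟩, fun h => topVector_ne_zero hi (congrArg Subtype.val h),
    fun g hg => Subtype.ext ?_, fun j t => Subtype.ext ?_⟩
  · refine (extRep_topVector hi g fun p q hp hq => hg.2 p q ?_).trans ?_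
    · rw [Fin.lt_def]
      omega
    · rw [Matrix.det_of_isUpperTriangular, Finset.prod_eq_one, one_smul]
      · intro a _
        exact hg.1 _
      · intro a b hab
        exact hg.2 _ _ hab
  · refine (extRep_topVector hi (coroot X l k j t) fun p q hp hq =>
      Matrix.diagonal_apply_ne _ fun h => hp (h ▸ hq)).trans ?_
    have h1 : (mat (coroot X l k j t)).submatrix (stdTuple X hi) (stdTuple X hi) =
        Matrix.diagonal fun a => ((t ^ corootExp X l j (stdTuple X hi a) : kˣ) : k) :=
      Matrix.submatrix_diagonal _ _ (stdTuple_injective hi)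
    rw [h1, Matrix.det_diagonal, ← Units.coe_prod, prod_zpow_eq, sum_corootExp_std]
    rfl

end Veps

/-! ### Tensor powers of the natural module -/

section TensorPowers

variable {X : CType} {l : ℕ} {k : Type*} [Field k] {i j : ℕ}

/-- An intertwining map on `V_{ε_i}` is determined by the image of the highest weight vector. -/
theorem intertwiningMap_ext {M : Type*} [AddCommMonoid M] [Module k M]
    {ρ : Representation k (Gp X l k) M} {f g : (Veps X l k i).IntertwiningMap ρ}
    (h : f ⟨_, topVector_mem⟩ = g ⟨_, topVector_mem⟩) : f = g := by
  have key : (VepsSub X l k i).toSubmodule ≤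
      (LinearMap.eqLocus f.toLinearMap g.toLinearMap).map (VepsSub X l k i).toSubmodule.subtype := by
    refine vepsSub_induction ⟨_, h, rfl⟩ ?_
    rintro x _ ⟨y, hy, rfl⟩
    refine ⟨Veps X l k i x y, ?_, rfl⟩
    exact (f.isIntertwining _ _ x y).trans
      ((congrArg (ρ x) (show f y = g y from hy)).trans (g.isIntertwining _ _ x y).symm)
  refine Representation.IntertwiningMap.ext (LinearMap.ext fun x => ?_)
  obtain ⟨y, hy, hyx⟩ := key x.2
  rw [← Subtype.ext (p := (· ∈ (VepsSub X l k i).toSubmodule)) hyx]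
  exact hy

theorem vepsSub_one [CharZero k] (hl : 1 ≤ l) : (VepsSub X l k 1).toSubmodule = ⊤ := by
  refine top_unique fun x _ => (mem_vepsSub_iff hl x).2 ⟨phi_skew x, fun f a b hab => ?_⟩
  exact absurd (Subsingleton.elim a b) hab

/-- The natural basis of the natural module `V_{ε_1}`. -/
def natBasis [CharZero k] (hl : 1 ≤ l) :
    Module.Basis (Fin (dim X l)) k (VepsSub X l k 1).toSubmodule :=
  Module.Basis.ofEquivFun
    ((LinearEquiv.ofTop _ (vepsSub_one hl)).trans (exteriorPower.oneEquiv k (Std X l k)))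

theorem natBasis_repr [CharZero k] (hl : 1 ≤ l) (g : Gp X l k)
    (v : (VepsSub X l k 1).toSubmodule) (p : Fin (dim X l)) :
    (natBasis hl).repr (Veps X l k 1 g v) p = ∑ q, mat g p q * (natBasis hl).repr v q := by
  have h1 : ∀ w, ((natBasis hl).repr w : Fin (dim X l) → k) =
      exteriorPower.oneEquiv k (Std X l k) w.1 := fun w => rfl
  rw [h1, h1]
  exact congrFun (LinearMap.congr_fun (exteriorPower.oneEquiv_naturality (stdRep X l k g)) v.1) p

/-- The tensor powers of `V_{ε_1}` in coordinates. -/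
def tensorCoord [CharZero k] (hl : 1 ≤ l) (j : ℕ) :
    (⨂[k]^j (VepsSub X l k 1).toSubmodule) ≃ₗ[k] Tup k (dim X l) j :=
  (Basis.piTensorProduct fun _ : Fin j => natBasis (X := X) (k := k) hl).equivFun

theorem tensorCoord_tprod [CharZero k] (hl : 1 ≤ l)
    (v : Fin j → (VepsSub X l k 1).toSubmodule) (f : Fin j → Fin (dim X l)) :
    tensorCoord hl j (PiTensorProduct.tprod k v) f = ∏ a, (natBasis hl).repr (v a) (f a) :=
  Basis.piTensorProduct_repr_tprod_apply _ _ _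

theorem tensorCoord_equivariant [CharZero k] (hl : 1 ≤ l) (g : Gp X l k)
    (x : ⨂[k]^j (VepsSub X l k 1).toSubmodule) :
    tensorCoord hl j (tensorPow (Veps X l k 1) j g x) = tact (mat g) (tensorCoord hl j x) := by
  have : (tensorCoord hl j).toLinearMap ∘ₗ tensorPow (Veps X l k 1) j g =
      tact (mat g) ∘ₗ (tensorCoord hl j).toLinearMap := by
    refine PiTensorProduct.ext (MultilinearMap.ext fun v => ?_)
    funext f
    have h1 : tensorPow (Veps X l k 1) j g (PiTensorProduct.tprod k v) =
        PiTensorProduct.tprod k fun a => Veps X l k 1 g (v a) := PiTensorProduct.map_tprod _ _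
    simp only [LinearMap.compMultilinearMap_apply, LinearMap.comp_apply, LinearEquiv.coe_coe, h1,
      tensorCoord_tprod, tact_apply, natBasis_repr, Finset.prod_univ_sum, Fintype.piFinset_univ,
      Finset.prod_mul_distrib]
  exact LinearMap.congr_fun this x

/-- A toral partner of a basis vector `e_p` with `p < i` outside of the span of `e_0, …, e_{i-1}`. -/
theorem exists_isToral (hi : i ≤ l) {p : Fin (dim X l)} (hp : (p : ℕ) < i) :
    ∃ q, IsToral X l p q ∧ ¬ (q : ℕ) < i := by
  by_cases hX : X = .A
  · subst hX
    refine ⟨⟨l, by simp only [dim]; omega⟩, ⟨fun h => ?_, fun h => absurd rfl h⟩, by simpa using hi⟩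
    rw [Fin.ext_iff] at h
    simp only at h
    omega
  · have h1 := rev_ge_of_lt hX (hp.trans_le hi)
    exact ⟨p.rev, ⟨(rev_ne_self hX (hp.trans_le hi)).symm, fun _ => rfl⟩, by omega⟩

/-- The weight of the highest weight vector forces every index `p < i` to occur. -/
theorem mem_range_of_weight [CharZero k] (hi : i ≤ l) {c : Tup k (dim X l) j}
    (hc : ∀ (g : Gp X l k) (s : k), extRep X l k i g (topVector X l k i) = s • topVector X l k i →
      tact (mat g) c = s • c) {h : Fin j → Fin (dim X l)} (hh : c h ≠ 0) {p : Fin (dim X l)}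
    (hp : (p : ℕ) < i) : p ∈ Set.range h := by
  obtain ⟨q, hpq, hq⟩ := exists_isToral hi hp
  have h2 : (2 : k) ≠ 0 := two_ne_zero
  have h1 := hc (torusEl hpq h2) 2 (by
    rw [extRep_topVector hi (torusEl hpq h2) fun a b ha hb =>
      Matrix.diagonal_apply_ne _ fun hab => ha (hab ▸ hb)]
    congr 1
    rw [mat_torusEl, Matrix.submatrix_diagonal _ _ (stdTuple_injective hi), Matrix.det_diagonal]
    simp only [Function.comp_apply]
    rw [prod_torusEntry (stdTuple_injective hi), if_pos ((mem_range_stdTuple hi p).2 hp),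
      if_neg (fun h => hq ((mem_range_stdTuple hi q).1 h)), mul_one])
  have h3 := congrFun h1 h
  rw [mat_torusEl, tact_diagonal, Pi.smul_apply, smul_eq_mul] at h3
  have h4 := mul_right_cancel₀ hh h3
  by_contra hpr
  have h5 : ∏ a, torusEntry p q 2 (h a) =
      (2 : k)⁻¹ ^ (Finset.univ.filter fun a => h a = q).card := by
    rw [Finset.prod_congr rfl fun a _ => show torusEntry p q (2 : k) (h a) =
      if h a = q then 2⁻¹ else 1 by
        rw [torusEntry, if_neg (fun h' => hpr ⟨a, h'⟩), one_mul], Finset.prod_ite]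
    simp
  rw [h5, inv_pow] at h4
  have h6 : (2 : k) ^ ((Finset.univ.filter fun a => h a = q).card + 1) = 1 := by
    rw [pow_succ]
    nth_rewrite 2 [← h4]
    exact mul_inv_cancel₀ (pow_ne_zero _ h2)
  have h7 : 2 ^ ((Finset.univ.filter fun a => h a = q).card + 1) = 1 := by exact_mod_cast h6
  exact absurd h7 (Nat.one_lt_two_pow (Nat.succ_ne_zero _)).ne'

theorem eq_zero_of_lt [CharZero k] (hi : i ≤ l) (hj : j < i) {c : Tup k (dim X l) j}
    (hc : ∀ (g : Gp X l k) (s : k), extRep X l k i g (topVector X l k i) = s • topVector X l k i →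
      tact (mat g) c = s • c) : c = 0 := by
  funext h
  by_contra hh
  choose t ht using fun a : Fin i => mem_range_of_weight hi hc hh (p := stdTuple X hi a) a.2
  have : Function.Injective t := fun a b hab => stdTuple_injective hi (by rw [← ht, ← ht, hab])
  have := Fintype.card_le_of_injective t this
  simp only [Fintype.card_fin] at this
  omega

/-- The root subgroups fixing the highest weight vector. -/
theorem extRep_expEl_topVector [CharZero k] (hi : i ≤ l) {p q : Fin i} (hpq : p ≠ q)
    (h : IsRootLike X l (rootMat (k := k) (stdTuple X hi p) (stdTuple X hi q))) (t : k) :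
    extRep X l k i (expEl h t) (topVector X l k i) = topVector X l k i := by
  have hlt : ∀ a : Fin i, ((stdTuple X hi a : Fin (dim X l)) : ℕ) < l := fun a => a.2.trans_le hi
  have hinj := stdTuple_injective (X := X) hi
  have hsq := rootMat_sq (k := k) (hinj.ne hpq)
    fun hX => ⟨rev_ne_self hX (hlt p), rev_ne_self hX (hlt q)⟩
  have hent : ∀ x y : Fin (dim X l), (y : ℕ) < i →
      rootMat (k := k) (stdTuple X hi p) (stdTuple X hi q) x y =
        if x = stdTuple X hi p ∧ y = stdTuple X hi q then 1 else 0 := fun x y hy => by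
    rw [rootMat, Matrix.of_apply, sub_eq_self]
    by_cases hX : X = .A
    · subst hX
      simp [formSign]
    · refine if_neg fun h' => ?_
      have := rev_ge_of_lt hX (hlt p)
      rw [← h'.2] at this
      omega
  rw [extRep_topVector hi]
  · have : (mat (expEl h t)).submatrix (stdTuple X hi) (stdTuple X hi) =
        Matrix.transvection p q t := by
      ext a b
      rw [Matrix.submatrix_apply, mat_expEl, uexp, hsq, smul_zero, add_zero, Matrix.add_apply,
        Matrix.smul_apply, hent _ _ b.2, Matrix.transvection, Matrix.add_apply,
        Matrix.single_apply]
      simp [Matrix.one_apply, hinj.eq_iff, eq_comm]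
    rw [this, Matrix.det_transvection_of_ne _ _ hpq, one_smul]
  · intro x y hx hy
    rw [mat_expEl, uexp, hsq, smul_zero, add_zero, Matrix.add_apply, Matrix.smul_apply, hent _ _ hy,
      if_neg (fun h' => hx (by rw [h'.1]; exact p.2)), smul_zero, add_zero,
      Matrix.one_apply_ne fun h' : x = y => hx (h' ▸ hy)]

/-- A tensor of degree `i` on which the stabilizer of the line of `e_0 ∧ ⋯ ∧ e_{i-1}` acts as on this
line is alternating in the indices `0, …, i - 1`: the root vector with `e_q ↦ e_p` annihilates it. -/
theorem coord_std_comp_perm [CharZero k] (hi : i ≤ l) {c : Tup k (dim X l) i}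
    (hc : ∀ (g : Gp X l k) (s : k), extRep X l k i g (topVector X l k i) = s • topVector X l k i →
      tact (mat g) c = s • c) (τ : Equiv.Perm (Fin i)) :
    c (stdTuple X hi ∘ τ) = ((Equiv.Perm.sign τ : ℤ) : k) * c (stdTuple X hi) := by
  have hlt : ∀ a : Fin i, ((stdTuple X hi a : Fin (dim X l)) : ℕ) < l := fun a => a.2.trans_le hi
  have hinj := stdTuple_injective (X := X) hi
  induction τ using Equiv.Perm.swap_induction_on with
  | one => simp
  | swap_mul τ p q hpq ih =>
    rw [Equiv.Perm.sign_mul, Equiv.Perm.sign_swap hpq]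
    have hR := rootMat_isRootLike (k := k) (hinj.ne hpq)
      fun hX => ⟨rev_ne_self hX (hlt p), rev_ne_self hX (hlt q)⟩
    have h0 := derAct_eq_zero _ c fun t => by
      have := hc (expEl hR t) 1 (by rw [extRep_expEl_topVector hi hpq, one_smul])
      rwa [one_smul] at this
    -- evaluate at the tuple in which the entry `q` of `std ∘ τ` is replaced by `p`
    set f := stdTuple X hi ∘ τ with hf
    set b := τ.symm q
    set a := τ.symm p
    have hab : a ≠ b := τ.symm.injective.ne hpq
    have hfb : f b = stdTuple X hi q := by simp [hf, b]
    have hfa : f a = stdTuple X hi p := by simp [hf, a]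
    have hfi : Function.Injective f := hinj.comp τ.injective
    have h1 := congrFun h0 (Function.update f b (stdTuple X hi p))
    have hent : ∀ j x, rootMat (k := k) (stdTuple X hi p) (stdTuple X hi q)
        (Function.update f b (stdTuple X hi p) j) x =
        if (j = a ∨ j = b) ∧ x = stdTuple X hi q then 1 else 0 := fun j x => by
      have hj : ((Function.update f b (stdTuple X hi p) j : Fin (dim X l)) : ℕ) < l := by
        rw [Function.update_apply]
        split_ifs
        · exact hlt p
        · exact hlt _
      rw [rootMat, Matrix.of_apply]
      have h2 : (if Function.update f b (stdTuple X hi p) j = (stdTuple X hi q).rev ∧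
          x = (stdTuple X hi p).rev then formSign k X l (stdTuple X hi p) *
            formSign k X l (stdTuple X hi q) else 0) = 0 := by
        by_cases hX : X = .A
        · subst hX
          simp [formSign]
        · refine if_neg fun h' => ?_
          have := rev_ge_of_lt hX (hlt q)
          rw [← h'.1] at this
          omega
      rw [h2, sub_zero]
      have h3 : Function.update f b (stdTuple X hi p) j = stdTuple X hi p ↔ j = a ∨ j = b := by
        rw [Function.update_apply]
        split_ifs with hjb
        · simp [hjb]
        · rw [← hfa, hfi.eq_iff]
          simp [hjb]
      simp only [h3]
    simp only [derAct, hent, ite_mul, one_mul, zero_mul, Pi.zero_apply] at h1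
    have h4 : ∀ j, ∑ x, (if (j = a ∨ j = b) ∧ x = stdTuple X hi q then
        c (Function.update (Function.update f b (stdTuple X hi p)) j x) else 0) =
        if j = a ∨ j = b then
          c (Function.update (Function.update f b (stdTuple X hi p)) j (stdTuple X hi q))
        else 0 := fun j => by
      by_cases hj : j = a ∨ j = b <;> simp [hj]
    simp only [h4] at h1
    rw [← Finset.sum_filter, show Finset.univ.filter (fun j => j = a ∨ j = b) = {a, b} by
      ext; simp, Finset.sum_pair hab] at h1
    have h5 : Function.update (Function.update f b (stdTuple X hi p)) a (stdTuple X hi q) =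
        stdTuple X hi ∘ (Equiv.swap p q * τ) := by
      funext j
      simp only [Function.update_apply, hf, Function.comp_apply, Equiv.Perm.mul_apply,
        Equiv.swap_apply_def, ← τ.eq_symm_apply]
      change (if j = a then _ else if j = b then _ else _) =
        stdTuple X hi (if j = a then _ else if j = b then _ else _)
      split_ifs <;> rfl
    have h6 : Function.update (Function.update f b (stdTuple X hi p)) b (stdTuple X hi q) = f := by
      rw [Function.update_idem, ← hfb, Function.update_eq_self]
    rw [h5, h6, ih] at h1
    rw [Units.val_mul, Units.val_neg, Units.val_one, Int.cast_mul, Int.cast_neg, Int.cast_one]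
    linear_combination h1

/-- Two such tensors of degree `i` are equal if they agree in one coordinate. -/
theorem eq_of_coord_std [CharZero k] (hi : i ≤ l) {c c' : Tup k (dim X l) i}
    (hc : ∀ (g : Gp X l k) (s : k), extRep X l k i g (topVector X l k i) = s • topVector X l k i →
      tact (mat g) c = s • c)
    (hc' : ∀ (g : Gp X l k) (s : k), extRep X l k i g (topVector X l k i) = s • topVector X l k i →
      tact (mat g) c' = s • c') (h0 : c (stdTuple X hi) = c' (stdTuple X hi)) : c = c' := by
  have hd : ∀ (g : Gp X l k) (s : k), extRep X l k i g (topVector X l k i) = s • topVector X l k i →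
      tact (mat g) (c - c') = s • (c - c') := fun g s hg => by
    rw [map_sub, hc g s hg, hc' g s hg, smul_sub]
  rw [← sub_eq_zero]
  funext h
  by_contra hh
  obtain ⟨τ, hτ⟩ := exists_perm (f₀ := h) (stdTuple_injective (X := X) hi) fun a =>
    mem_range_of_weight hi hd hh (p := stdTuple X hi a) a.2
  refine hh ?_
  have h1 := coord_std_comp_perm hi hd τ.symm
  rw [Pi.sub_apply c c' (stdTuple X hi), h0, sub_self, mul_zero, hτ] at h1
  simpa [Function.comp_assoc] using h1

/-- The coordinates of the image of the highest weight vector in a tensor power. -/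
theorem tact_tensorCoord [CharZero k] (hl : 1 ≤ l)
    (f : (Veps X l k i).IntertwiningMap (tensorPow (Veps X l k 1) j)) (g : Gp X l k) (s : k)
    (h : extRep X l k i g (topVector X l k i) = s • topVector X l k i) :
    tact (mat g) (tensorCoord hl j (f ⟨_, topVector_mem⟩)) =
      s • tensorCoord hl j (f ⟨_, topVector_mem⟩) := by
  rw [← tensorCoord_equivariant, ← f.isIntertwining _ _, ← map_smul, ← map_smul]
  congr 2
  exact Subtype.ext h

/-- The embedding of `V_{ε_i}` into the tensor power of degree `i`. -/
def vepsToTensorPow [CharZero k] (hl : 1 ≤ l) (i : ℕ) :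
    (Veps X l k i).IntertwiningMap (tensorPow (Veps X l k 1) i) where
  toLinearMap := (tensorCoord hl i).symm.toLinearMap ∘ₗ phi k (dim X l) i ∘ₗ
    (VepsSub X l k i).toSubmodule.subtype
  isIntertwining' g := LinearMap.ext fun x => by
    apply (tensorCoord hl i).injective
    simp only [LinearMap.comp_apply, LinearEquiv.coe_coe, LinearEquiv.apply_symm_apply,
      tensorCoord_equivariant]
    exact phi_extRep g x.1

theorem tensorCoord_vepsToTensorPow [CharZero k] (hl : 1 ≤ l)
    (x : (VepsSub X l k i).toSubmodule) :
    tensorCoord hl i (vepsToTensorPow hl i x) = phi k (dim X l) i x.1 :=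
  (tensorCoord hl i).apply_symm_apply _

theorem vepsToTensorPow_injective [CharZero k] (hl : 1 ≤ l) :
    Function.Injective (vepsToTensorPow (X := X) (k := k) hl i) := fun x y h => by
  have h1 := congrArg (tensorCoord hl i) h
  rw [tensorCoord_vepsToTensorPow, tensorCoord_vepsToTensorPow] at h1
  exact Subtype.ext (phi_injective h1)

theorem finrank_intertwiningMap_tensorPow [CharZero k] (hl : 1 ≤ l) (hi : i ≤ l) :
    Module.finrank k ((Veps X l k i).IntertwiningMap (tensorPow (Veps X l k 1) i)) = 1 := by
  have h1 : tensorCoord hl i (vepsToTensorPow hl i ⟨_, topVector_mem⟩) =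
      wedge k (stdTuple X hi) := by
    rw [tensorCoord_vepsToTensorPow, phi_topVector hi]
  have h2 := wedge_self (k := k) (stdTuple_injective (X := X) hi)
  let ev : (Veps X l k i).IntertwiningMap (tensorPow (Veps X l k 1) i) →ₗ[k] k :=
    { toFun := fun f => tensorCoord hl i (f ⟨_, topVector_mem⟩) (stdTuple X hi)
      map_add' := fun f g => by
        rw [Representation.IntertwiningMap.coe_add, Pi.add_apply, map_add, Pi.add_apply]
      map_smul' := fun c f => by
        rw [Representation.IntertwiningMap.smul_apply, map_smul]
        rfl }
  have hev : ev (vepsToTensorPow hl i) = 1 := (congrFun h1 _).trans h2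
  have hbij : Function.Bijective ev := by
    refine ⟨fun f g hfg => intertwiningMap_ext ?_, fun c => ⟨c • vepsToTensorPow hl i, ?_⟩⟩
    · exact (tensorCoord hl i).injective
        (eq_of_coord_std hi (tact_tensorCoord hl f) (tact_tensorCoord hl g) hfg)
    · rw [map_smul, hev, smul_eq_mul, mul_one]
  rw [(LinearEquiv.ofBijective ev hbij).finrank_eq, Module.finrank_self]

theorem not_injective_tensorPow [CharZero k] (hl : 1 ≤ l) (hi : i ≤ l) (hj : j < i)
    (f : (Veps X l k i).IntertwiningMap (tensorPow (Veps X l k 1) j)) :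
    ¬ Function.Injective f := fun hf => by
  have h1 := eq_zero_of_lt hi hj (tact_tensorCoord hl f)
  rw [LinearEquiv.map_eq_zero_iff, ← map_zero f] at h1
  exact topVector_ne_zero hi (congrArg Subtype.val (hf h1))

end TensorPowers

/-! ### The subgroups as stabilizers of a vector and a matrix -/

section Stabilizers

variable (X : CType) (l : ℕ) (k : Type*) [Field k]

/-- The index of the basis vector fixed by the subgroup `H`. -/
def fixedIdx : CType → ℕ → ℕ
  | .A, l => l
  | .B, l => l
  | .C, _ => 0

/-- The column of the entry of `pairMat` in a given row that may be nonzero. -/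
def pairing : (X : CType) → (l : ℕ) → Fin (dim X l) → Fin (dim X l)
  | .A, l, p => if (p : ℕ) % 2 = 0 then (if h : (p : ℕ) + 1 < l + 1 then ⟨p + 1, h⟩ else p)
      else ⟨p - 1, (Nat.sub_le _ _).trans_lt p.2⟩
  | .B, _, p => p.rev
  | .C, _, p => p.rev

/-- The entries of `pairMat`. -/
def pairCoef : (X : CType) → (l : ℕ) → Fin (dim X l) → k
  | .A, l, p => if (p : ℕ) % 2 = 0 then (if (p : ℕ) + 1 < l + 1 then 1 else 0) else -1
  | .B, l, p => if (p : ℕ) < l then 1 else if l < (p : ℕ) then -1 else 0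
  | .C, l, p => if (p : ℕ) < (l + 1) / 2 then 1 else if 2 * l ≤ p + (l + 1) / 2 then -1 else 0

/-- The alternating matrix `K` such that `H` consists of the `g` in the group that fix the basis
vector of index `fixedIdx` and satisfy `g * K * gᵀ = K`. In type `A` this is the matrix of the
bivector, in types `B` and `C` it is the product of the form and of the diagonal matrix whose
eigenspaces are the subspaces stabilized by `H`. -/
def pairMat : Matrix (Fin (dim X l)) (Fin (dim X l)) k :=
  Matrix.of fun p q => if q = pairing X l p then pairCoef k X l p else 0

variable {X l k}

theorem mem_coordSpan (P : ℕ → Prop) (v : Std X l k) :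
    v ∈ coordSpan X l k P ↔ ∀ x : Fin (dim X l), ¬ P x → v x = 0 := by
  constructor
  · intro hv x hx
    have : coordSpan X l k P ≤ LinearMap.ker (LinearMap.proj x : Std X l k →ₗ[k] k) := by
      refine Submodule.span_le.2 ?_
      rintro _ ⟨p, hp, rfl⟩
      exact if_neg fun h : (x : ℕ) = p => hx (h ▸ hp)
    exact this hv
  · intro hv
    have h1 : v = ∑ x : Fin (dim X l), v x • e X l k x := by
      funext y
      simp [e, Finset.sum_apply, ← Fin.ext_iff]
    rw [h1]
    refine Submodule.sum_mem _ fun x _ => ?_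
    by_cases hx : P x
    · exact Submodule.smul_mem _ _ (Submodule.subset_span ⟨x, hx, rfl⟩)
    · rw [hv x hx, zero_smul]
      exact Submodule.zero_mem _

theorem mulVec_e (g : Matrix (Fin (dim X l)) (Fin (dim X l)) k) (p x : Fin (dim X l)) :
    (g *ᵥ e X l k p) x = g x p := by
  simp [Matrix.mulVec, dotProduct, e, ← Fin.ext_iff]

theorem mem_stabSub_coordSpan (P : ℕ → Prop) (g : Gp X l k) :
    g ∈ stabSub (stdRep X l k) (coordSpan X l k P) ↔
      ∀ x y : Fin (dim X l), P y → ¬ P x → mat g x y = 0 := by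
  constructor
  · intro h x y hy hx
    have h1 : stdRep X l k g (e X l k y) ∈ coordSpan X l k P := by
      have : (coordSpan X l k P).map (stdRep X l k g) = coordSpan X l k P := h
      rw [← this]
      exact ⟨_, Submodule.subset_span ⟨y, hy, rfl⟩, rfl⟩
    exact (mulVec_e (mat g) y x).symm.trans ((mem_coordSpan P _).1 h1 x hx)
  · intro h
    have hinj : Function.Injective (stdRep X l k g) := by
      refine Function.LeftInverse.injective (g := stdRep X l k g⁻¹) fun v => ?_
      rw [← Module.End.mul_apply, ← map_mul, inv_mul_cancel, map_one, Module.End.one_apply]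
    refine Submodule.eq_of_le_of_finrank_eq ?_
      (Submodule.equivMapOfInjective _ hinj _).finrank_eq.symm
    rw [Submodule.map_le_iff_le_comap, coordSpan, Submodule.span_le]
    rintro _ ⟨p, hp, rfl⟩
    by_cases hpN : p < dim X l
    · refine (mem_coordSpan P _).2 fun x hx => ?_
      exact (mulVec_e (mat g) ⟨p, hpN⟩ x).trans (h x ⟨p, hpN⟩ hp hx)
    · have : e X l k p = 0 := by
        funext q
        exact if_neg fun h : (q : ℕ) = p => hpN (h ▸ q.2)
      rw [this]
      exact Submodule.zero_mem _

theorem mem_stabVec {M : Type*} [AddCommMonoid M] [Module k M]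
    (ρ : Representation k (Gp X l k) M) (v : M) (g : Gp X l k) :
    g ∈ stabVec ρ v ↔ ρ g v = v := Iff.rfl

theorem eq_pairing_typeA (p q : Fin (dim .A l)) : q = pairing .A l p ↔
    (q : ℕ) = if (p : ℕ) % 2 = 0 then (if (p : ℕ) + 1 < l + 1 then (p : ℕ) + 1 else p)
      else (p : ℕ) - 1 := by
  rw [Fin.ext_iff, pairing]
  split_ifs <;> rfl

theorem phi_bivector (f : Fin 2 → Fin (dim .A l)) :
    phi k (dim .A l) 2 (bivector .A l k) f = pairMat .A l k (f 0) (f 1) := by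
  rw [bivector, map_sum, Finset.sum_apply]
  have h1 : ∀ j, phi k (dim .A l) 2 (exteriorPower.ιMulti k 2
      ![e .A l k (2 * j), e .A l k (2 * j + 1)]) f =
      (if (f 0 : ℕ) = 2 * j ∧ (f 1 : ℕ) = 2 * j + 1 then 1 else 0) -
      (if (f 0 : ℕ) = 2 * j + 1 ∧ (f 1 : ℕ) = 2 * j then 1 else 0) := fun j => by
    rw [phi_ιMulti, Matrix.det_fin_two]
    simp only [Matrix.of_apply, Matrix.cons_val_zero, Matrix.cons_val_one, e, ite_and]
    split_ifs <;> simp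
  simp only [h1]
  have hf0 := (f 0).2
  have hf1 := (f 1).2
  simp only [dim] at hf0 hf1
  rw [Finset.sum_eq_single ((f 0 : ℕ) / 2)]
  · rw [pairMat, Matrix.of_apply, if_congr (eq_pairing_typeA _ _) rfl rfl]
    simp only [pairCoef]
    split_ifs <;> first | (exfalso; omega) | simp
  · intro j _ hj
    rw [if_neg (by omega), if_neg (by omega), sub_zero]
  · intro h
    simp only [Finset.mem_range, dim] at h
    rw [if_neg (by omega), if_neg (by omega), sub_zero]

theorem tact_matrix {N : ℕ} (g K : Matrix (Fin N) (Fin N) k) (f : Fin 2 → Fin N) :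
    tact g (fun h : Fin 2 → Fin N => K (h 0) (h 1)) f = (g * K * gᵀ) (f 0) (f 1) := by
  rw [tact_apply, ← (finTwoArrowEquiv (Fin N)).symm.sum_comp, Fintype.sum_prod_type_right]
  simp only [finTwoArrowEquiv_symm_apply, Fin.prod_univ_two, Matrix.cons_val_zero,
    Matrix.cons_val_one, Matrix.mul_apply, Matrix.transpose_apply, Finset.sum_mul]
  exact Finset.sum_congr rfl fun x _ => Finset.sum_congr rfl fun y _ => by ring

theorem mem_stabVec_bivector (g : Gp .A l k) :
    g ∈ stabVec (extRep .A l k 2) (bivector .A l k) ↔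
      mat g * pairMat .A l k * (mat g)ᵀ = pairMat .A l k := by
  have h1 : phi k (dim .A l) 2 (bivector .A l k) =
      fun h => pairMat .A l k (h 0) (h 1) := funext phi_bivector
  rw [mem_stabVec, ← phi_injective.eq_iff, phi_extRep, h1]
  constructor
  · intro h
    ext x y
    have := congrFun h ![x, y]
    rwa [tact_matrix] at this
  · intro h
    funext f
    rw [tact_matrix, h]

theorem pairMat_eq (hX : X ≠ .A) : pairMat X l k =
    Matrix.diagonal (fun p => pairCoef k X l p * formSign k X l p) * form k X l := by
  ext p q
  rw [Matrix.diagonal_mul, form_apply, pairMat, Matrix.of_apply]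
  have h1 : pairing X l p = p.rev := by
    cases X
    · exact absurd rfl hX
    all_goals rfl
  rw [h1]
  split_ifs
  · rw [mul_assoc, formSign_mul_self X l k hX, mul_one]
  · rw [mul_zero]

/-- In types `B` and `C`, the condition on `K` says that `g` preserves the eigenspaces of a
diagonal matrix. -/
theorem mul_pairMat_mul_iff (hX : X ≠ .A) (g : Gp X l k) :
    mat g * pairMat X l k * (mat g)ᵀ = pairMat X l k ↔
      ∀ x y, pairCoef k X l x * formSign k X l x ≠ pairCoef k X l y * formSign k X l y →
        mat g x y = 0 := by
  rw [pairMat_eq hX]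
  set d : Fin (dim X l) → k := fun p => pairCoef k X l p * formSign k X l p
  have h1 := form_mul_form X l k hX
  have h2 := mat_form' g
  have h3 : form k X l * (formParity k X • form k X l) = 1 := by
    rw [mul_smul_comm, h1, smul_smul, formParity_mul_self, one_smul]
  have hu : IsUnit (mat g)ᵀ := by
    rw [Matrix.isUnit_iff_isUnit_det, Matrix.det_transpose, g.1.2]
    exact isUnit_one
  have hcomm : mat g * (Matrix.diagonal d * form k X l) * (mat g)ᵀ =
      Matrix.diagonal d * form k X l ↔ mat g * Matrix.diagonal d = Matrix.diagonal d * mat g := by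
    rw [← h2]
    constructor
    · intro h
      rw [h2] at h
      have h4 : mat g * Matrix.diagonal d * form k X l * (mat g)ᵀ =
          Matrix.diagonal d * mat g * form k X l * (mat g)ᵀ := by
        calc _ = mat g * (Matrix.diagonal d * form k X l) * (mat g)ᵀ := by
              simp only [Matrix.mul_assoc]
          _ = Matrix.diagonal d * form k X l := h
          _ = Matrix.diagonal d * (mat g * form k X l * (mat g)ᵀ) := by rw [h2]
          _ = _ := by simp only [Matrix.mul_assoc]
      have h5 := hu.mul_left_injective h4
      have h6 := congrArg (· * (formParity k X • form k X l)) h5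
      simpa only [Matrix.mul_assoc, h3, mul_one] using h6
    · intro h
      rw [h2]
      calc _ = mat g * Matrix.diagonal d * form k X l * (mat g)ᵀ := by
            simp only [Matrix.mul_assoc]
        _ = Matrix.diagonal d * (mat g * form k X l * (mat g)ᵀ) := by
            rw [h]
            simp only [Matrix.mul_assoc]
        _ = _ := by rw [h2]
  rw [hcomm, ← Matrix.ext_iff]
  refine forall_congr' fun x => forall_congr' fun y => ?_
  rw [Matrix.mul_diagonal, Matrix.diagonal_mul, mul_comm]
  constructor
  · intro h hne
    exact (mul_eq_mul_right_iff.1 h).resolve_left (Ne.symm hne)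
  · intro h
    by_cases hxy : d x = d y
    · rw [hxy]
    · rw [h hxy, mul_zero, mul_zero]

/-- The subgroup `H` consists of the `g` that fix a basis vector and the tensor `K`. -/
theorem mem_modelSubgroup_iff [CharZero k] (g : Gp X l k) : g ∈ modelSubgroup k X l ↔
    mat g *ᵥ e X l k (fixedIdx X l) = e X l k (fixedIdx X l) ∧
      mat g * pairMat X l k * (mat g)ᵀ = pairMat X l k := by
  have h1 : (1 : k) ≠ -1 := fun h => two_ne_zero (α := k) (by linear_combination h)
  cases X
  · exact and_congr Iff.rfl (mem_stabVec_bivector g)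
  · rw [mul_pairMat_mul_iff (by simp)]
    change (_ ∧ g ∈ stabSub _ _) ∧ g ∈ stabSub _ _ ↔ _
    rw [mem_stabSub_coordSpan, mem_stabSub_coordSpan, and_assoc]
    refine and_congr_right fun hv => ?_
    simp only [pairCoef, formSign, mul_one]
    constructor
    · rintro ⟨h2, h3⟩ x y hxy
      by_cases hy : (y : ℕ) < l
      · exact h2 x y hy fun hx => hxy (by rw [if_pos hx, if_pos hy])
      · by_cases hy' : l < (y : ℕ)
        · exact h3 x y hy' fun hx => hxy (by
            rw [if_neg (by omega), if_neg hy, if_pos hx, if_pos hy'])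
        · have hyl : (y : ℕ) = l := by omega
          have h4 := congrFun hv x
          have h5 : e .B l k l = e .B l k y := by rw [hyl]
          rw [h5] at h4
          refine (mulVec_e (mat g) y x).symm.trans (h4.trans (if_neg fun hx => hxy ?_))
          rw [hx]
    · intro h
      refine ⟨fun x y hy hx => h x y ?_, fun x y hy hx => h x y ?_⟩
      · rw [if_neg hx, if_pos hy]
        split_ifs
        · exact h1.symm
        · exact zero_ne_one
      · rw [if_neg hx, if_neg (c := (y : ℕ) < l) (by omega), if_pos hy]
        split_ifs
        · exact h1
        · exact fun h' => one_ne_zero (α := k) (by linear_combination h')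
  · rw [mul_pairMat_mul_iff (by simp)]
    change (_ ∧ g ∈ stabSub _ _) ∧ g ∈ stabSub _ _ ↔ _
    rw [mem_stabSub_coordSpan, mem_stabSub_coordSpan, and_assoc]
    refine and_congr_right fun hv => ?_
    have hd : ∀ p : Fin (dim .C l), pairCoef k .C l p * formSign k .C l p =
        if (p : ℕ) < (l + 1) / 2 ∨ 2 * l ≤ p + (l + 1) / 2 then 1 else 0 := fun p => by
      have := p.2
      simp only [dim] at this
      simp only [pairCoef, formSign]
      split_ifs <;> first | (exfalso; omega) | simp
    simp only [hd]
    constructor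
    · rintro ⟨h2, h3⟩ x y hxy
      by_cases hy : (y : ℕ) < (l + 1) / 2 ∨ 2 * l ≤ y + (l + 1) / 2
      · exact h2 x y hy fun hx => hxy (by rw [if_pos hx, if_pos hy])
      · refine h3 x y (by omega) fun hx => hxy ?_
        rw [if_neg (by omega), if_neg hy]
    · intro h
      refine ⟨fun x y hy hx => h x y ?_, fun x y hy hx => h x y ?_⟩
      · rw [if_neg hx, if_pos hy]
        exact zero_ne_one
      · rw [if_pos (by omega), if_neg (by omega)]
        exact one_ne_zero

end Stabilizers

/-! ### The invariant tensors -/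

section InvariantTensor

variable {k : Type*} [Field k] {N : ℕ}

/-- The entries of the tensor `K ⊗ K ⊗ ⋯`, followed by the vector `v` in odd degree. -/
def pairTensorList (K : Matrix (Fin N) (Fin N) k) (v : Fin N → k) : List (Fin N) → k
  | [] => 1
  | [a] => v a
  | a :: b :: L => K a b * pairTensorList K v L

/-- The tensor `K ⊗ K ⊗ ⋯` of degree `i`, with the vector `v` as last factor if `i` is odd. -/
def pairTensor (K : Matrix (Fin N) (Fin N) k) (v : Fin N → k) (i : ℕ) : Tup k N i :=
  fun f => pairTensorList K v (List.ofFn f)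

theorem pairTensor_zero (K : Matrix (Fin N) (Fin N) k) (v : Fin N → k) (f : Fin 0 → Fin N) :
    pairTensor K v 0 f = 1 := by
  simp [pairTensor, pairTensorList]

theorem pairTensor_one (K : Matrix (Fin N) (Fin N) k) (v : Fin N → k) (f : Fin 1 → Fin N) :
    pairTensor K v 1 f = v (f 0) := by
  simp [pairTensor, pairTensorList]

theorem pairTensor_add_two (K : Matrix (Fin N) (Fin N) k) (v : Fin N → k) (i : ℕ)
    (f : Fin (i + 2) → Fin N) :
    pairTensor K v (i + 2) f = K (f 0) (f 1) * pairTensor K v i fun j => f j.succ.succ := by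
  simp only [pairTensor, List.ofFn_succ, pairTensorList]
  rfl

theorem pairTensorList_append (K : Matrix (Fin N) (Fin N) k) (v : Fin N → k) (L : List (Fin N)) :
    ∀ (n : ℕ) (M : List (Fin N)), M.length = 2 * n →
      pairTensorList K v (M ++ L) = pairTensorList K v M * pairTensorList K v L
  | 0, M, h => by
    rw [List.length_eq_zero_iff.1 h]
    simp [pairTensorList]
  | n + 1, [], h => by simp at h
  | n + 1, [a], h => by simp at h; omega
  | n + 1, a :: b :: M, h => by
    simp only [List.cons_append, pairTensorList]
    rw [pairTensorList_append K v L n M (by simp only [List.length_cons] at h; omega), mul_assoc]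

theorem pairTensor_append (K : Matrix (Fin N) (Fin N) k) (v : Fin N → k) (n i : ℕ)
    (f : Fin (2 * n) → Fin N) (f' : Fin i → Fin N) :
    pairTensor K v (2 * n + i) (Fin.append f f') = pairTensor K v (2 * n) f * pairTensor K v i f' := by
  simp only [pairTensor, List.ofFn_fin_append]
  exact pairTensorList_append K v _ n _ (List.length_ofFn)

theorem tact_pairTensor (g K : Matrix (Fin N) (Fin N) k) (v : Fin N → k) :
    ∀ (i : ℕ), tact g (pairTensor K v i) = pairTensor (g * K * gᵀ) (g *ᵥ v) i
  | 0 => by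
    funext f
    rw [tact_apply, pairTensor_zero]
    simp [pairTensor_zero]
  | 1 => by
    funext f
    rw [tact_apply, pairTensor_one, ← (Equiv.funUnique (Fin 1) (Fin N)).symm.sum_comp]
    simp [pairTensor_one, Matrix.mulVec, dotProduct]
  | i + 2 => by
    funext f
    have ih := congrFun (tact_pairTensor g K v i) fun j => f j.succ.succ
    rw [pairTensor_add_two, ← ih, tact_apply, tact_apply,
      ← (Fin.consEquiv fun _ : Fin (i + 2) => Fin N).sum_comp, Fintype.sum_prod_type]
    have h1 : ∀ x : Fin N, ∑ h : Fin (i + 1) → Fin N,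
        (∏ j, g (f j) (Fin.consEquiv (fun _ : Fin (i + 2) => Fin N) (x, h) j)) *
          pairTensor K v (i + 2) (Fin.consEquiv (fun _ : Fin (i + 2) => Fin N) (x, h)) =
        ∑ y, ∑ h : Fin i → Fin N, g (f 0) x * (g (f 1) y * ∏ j, g (f j.succ.succ) (h j)) *
          (K x y * pairTensor K v i h) := fun x => by
      rw [← (Fin.consEquiv fun _ : Fin (i + 1) => Fin N).sum_comp, Fintype.sum_prod_type]
      refine Finset.sum_congr rfl fun y _ => Finset.sum_congr rfl fun h _ => ?_
      rw [Fin.prod_univ_succ, Fin.prod_univ_succ, pairTensor_add_two]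
      rfl
    rw [Finset.sum_congr rfl fun x _ => h1 x, Finset.sum_comm, Matrix.mul_apply, Finset.sum_mul]
    refine Finset.sum_congr rfl fun y _ => ?_
    rw [Matrix.mul_apply, Finset.sum_mul, Finset.sum_mul]
    refine Finset.sum_congr rfl fun x _ => ?_
    rw [Finset.mul_sum]
    refine Finset.sum_congr rfl fun h _ => ?_
    rw [Matrix.transpose_apply]
    ring

end InvariantTensor

/-! ### Copies of the dual modules in the coordinate ring -/

section DualCopies

variable {X : CType} {l : ℕ} {k : Type*} [Field k] {i : ℕ}

/-- The functional on `V_{ε_i}` given by the dot product with a primitive tensor. -/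
def dotDual (X : CType) (l : ℕ) (k : Type*) [Field k] (i : ℕ) :
    prim X l k i →ₗ[k] Module.Dual k (VepsSub X l k i).toSubmodule :=
  LinearMap.mk₂ k (fun y x => y.1 ⬝ᵥ phi k (dim X l) i x.1) (fun _ _ _ => add_dotProduct _ _ _)
    (fun _ _ _ => smul_dotProduct _ _ _)
    (fun _ _ _ => by
      rw [Submodule.coe_add, map_add, dotProduct_add])
    (fun _ _ _ => by
      rw [Submodule.coe_smul, map_smul, dotProduct_smul])

theorem dotDual_apply (y : prim X l k i) (x : (VepsSub X l k i).toSubmodule) :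
    dotDual X l k i y x = y.1 ⬝ᵥ phi k (dim X l) i x.1 := rfl

/-- The coordinates identify `V_{ε_i}` with the primitive tensors. -/
def phiEquiv [CharZero k] (hi : i ≤ l) :
    (VepsSub X l k i).toSubmodule ≃ₗ[k] prim X l k i :=
  (Submodule.equivMapOfInjective _ phi_injective _).trans
    (LinearEquiv.ofEq _ _ (map_phi_vepsSub hi))

theorem dotDual_bijective [CharZero k] (hi : i ≤ l) :
    Function.Bijective (dotDual X l k i) := by
  have hinj : Function.Injective (dotDual X l k i) := by
    rw [injective_iff_map_eq_zero]
    intro y hy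
    refine Subtype.ext (eq_zero_of_orthogonal hi prim_stable
      (wedge_mem_prim fun a => a.2.trans_le hi) y.2 fun z hz => ?_)
    rw [← map_phi_vepsSub hi] at hz
    obtain ⟨x, hx, rfl⟩ := hz
    exact LinearMap.congr_fun hy ⟨x, hx⟩
  refine ⟨hinj, (LinearMap.injective_iff_surjective_of_finrank_eq_finrank ?_).1 hinj⟩
  rw [(phiEquiv hi).symm.dualMap.finrank_eq, Subspace.dual_finrank_eq]

theorem dual_dotDual [CharZero k] (x : Gp X l k) (y : prim X l k i) :
    (Veps X l k i).dual x (dotDual X l k i y) =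
      dotDual X l k i ⟨tact (mat (transp x⁻¹)) y.1, prim_stable _ _ y.2⟩ := by
  refine LinearMap.ext fun v => ?_
  rw [dotDual_apply, tact_dotProduct, mat_transp, Matrix.transpose_transpose, ← phi_extRep]
  rfl

theorem matrixEntry_mem (a b : Fin (dim X l)) :
    (fun g : Gp X l k => mat g a b) ∈ regularFunctions X l k :=
  ⟨MvPolynomial.X (a, b), MvPolynomial.aeval_X _ _⟩

/-- The function `g ↦ y ⬝ᵥ g w` on the group. -/
theorem coef_mem_regularFunctions (y w : Tup k (dim X l) i) :
    (fun g : Gp X l k => y ⬝ᵥ tact (mat g) w) ∈ regularFunctions X l k := by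
  have : (fun g : Gp X l k => y ⬝ᵥ tact (mat g) w) =
      ∑ f, y f • ∑ h : Fin i → Fin (dim X l),
        w h • ∏ j, fun g : Gp X l k => mat g (f j) (h j) := by
    funext g
    simp only [dotProduct, tact_apply, Finset.sum_apply, Pi.smul_apply, smul_eq_mul,
      Finset.prod_apply]
    refine Finset.sum_congr rfl fun f _ => ?_
    congr 1
    exact Finset.sum_congr rfl fun h _ => mul_comm _ _
  rw [this]
  exact Subalgebra.sum_mem _ fun f _ => Subalgebra.smul_mem _ (Subalgebra.sum_mem _ fun h _ =>
    Subalgebra.smul_mem _ (Subalgebra.prod_mem _ fun j _ => matrixEntry_mem _ _) _) _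

/-- The invariant tensor of the subgroup `H`, of degree `i`. -/
def invTensor (X : CType) (l : ℕ) (k : Type*) [Field k] (i : ℕ) : Tup k (dim X l) i :=
  pairTensor (pairMat X l k) (e X l k (fixedIdx X l)) i

theorem tact_invTensor [CharZero k] {h : Gp X l k} (hh : h ∈ modelSubgroup k X l) :
    tact (mat h) (invTensor X l k i) = invTensor X l k i := by
  obtain ⟨h1, h2⟩ := (mem_modelSubgroup_iff h).1 hh
  rw [invTensor, tact_pairTensor, h1, h2]

/-- The matrix coefficients `g ↦ y ⬝ᵥ g w`, for the invariant tensor `w`. -/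
def coef [CharZero k] (X : CType) (l i : ℕ) : Tup k (dim X l) i →ₗ[k] coordinateRing X l k where
  toFun y := ⟨fun g => y ⬝ᵥ tact (mat g) (invTensor X l k i),
    coef_mem_regularFunctions _ _, fun g _ hh =>
      congrArg (y ⬝ᵥ ·) ((tact_mul _ _ _).trans (congrArg (tact (mat g)) (tact_invTensor hh)))⟩
  map_add' _ _ := Subtype.ext (funext fun _ => add_dotProduct _ _ _)
  map_smul' _ _ := Subtype.ext (funext fun _ => smul_dotProduct _ _ _)

theorem coef_apply [CharZero k] (y : Tup k (dim X l) i) (g : Gp X l k) :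
    (coef X l i y).1 g = y ⬝ᵥ tact (mat g) (invTensor X l k i) := rfl

theorem coordRep_coef [CharZero k] (x : Gp X l k) (y : Tup k (dim X l) i) :
    coordRep X l k x (coef X l i y) = coef X l i (tact (mat (transp x⁻¹)) y) :=
  Subtype.ext (funext fun g => by
    change (coef X l i y).1 (x⁻¹ * g) = _
    rw [coef_apply, coef_apply, mat_mul, tact_mul, tact_dotProduct, mat_transp,
      Matrix.transpose_transpose])

/-- A space of primitive tensors that is stable under the transposed action and contains the
highest weight vector is everything. -/
theorem prim_le_of_stable [CharZero k] (hi : i ≤ l) {S : Submodule k (Tup k (dim X l) i)}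
    (hS : ∀ x : Gp X l k, ∀ y ∈ S, tact (mat (transp x⁻¹)) y ∈ S)
    (h : wedge k (stdTuple X hi) ∈ S) : prim X l k i ≤ S := by
  have hS' : GStable X l S := fun g y hy => by
    have h1 := hS (transp g)⁻¹ y hy
    rw [inv_inv] at h1
    exact h1
  rw [← map_phi_vepsSub hi, Submodule.map_le_iff_le_comap]
  refine vepsSub_induction ?_ fun g x hx => ?_
  · rw [Submodule.mem_comap, phi_topVector hi]
    exact h
  · rw [Submodule.mem_comap] at hx ⊢
    rw [phi_extRep]
    exact hS' g _ hx

theorem coef_injOn [CharZero k] (hi : i ≤ l) {y₀ : Tup k (dim X l) i} (hy₀ : y₀ ∈ prim X l k i)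
    (h : coef X l i y₀ ≠ 0) {y : Tup k (dim X l) i} (hy : y ∈ prim X l k i)
    (h0 : coef X l i y = 0) : y = 0 := by
  by_contra hne
  set S : Submodule k (Tup k (dim X l) i) := prim X l k i ⊓ LinearMap.ker (coef X l i)
  have hS : ∀ x : Gp X l k, ∀ y ∈ S, tact (mat (transp x⁻¹)) y ∈ S := fun x y hy =>
    ⟨prim_stable _ _ hy.1, (coordRep_coef x y).symm.trans
      ((congrArg (coordRep X l k x) hy.2).trans (map_zero _))⟩
  have hS' : GStable X l S := fun g y hy => by
    have h1 := hS (transp g)⁻¹ y hy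
    rw [inv_inv] at h1
    exact h1
  have h1 := wedge_std_mem hi hS' inf_le_left ((Submodule.ne_bot_iff _).2 ⟨y, ⟨hy, h0⟩, hne⟩)
  exact h (prim_le_of_stable hi hS h1 hy₀).2

/-- A nonzero matrix coefficient gives rise to a copy of the dual module. -/
theorem exists_isDualCopy [CharZero k] (hi : i ≤ l) {y₀ : Tup k (dim X l) i}
    (hy₀ : y₀ ∈ prim X l k i) (h : coef X l i y₀ ≠ 0) :
    ∃ S, IsDualCopy X l k i S ∧ S.toSubmodule = (prim X l k i).map (coef X l i) := by
  let β := LinearEquiv.ofBijective _ (dotDual_bijective (X := X) (k := k) hi)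
  let ψ : (Veps X l k i).dual.IntertwiningMap (coordRep X l k) :=
    { toLinearMap := coef X l i ∘ₗ (prim X l k i).subtype ∘ₗ β.symm.toLinearMap
      isIntertwining' := fun x => LinearMap.ext fun ξ => by
        obtain ⟨y, rfl⟩ := β.surjective ξ
        have h1 : (Veps X l k i).dual x (β y) =
          β ⟨tact (mat (transp x⁻¹)) y.1, prim_stable _ _ y.2⟩ := dual_dotDual x y
        simp only [LinearMap.comp_apply, LinearEquiv.coe_coe, h1, LinearEquiv.symm_apply_apply,
          Submodule.subtype_apply, coordRep_coef] }
  have hψ : ∀ y, ψ (β y) = coef X l i y.1 := fun y => by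
    change coef X l i (β.symm (β y)).1 = _
    rw [LinearEquiv.symm_apply_apply]
  have hinj : Function.Injective ψ.toLinearMap := by
    rw [injective_iff_map_eq_zero]
    intro ξ hξ
    obtain ⟨y, rfl⟩ := β.surjective ξ
    have : y = 0 := Subtype.ext (coef_injOn hi hy₀ h y.2 ((hψ y).symm.trans hξ))
    rw [this, map_zero]
  refine ⟨ψ.range, ⟨Representation.Equiv.mk (LinearEquiv.ofInjective ψ.toLinearMap hinj)
    fun x => LinearMap.ext fun ξ => Subtype.ext (ψ.isIntertwining _ _ x ξ)⟩, ?_⟩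
  refine le_antisymm ?_ ?_
  · rintro _ ⟨ξ, rfl⟩
    obtain ⟨y, rfl⟩ := β.surjective ξ
    exact ⟨y.1, y.2, (hψ y).symm⟩
  · rintro _ ⟨y, hy, rfl⟩
    exact ⟨β ⟨y, hy⟩, hψ ⟨y, hy⟩⟩

/-- Frobenius reciprocity: a copy of `V_{ε_i}^*` in the coordinate ring consists of the matrix
coefficients `g ↦ ξ (g v)` for a vector `v` of `V_{ε_i}` that is invariant under `H`. -/
theorem IsDualCopy.exists_vector [CharZero k] {S : Subrepresentation (coordRep X l k)} (hi : i ≤ l)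
    (hS : IsDualCopy X l k i S) : ∃ v : (VepsSub X l k i).toSubmodule, v ≠ 0 ∧
      (∀ h ∈ modelSubgroup k X l, Veps X l k i h v = v) ∧
      ∀ f, f ∈ S.toSubmodule ↔
        ∃ ξ : Module.Dual k (VepsSub X l k i).toSubmodule, ∀ g, f.1 g = ξ (Veps X l k i g v) := by
  obtain ⟨φ⟩ := hS
  let ev : Module.Dual k (Module.Dual k (VepsSub X l k i).toSubmodule) :=
    { toFun := fun ξ => (φ ξ).1.1 1
      map_add' := fun ξ η => by rw [map_add]; rfl
      map_smul' := fun c ξ => by rw [map_smul]; rfl }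
  have : Module.IsReflexive k (VepsSub X l k i).toSubmodule := Module.equiv (phiEquiv hi).symm
  obtain ⟨v, hv⟩ := (Module.evalEquiv k (VepsSub X l k i).toSubmodule).surjective ev
  have hv' : ∀ ξ, (φ ξ).1.1 1 = ξ v := fun ξ => (LinearMap.congr_fun hv ξ).symm
  have key : ∀ ξ g, (φ ξ).1.1 g = ξ (Veps X l k i g v) := fun ξ g => by
    have h2 : φ ((Veps X l k i).dual g⁻¹ ξ) = S.toRepresentation g⁻¹ (φ ξ) :=
      LinearMap.congr_fun (φ.isIntertwining' g⁻¹) ξ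
    calc (φ ξ).1.1 g = (φ ξ).1.1 (g⁻¹⁻¹ * 1) := by rw [inv_inv, mul_one]
      _ = (φ ((Veps X l k i).dual g⁻¹ ξ)).1.1 1 := by rw [h2]; rfl
      _ = ξ (Veps X l k i g⁻¹⁻¹ v) := hv' _
      _ = ξ (Veps X l k i g v) := by rw [inv_inv]
  have hsep : ∀ x y : (VepsSub X l k i).toSubmodule, (∀ ξ : Module.Dual k _, ξ x = ξ y) → x = y :=
    fun x y h => Subtype.ext (phi_injective (funext fun f => h (LinearMap.proj f ∘ₗ
      phi k (dim X l) i ∘ₗ (VepsSub X l k i).toSubmodule.subtype)))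
  refine ⟨v, ?_, fun h hh => hsep _ _ fun ξ => ?_, fun f => ⟨fun hf => ?_, fun ⟨ξ, hξ⟩ => ?_⟩⟩
  · rintro rfl
    refine topVector_ne_zero (k := k) (X := X) hi (congrArg Subtype.val
      (hsep ⟨_, topVector_mem⟩ 0 fun ξ => ?_))
    have : ξ = 0 := EquivLike.injective φ (Subtype.ext (Subtype.ext (funext fun g => by
      rw [key, key, map_zero, map_zero, map_zero])))
    rw [this]
    rfl
  · rw [← key, ← hv', ← one_mul h]
    exact (φ ξ).1.2.2 1 h hh
  · refine ⟨φ.symm ⟨f, hf⟩, fun g => ?_⟩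
    rw [← key, Representation.Equiv.apply_symm_apply]
  · have : f = (φ ξ).1 := Subtype.ext (funext fun g => by rw [hξ, key])
    rw [this]
    exact (φ ξ).2

/-- If the `H`-invariant primitive tensors are determined by one coordinate, there is at most one
copy of the dual module. -/
theorem IsDualCopy.unique [CharZero k] (hi : i ≤ l) {f₀ : Fin i → Fin (dim X l)}
    (h0 : ∀ y ∈ prim X l k i, (∀ h ∈ modelSubgroup k X l, tact (mat h) y = y) → y f₀ = 0 → y = 0)
    {S S' : Subrepresentation (coordRep X l k)} (hS : IsDualCopy X l k i S)
    (hS' : IsDualCopy X l k i S') : S = S' := by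
  obtain ⟨v, hv0, hv, hvS⟩ := hS.exists_vector hi
  obtain ⟨v', hv0', hv', hvS'⟩ := hS'.exists_vector hi
  have hmem : ∀ x : (VepsSub X l k i).toSubmodule, phi k (dim X l) i x.1 ∈ prim X l k i :=
    fun x => (mem_vepsSub_iff hi _).1 x.2
  have hfix : ∀ x : (VepsSub X l k i).toSubmodule,
      (∀ h ∈ modelSubgroup k X l, Veps X l k i h x = x) → ∀ h ∈ modelSubgroup k X l,
        tact (mat h) (phi k (dim X l) i x.1) = phi k (dim X l) i x.1 := fun x hx h hh => by
    rw [← phi_extRep]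
    exact congrArg (fun z : (VepsSub X l k i).toSubmodule => phi k (dim X l) i z.1) (hx h hh)
  have hne : ∀ x : (VepsSub X l k i).toSubmodule, x ≠ 0 →
      (∀ h ∈ modelSubgroup k X l, Veps X l k i h x = x) → phi k (dim X l) i x.1 f₀ ≠ 0 :=
    fun x hx0 hx hc => hx0 (Subtype.ext (phi_injective
      ((h0 _ (hmem x) (hfix x hx) hc).trans (map_zero _).symm)))
  have hc := hne v hv0 hv
  have hc' := hne v' hv0' hv'
  set c := phi k (dim X l) i v.1 f₀
  set c' := phi k (dim X l) i v'.1 f₀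
  have h1 := h0 (c' • phi k (dim X l) i v.1 - c • phi k (dim X l) i v'.1)
    (Submodule.sub_mem _ (Submodule.smul_mem _ _ (hmem v)) (Submodule.smul_mem _ _ (hmem v')))
    (fun h hh => by rw [map_sub, map_smul, map_smul, hfix v hv h hh, hfix v' hv' h hh])
    (sub_eq_zero.2 (mul_comm c' c))
  have h2 : v = (c'⁻¹ * c) • v' := Subtype.ext (phi_injective (by
    rw [Submodule.coe_smul, map_smul, mul_smul, ← sub_eq_zero.1 h1, smul_smul, inv_mul_cancel₀ hc',
      one_smul]))
  have hu : c'⁻¹ * c ≠ 0 := mul_ne_zero (inv_ne_zero hc') hc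
  have hg : ∀ g, Veps X l k i g v = (c'⁻¹ * c) • Veps X l k i g v' := fun g => by
    rw [h2, map_smul]
  have hξg : ∀ (ξ : Module.Dual k (VepsSub X l k i).toSubmodule) g,
      ξ (Veps X l k i g v) = (c'⁻¹ * c) * ξ (Veps X l k i g v') := fun ξ g => by
    rw [hg, map_smul, smul_eq_mul]
  refine Subrepresentation.toSubmodule_injective (Submodule.ext fun f => ?_)
  rw [hvS, hvS']
  constructor
  · rintro ⟨ξ, hξ⟩
    exact ⟨(c'⁻¹ * c) • ξ, fun g => (hξ g).trans (hξg ξ g)⟩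
  · rintro ⟨ξ, hξ⟩
    refine ⟨(c'⁻¹ * c)⁻¹ • ξ, fun g => (hξ g).trans ?_⟩
    exact ((congrArg _ (hξg ξ g)).trans (inv_mul_cancel_left₀ hu _)).symm

end DualCopies

/-! ### Alternating sums of the invariant tensors -/

section Signs

variable {k : Type*} [Field k] {N M : ℕ}

theorem pairTensor_submatrix (K : Matrix (Fin N) (Fin N) k) (v : Fin N → k) (ρ : Fin M → Fin N) :
    ∀ (i : ℕ) (f : Fin i → Fin M),
      pairTensor (K.submatrix ρ ρ) (v ∘ ρ) i f = pairTensor K v i (ρ ∘ f)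
  | 0, f => by rw [pairTensor_zero, pairTensor_zero]
  | 1, f => by rw [pairTensor_one, pairTensor_one]; rfl
  | i + 2, f => by
    rw [pairTensor_add_two, pairTensor_add_two, pairTensor_submatrix K v ρ i]
    rfl

theorem pairTensor_even (K : Matrix (Fin N) (Fin N) k) (v v' : Fin N → k) :
    ∀ (n : ℕ) (f : Fin (2 * n) → Fin N), pairTensor K v (2 * n) f = pairTensor K v' (2 * n) f
  | 0, f => by rw [pairTensor_zero, pairTensor_zero]
  | n + 1, f => by
    refine (pairTensor_add_two K v (2 * n) f).trans (Eq.trans ?_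
      (pairTensor_add_two K v' (2 * n) f).symm)
    rw [pairTensor_even K v v' n]

/-- The matrix that pairs the indices `2 j` and `2 j + 1`. -/
def blockMat (k : Type*) [Field k] (i : ℕ) : Matrix (Fin i) (Fin i) k :=
  Matrix.of fun a b => if (a : ℕ) % 2 = 0 ∧ (b : ℕ) = a + 1 then 1 else
    if (b : ℕ) % 2 = 0 ∧ (a : ℕ) = b + 1 then -1 else 0

/-- For `i` odd, the last basis vector of `k ^ i`. -/
def lastVec (k : Type*) [Field k] (i : ℕ) : Fin i → k :=
  fun a => if (a : ℕ) % 2 = 0 ∧ (a : ℕ) + 1 = i then 1 else 0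

theorem blockMat_submatrix_succ (i : ℕ) :
    (blockMat k (i + 2)).submatrix (fun a => a.succ.succ) (fun a => a.succ.succ) =
      blockMat k i := by
  ext a b
  simp only [blockMat, Matrix.submatrix_apply, Matrix.of_apply, Fin.val_succ]
  refine if_congr (by omega) rfl (if_congr (by omega) rfl rfl)

theorem lastVec_comp_succ (i : ℕ) : (lastVec k (i + 2)) ∘ (fun a => a.succ.succ) = lastVec k i := by
  funext a
  simp only [lastVec, Function.comp_apply, Fin.val_succ]
  exact if_congr (by omega) rfl rfl

theorem pairTensor_blockMat_id : ∀ i : ℕ, pairTensor (blockMat k i) (lastVec k i) i id = 1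
  | 0 => by rw [pairTensor_zero]
  | 1 => by rw [pairTensor_one]; simp [lastVec]
  | i + 2 => by
    rw [pairTensor_add_two]
    have h1 := pairTensor_submatrix (blockMat k (i + 2)) (lastVec k (i + 2))
      (fun a => a.succ.succ) i id
    rw [blockMat_submatrix_succ, lastVec_comp_succ, pairTensor_blockMat_id i] at h1
    have h2 : (fun j : Fin i => id j.succ.succ) = (fun a => a.succ.succ) ∘ id := rfl
    rw [h2, ← h1, mul_one]
    simp [blockMat]

/-- A permutation that fixes `0` and `1` comes from a permutation of the other indices. -/
theorem exists_perm_succ_succ {i : ℕ} (τ : Equiv.Perm (Fin (i + 2))) (h0 : τ 0 = 0)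
    (h1 : τ 1 = 1) : ∃ σ : Equiv.Perm (Fin i), Equiv.Perm.sign τ = Equiv.Perm.sign σ ∧
      ∀ j : Fin i, τ j.succ.succ = (σ j).succ.succ := by
  have key : ∀ {n : ℕ} (τ : Equiv.Perm (Fin (n + 1))), τ 0 = 0 → ∃ σ : Equiv.Perm (Fin n),
      Equiv.Perm.sign τ = Equiv.Perm.sign σ ∧ ∀ j, τ j.succ = (σ j).succ := fun τ h0 => by
    obtain ⟨⟨p, σ⟩, rfl⟩ := Equiv.Perm.decomposeFin.symm.surjective τ
    rw [Equiv.Perm.decomposeFin_symm_apply_zero] at h0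
    subst h0
    exact ⟨σ, by simp, fun j => by simp⟩
  obtain ⟨σ, h2, h3⟩ := key τ h0
  obtain ⟨σ', h4, h5⟩ := key σ (Fin.succ_injective _ (by rw [← h3]; exact h1))
  exact ⟨σ', h2.trans h4, fun j => by rw [h3, h5]⟩

/-- Every nonzero term of the alternating sum of `pairTensor` over the permutations is `1`: a
permutation that contributes maps blocks to blocks, so it is an even permutation of the blocks,
composed with transpositions within the blocks, whose signs cancel. -/
theorem sign_mul_pairTensor : ∀ (i : ℕ) (τ : Equiv.Perm (Fin i)),
    pairTensor (blockMat k i) (lastVec k i) i τ = 0 ∨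
      ((Equiv.Perm.sign τ : ℤ) : k) * pairTensor (blockMat k i) (lastVec k i) i τ = 1
  | 0, τ => by
    rw [pairTensor_zero, Subsingleton.elim τ 1]
    simp
  | 1, τ => by
    rw [pairTensor_one, Subsingleton.elim τ 1]
    simp [lastVec]
  | i + 2, τ => by
    -- first for the permutations with `τ 1 = τ 0 + 1`
    have main : ∀ τ : Equiv.Perm (Fin (i + 2)), ((τ 0 : Fin (i + 2)) : ℕ) % 2 = 0 →
        ((τ 1 : Fin (i + 2)) : ℕ) = τ 0 + 1 →
        pairTensor (blockMat k (i + 2)) (lastVec k (i + 2)) (i + 2) τ = 0 ∨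
        ((Equiv.Perm.sign τ : ℤ) : k) *
          pairTensor (blockMat k (i + 2)) (lastVec k (i + 2)) (i + 2) τ = 1 := by
      intro τ hτ0 hτ1
      set p := τ 0
      set q := τ 1
      -- the exchange of the block `{p, q}` with the first block is even
      set ρ : Equiv.Perm (Fin (i + 2)) := Equiv.swap p 0 * Equiv.swap q 1
      have hρs : Equiv.Perm.sign ρ = 1 := by
        by_cases hp : p = 0
        · have hq : q = 1 := by
            apply Fin.ext
            rw [hτ1, hp]
            simp
          simp [ρ, hp, hq]
        · have hq : q ≠ 1 := by
            intro hq
            apply hp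
            apply Fin.ext
            rw [hq] at hτ1
            simp at hτ1
            simp [← hτ1]
          simp [ρ, Equiv.Perm.sign_swap hp, Equiv.Perm.sign_swap hq]
      have hone : ((1 : Fin (i + 2)) : ℕ) = 1 := rfl
      have hρv : ∀ x, ((ρ x : Fin (i + 2)) : ℕ) = if (x : ℕ) = 0 then (p : ℕ) else
          if (x : ℕ) = 1 then (q : ℕ) else if (x : ℕ) = p then 0 else if (x : ℕ) = q then 1
          else (x : ℕ) := fun x => by
        simp only [ρ, Equiv.Perm.mul_apply, Equiv.swap_apply_def, Fin.ext_iff, apply_ite Fin.val,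
          Fin.val_zero, hone]
        split_ifs <;> first | omega | contradiction
      have hK : (blockMat k (i + 2)).submatrix ρ ρ = blockMat k (i + 2) := by
        have hP : ∀ a b, ((ρ a : ℕ) % 2 = 0 ∧ (ρ b : ℕ) = ρ a + 1) ↔
            ((a : ℕ) % 2 = 0 ∧ (b : ℕ) = a + 1) := fun a b => by
          have ha := hρv a
          have hb := hρv b
          split_ifs at ha hb <;> omega
        ext a b
        exact if_congr (hP a b) rfl (if_congr (hP b a) rfl rfl)
      have hv : lastVec k (i + 2) ∘ ρ = lastVec k (i + 2) := by
        funext a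
        refine if_congr ?_ rfl rfl
        have ha := hρv a
        have := a.2
        have := q.2
        split_ifs at ha <;> omega
      have h1 := pairTensor_submatrix (blockMat k (i + 2)) (lastVec k (i + 2)) ρ (i + 2) τ
      rw [hK, hv] at h1
      obtain ⟨σ, hσ, hσv⟩ := exists_perm_succ_succ (ρ * τ)
        (Fin.ext (by rw [Equiv.Perm.mul_apply, hρv, Fin.val_zero]; split_ifs <;> omega))
        (Fin.ext (by rw [Equiv.Perm.mul_apply, hρv, hone]; split_ifs <;> omega))
      have h2 := pairTensor_submatrix (blockMat k (i + 2)) (lastVec k (i + 2))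
        (fun a => a.succ.succ) i σ
      rw [blockMat_submatrix_succ, lastVec_comp_succ] at h2
      have h3 : pairTensor (blockMat k (i + 2)) (lastVec k (i + 2)) (i + 2) τ =
          pairTensor (blockMat k i) (lastVec k i) i σ := by
        rw [h1, h2, pairTensor_add_two]
        have h4 : (ρ ∘ τ) 0 = 0 :=
          Fin.ext (by rw [Function.comp_apply, hρv, Fin.val_zero]; split_ifs <;> omega)
        have h5 : (ρ ∘ τ) 1 = 1 :=
          Fin.ext (by rw [Function.comp_apply, hρv, hone]; split_ifs <;> omega)
        have h6 : (fun j : Fin i => (ρ ∘ τ) j.succ.succ) = (fun a => a.succ.succ) ∘ σ :=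
          funext hσv
        rw [h4, h5, h6]
        simp [blockMat]
      rw [Equiv.Perm.sign_mul, hρs, one_mul] at hσ
      rw [h3, hσ]
      exact sign_mul_pairTensor i σ
    by_cases hτ : blockMat k (i + 2) (τ 0) (τ 1) = 0
    · left
      rw [pairTensor_add_two, hτ, zero_mul]
    · by_cases h1 : ((τ 0 : Fin (i + 2)) : ℕ) % 2 = 0 ∧ ((τ 1 : Fin (i + 2)) : ℕ) = τ 0 + 1
      · exact main τ h1.1 h1.2
      · have h2 : ((τ 1 : Fin (i + 2)) : ℕ) % 2 = 0 ∧ ((τ 0 : Fin (i + 2)) : ℕ) = τ 1 + 1 := by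
          by_contra h2
          exact hτ ((if_neg h1).trans (if_neg h2))
        have h01 : (0 : Fin (i + 2)) ≠ 1 := Fin.zero_ne_one
        have h3 := main (τ * Equiv.swap 0 1) (by simpa using h2.1) (by simpa using h2.2)
        have h4 : pairTensor (blockMat k (i + 2)) (lastVec k (i + 2)) (i + 2)
            (τ * Equiv.swap 0 1 : Equiv.Perm (Fin (i + 2))) =
            - pairTensor (blockMat k (i + 2)) (lastVec k (i + 2)) (i + 2) τ := by
          rw [pairTensor_add_two, pairTensor_add_two, ← neg_mul]
          congr 1
          rw [Equiv.Perm.mul_apply, Equiv.Perm.mul_apply, Equiv.swap_apply_left,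
            Equiv.swap_apply_right]
          simp only [blockMat, Matrix.of_apply]
          rw [if_pos h2, if_neg h1, if_pos h2, neg_neg]
        rw [h4, Equiv.Perm.sign_mul, Equiv.Perm.sign_swap h01] at h3
        refine h3.imp neg_eq_zero.1 fun h => ?_
        rw [← h]
        push_cast
        ring

/-- The alternating sum of `K ⊗ K ⊗ ⋯` does not vanish on the wedge of a family of vectors that
`K` pairs in blocks. -/
theorem altSum_pairTensor_ne_zero [CharZero k] {i : ℕ} (K : Matrix (Fin N) (Fin N) k)
    (v : Fin N → k) (f : Fin i → Fin N) (hK : K.submatrix f f = blockMat k i)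
    (hv : i % 2 = 1 → v ∘ f = lastVec k i) : altSum (pairTensor K v i) f ≠ 0 := by
  have h1 : ∀ τ : Equiv.Perm (Fin i), pairTensor K v i (f ∘ τ) =
      pairTensor (blockMat k i) (lastVec k i) i τ := fun τ => by
    rw [← pairTensor_submatrix, hK]
    by_cases hi : i % 2 = 1
    · rw [hv hi]
    · obtain ⟨n, rfl⟩ : ∃ n, i = 2 * n := ⟨i / 2, by omega⟩
      exact pairTensor_even _ _ _ n _
  classical
  have h2 : ∀ τ : Equiv.Perm (Fin i), ((Equiv.Perm.sign τ : ℤ) : k) * pairTensor K v i (f ∘ τ) =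
      if pairTensor (blockMat k i) (lastVec k i) i τ = 0 then 0 else 1 := fun τ => by
    rw [h1]
    split_ifs with h
    · rw [h, mul_zero]
    · exact (sign_mul_pairTensor i τ).resolve_left h
  simp only [← ite_not (_ = (0 : k))] at h2
  rw [altSum, Finset.sum_congr rfl fun τ _ => h2 τ, ← Finset.sum_filter, Finset.sum_const,
    nsmul_eq_mul, mul_one, Nat.cast_ne_zero, Finset.card_ne_zero]
  refine ⟨1, Finset.mem_filter.2 ⟨Finset.mem_univ _, ?_⟩⟩
  rw [Equiv.Perm.coe_one, pairTensor_blockMat_id]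
  exact one_ne_zero

end Signs

/-! ### Nonvanishing matrix coefficients -/

section Nonvanishing

variable {X : CType} {l : ℕ} {k : Type*} [Field k] {i : ℕ}

theorem mem_prim_of_isSkew [CharZero k] (hX : X ≠ .C) {y : Tup k (dim X l) i} (hy : IsSkew y) :
    y ∈ prim X l k i := by
  refine ⟨hy, fun f a b hab => ?_⟩
  have hsymm : ∀ x z, form k X l x z = form k X l z x := fun x z => by
    have h2 : z = x.rev ↔ x = z.rev :=
      ⟨fun h => by rw [h, Fin.rev_rev], fun h => by rw [h, Fin.rev_rev]⟩
    rw [form_apply, form_apply, if_congr h2 rfl rfl]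
    cases X
    · rfl
    · rfl
    · exact absurd rfl hX
  have h1 : ∑ x, ∑ z, form k X l x z * y (Function.update (Function.update f a x) b z) =
      - ∑ x, ∑ z, form k X l x z * y (Function.update (Function.update f a x) b z) := by
    conv_lhs => rw [Finset.sum_comm]
    rw [← Finset.sum_neg_distrib]
    refine Finset.sum_congr rfl fun x _ => ?_
    rw [← Finset.sum_neg_distrib]
    refine Finset.sum_congr rfl fun z _ => ?_
    rw [hsymm, hy.swap hab, mul_neg]
  exact self_eq_neg.1 h1

theorem coef_wedge_ne_zero [CharZero k] {f : Fin i → Fin (dim X l)} (g : Gp X l k)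
    (hK : (mat g * pairMat X l k * (mat g)ᵀ).submatrix f f = blockMat k i)
    (hv : i % 2 = 1 → (mat g *ᵥ e X l k (fixedIdx X l)) ∘ f = lastVec k i) :
    coef X l i (wedge k f) ≠ 0 := fun h => by
  have h1 := congrFun (congrArg Subtype.val h) g
  rw [coef_apply, invTensor, tact_pairTensor, wedge_dotProduct] at h1
  exact altSum_pairTensor_ne_zero _ _ _ hK hv h1

theorem exists_coef_ne_zero_typeA [CharZero k] (hi : i ≤ l) :
    ∃ y ∈ prim .A l k i, coef .A l i y ≠ 0 := by
  let f : Fin i → Fin (dim .A l) := fun a =>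
    if (a : ℕ) % 2 = 0 ∧ (a : ℕ) + 1 = i then ⟨l, Nat.lt_succ_self l⟩
    else ⟨a, Nat.lt_succ_of_le (a.2.le.trans hi)⟩
  have hf : ∀ a, (f a : ℕ) = if (a : ℕ) % 2 = 0 ∧ (a : ℕ) + 1 = i then l else a := fun a => by
    simp only [f]
    split_ifs <;> rfl
  refine ⟨wedge k f, mem_prim_of_isSkew (by simp) (wedge_skew f),
    coef_wedge_ne_zero 1 ?_ fun hodd => ?_⟩
  · rw [mat_one, one_mul, Matrix.transpose_one, mul_one]
    ext a b
    rw [Matrix.submatrix_apply, pairMat, Matrix.of_apply, if_congr (eq_pairing_typeA _ _) rfl rfl]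
    simp only [pairCoef, blockMat, Matrix.of_apply]
    have ha := hf a
    have hb := hf b
    have := a.2
    have := b.2
    generalize (f a : ℕ) = x at *
    generalize (f b : ℕ) = z at *
    split_ifs at * <;> first | rfl | (exfalso; omega)
  · rw [mat_one, Matrix.one_mulVec]
    funext a
    refine if_congr ?_ rfl rfl
    have ha := hf a
    have := a.2
    simp only [fixedIdx]
    split_ifs at ha <;> omega

theorem exists_coef_ne_zero_typeB [CharZero k] (hi : i ≤ l) :
    ∃ y ∈ prim .B l k i, coef .B l i y ≠ 0 := by
  let f : Fin i → Fin (dim .B l) := fun a =>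
    ⟨if (a : ℕ) % 2 = 0 then (if (a : ℕ) + 1 = i then l else a / 2) else 2 * l - a / 2, by
      have := a.2
      simp only [dim]
      split_ifs <;> omega⟩
  have hf : ∀ a, (f a : ℕ) = if (a : ℕ) % 2 = 0 then (if (a : ℕ) + 1 = i then l else (a : ℕ) / 2)
    else 2 * l - (a : ℕ) / 2 := fun a => rfl
  refine ⟨wedge k f, mem_prim_of_isSkew (by simp) (wedge_skew f),
    coef_wedge_ne_zero 1 ?_ fun hodd => ?_⟩
  · rw [mat_one, one_mul, Matrix.transpose_one, mul_one]
    ext a b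
    have hr : f b = pairing .B l (f a) ↔ (f b : ℕ) = 2 * l - f a := by
      rw [Fin.ext_iff]
      change (f b : ℕ) = (f a).rev ↔ _
      rw [Fin.val_rev]
      simp only [dim]
      omega
    rw [Matrix.submatrix_apply, pairMat, Matrix.of_apply, if_congr hr rfl rfl]
    simp only [pairCoef, blockMat, Matrix.of_apply]
    have ha := hf a
    have hb := hf b
    have := a.2
    have := b.2
    generalize (f a : ℕ) = x at *
    generalize (f b : ℕ) = z at *
    split_ifs at * <;> first | rfl | (exfalso; omega)
  · rw [mat_one, Matrix.one_mulVec]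
    funext a
    refine if_congr ?_ rfl rfl
    have ha := hf a
    have := a.2
    simp only [fixedIdx]
    split_ifs at ha <;> omega

/-- The nilpotent matrix of type `C` with `e_x ↦ e_{x-ℓ+ε}` for `ℓ ≤ x < 2 ℓ - ε`, and
`e_x ↦ 0` for the other `x`. -/
def mixMat (l ε : ℕ) : Matrix (Fin (dim .C l)) (Fin (dim .C l)) k :=
  Matrix.of fun a x => if l ≤ (x : ℕ) ∧ (a : ℕ) < l ∧ (a : ℕ) + l = x + ε then 1 else 0

theorem mixMat_sq (l ε : ℕ) : mixMat (k := k) l ε * mixMat l ε = 0 := by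
  ext a x
  rw [Matrix.mul_apply, Matrix.zero_apply]
  refine Finset.sum_eq_zero fun z _ => ?_
  simp only [mixMat, Matrix.of_apply]
  split_ifs <;> first | (exfalso; omega) | simp

theorem mixMat_isRootLike (l ε : ℕ) : IsRootLike .C l (mixMat (k := k) l ε) := by
  refine ⟨by rw [mixMat_sq, mul_zero], ?_⟩
  ext x y
  rw [Matrix.neg_apply, Matrix.mul_apply, Matrix.mul_apply, Finset.sum_eq_single y.rev,
    Finset.sum_eq_single x.rev]
  · simp only [form_apply, Fin.rev_rev, if_true, Matrix.transpose_apply, mixMat, Matrix.of_apply,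
      formSign, Fin.val_rev, dim]
    have hx := x.2
    have hy := y.2
    simp only [dim] at hx hy
    split_ifs <;> first | (exfalso; omega) | simp
  · intro r _ hr
    rw [form_apply, if_neg hr, zero_mul]
  · simp
  · intro r _ hr
    rw [form_apply, if_neg (fun h => hr (by rw [h, Fin.rev_rev])), mul_zero]
  · simp

/-- The upper left block of the transform of `K` by the exponential of `mixMat`. -/
theorem uexp_mixMat_pairMat [CharZero k] (l ε : ℕ) (a b : Fin (dim .C l)) (ha : (a : ℕ) < l)
    (hb : (b : ℕ) < l) :
    (uexp (mixMat (k := k) l ε) 1 * pairMat .C l k * (uexp (mixMat (k := k) l ε) 1)ᵀ) a b =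
      if (a : ℕ) + b + 1 = l + ε then
        (if (a : ℕ) < (l + 1) / 2 then 1 else 0) - (if (b : ℕ) < (l + 1) / 2 then 1 else 0)
      else 0 := by
  have hrev : ∀ x : Fin (dim .C l), (x.rev : ℕ) = 2 * l - 1 - x := fun x => by
    rw [Fin.val_rev]
    simp only [dim]
    omega
  have hK : ∀ x y : Fin (dim .C l), pairMat .C l k x y =
      if y = x.rev then pairCoef k .C l x else 0 := fun x y => rfl
  have h1 : (mixMat (k := k) l ε * pairMat .C l k) a b =
      mixMat l ε a b.rev * pairCoef k .C l b.rev := by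
    rw [Matrix.mul_apply, Finset.sum_eq_single b.rev]
    · rw [hK, Fin.rev_rev, if_pos rfl]
    · intro x _ hx
      rw [hK, if_neg (fun h => hx (by rw [h, Fin.rev_rev])), mul_zero]
    · simp
  have h2 : (pairMat .C l k * (mixMat (k := k) l ε)ᵀ) a b =
      pairCoef k .C l a * mixMat l ε b a.rev := by
    rw [Matrix.mul_apply, Finset.sum_eq_single a.rev]
    · rw [hK, if_pos rfl, Matrix.transpose_apply]
    · intro x _ hx
      rw [hK, if_neg hx, zero_mul]
    · simp
  have h3 : (mixMat (k := k) l ε * pairMat .C l k * (mixMat (k := k) l ε)ᵀ) a b = 0 := by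
    rw [Matrix.mul_apply]
    refine Finset.sum_eq_zero fun y _ => ?_
    rw [Matrix.mul_apply, Finset.sum_mul]
    refine Finset.sum_eq_zero fun x _ => ?_
    rw [hK, Matrix.transpose_apply]
    have := hrev x
    simp only [mixMat, Matrix.of_apply, Fin.ext_iff]
    split_ifs <;> first | (exfalso; omega) | simp
  have h4 : uexp (mixMat (k := k) l ε) 1 * pairMat .C l k * (uexp (mixMat (k := k) l ε) 1)ᵀ =
      pairMat .C l k + mixMat l ε * pairMat .C l k + pairMat .C l k * (mixMat l ε)ᵀ +
        mixMat l ε * pairMat .C l k * (mixMat l ε)ᵀ := by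
    rw [uexp, mixMat_sq, smul_zero, add_zero, one_smul, Matrix.transpose_add, Matrix.transpose_one,
      add_mul, mul_add, one_mul, mul_one, add_mul]
    abel
  rw [h4, Matrix.add_apply, Matrix.add_apply, Matrix.add_apply, h1, h2, h3, hK]
  have hra := hrev a
  have hrb := hrev b
  have h5 : mixMat (k := k) l ε a b.rev = if (a : ℕ) + b + 1 = l + ε then 1 else 0 :=
    if_congr (by omega) rfl rfl
  have h6 : mixMat (k := k) l ε b a.rev = if (a : ℕ) + b + 1 = l + ε then 1 else 0 :=
    if_congr (by omega) rfl rfl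
  have h7 : pairCoef k .C l a = if (a : ℕ) < (l + 1) / 2 then 1 else 0 :=
    if_congr Iff.rfl rfl (if_neg (by omega))
  have h8 : pairCoef k .C l b.rev = - if (b : ℕ) < (l + 1) / 2 then 1 else 0 := by
    simp only [pairCoef]
    split_ifs <;> first | (exfalso; omega) | simp
  rw [h5, h6, h7, h8, if_neg (fun h => by rw [Fin.ext_iff] at h; omega)]
  by_cases hab : (a : ℕ) + b + 1 = l + ε
  · simp only [if_pos hab]
    ring
  · simp only [if_neg hab]
    ring

theorem exists_coef_ne_zero_typeC [CharZero k] (hi : i ≤ l) :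
    ∃ y ∈ prim .C l k i, coef .C l i y ≠ 0 := by
  let f : Fin i → Fin (dim .C l) := fun a =>
    ⟨if (a : ℕ) % 2 = 0 then (if (a : ℕ) + 1 = i then 0 else a / 2 + i % 2) else l - 1 - a / 2, by
      have := a.2
      simp only [dim]
      split_ifs <;> omega⟩
  have hf : ∀ a, (f a : ℕ) = if (a : ℕ) % 2 = 0 then (if (a : ℕ) + 1 = i then 0
    else (a : ℕ) / 2 + i % 2) else l - 1 - (a : ℕ) / 2 := fun a => rfl
  have hfl : ∀ a, (f a : ℕ) < l := fun a => by
    have := a.2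
    rw [hf]
    split_ifs <;> omega
  refine ⟨wedge k f, wedge_mem_prim hfl, coef_wedge_ne_zero
    (expEl (mixMat_isRootLike l (i % 2)) 1) ?_ fun hodd => ?_⟩
  · ext a b
    rw [mat_expEl, Matrix.submatrix_apply, uexp_mixMat_pairMat _ _ _ _ (hfl a) (hfl b)]
    simp only [blockMat, Matrix.of_apply]
    have ha := hf a
    have hb := hf b
    have := a.2
    have := b.2
    generalize (f a : ℕ) = x at *
    generalize (f b : ℕ) = z at *
    split_ifs at * <;> first | (exfalso; omega) | simp
  · funext a
    have h0 : 0 < dim .C l := (Nat.zero_le _).trans_lt (f a).2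
    have h1 : e .C l k (fixedIdx .C l) = e .C l k ((⟨0, h0⟩ : Fin (dim .C l)) : ℕ) := rfl
    rw [h1, Function.comp_apply, mulVec_e, mat_expEl, uexp, mixMat_sq, smul_zero, add_zero,
      one_smul, Matrix.add_apply, Matrix.one_apply]
    simp only [mixMat, Matrix.of_apply, lastVec, Fin.ext_iff]
    have ha := hf a
    have := a.2
    have := hfl a
    generalize (f a : ℕ) = x at *
    split_ifs at * <;> first | (exfalso; omega) | simp

theorem exists_coef_ne_zero [CharZero k] (hi : i ≤ l) :
    ∃ y ∈ prim X l k i, coef X l i y ≠ 0 := by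
  cases X
  · exact exists_coef_ne_zero_typeA hi
  · exact exists_coef_ne_zero_typeB hi
  · exact exists_coef_ne_zero_typeC hi

end Nonvanishing

/-! ### Exchange of pairs -/

section Exchange

variable {α : Type*} [DecidableEq α] {σ : α → α} {v : α}

/-- A set closed under an involution, except possibly at a point `v`, has odd cardinality if and
only if it contains `v` without a partner. -/
theorem odd_card_iff_of_involutive (hσ : Function.Involutive σ) (hfix : ∀ x, σ x = x → x = v)
    {R : Finset α} (hR : ∀ x ∈ R, x ≠ v → σ x ∈ R) :
    Odd R.card ↔ v ∈ R ∧ (σ v ∉ R ∨ σ v = v) := by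
  have heven : ∀ T : Finset α, (∀ x ∈ T, σ x ∈ T ∧ σ x ≠ x) → Even T.card := fun T hT => by
    have h1 : ∑ _x ∈ T, (1 : ZMod 2) = 0 :=
      Finset.sum_involution (fun x _ => σ x) (fun _ _ => by decide) (fun x hx _ => (hT x hx).2)
        (fun x hx => (hT x hx).1) fun x _ => hσ x
    rw [Finset.sum_const, nsmul_eq_mul, mul_one] at h1
    exact (ZMod.natCast_eq_zero_iff_even).1 h1
  by_cases hv : v ∈ R
  · by_cases hσv : σ v ∈ R ∧ σ v ≠ v
    · have h1 := heven R fun x hx => by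
        by_cases hxv : x = v
        · rw [hxv]
          exact hσv
        · exact ⟨hR x hx hxv, fun h => hxv (hfix x h)⟩
      rw [← Nat.not_even_iff_odd]
      simp only [h1, not_true, false_iff]
      rintro ⟨-, h | h⟩
      · exact h hσv.1
      · exact hσv.2 h
    · have h1 := heven (R.erase v) fun x hx => by
        obtain ⟨hxv, hxR⟩ := Finset.mem_erase.1 hx
        refine ⟨Finset.mem_erase.2 ⟨fun h => ?_, hR x hxR hxv⟩, fun h => hxv (hfix x h)⟩
        have h2 : σ v = x := by rw [← h, hσ]
        exact hσv ⟨h2 ▸ hxR, h2 ▸ hxv⟩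
      rw [Finset.card_erase_of_mem hv] at h1
      have h2 : 1 ≤ R.card := Finset.card_pos.2 ⟨v, hv⟩
      have h3 : Odd R.card := by
        have := h1.add_one
        rwa [Nat.sub_add_cancel h2] at this
      simp only [h3, hv, true_and, true_iff]
      by_contra! h
      exact hσv h
  · have h1 := heven R fun x hx => by
      have hxv : x ≠ v := fun h => hv (h ▸ hx)
      exact ⟨hR x hx hxv, fun h => hxv (hfix x h)⟩
    rw [← Nat.not_even_iff_odd]
    simp [h1, hv]

/-- Two sets of the same size that consist of pairs, and possibly of `v`, differ by pairs: by the
parity of the sizes, `v` occurs without a partner in both sets or in none. -/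
theorem pair_mem_sdiff (hσ : Function.Involutive σ) (hfix : ∀ x, σ x = x → x = v)
    {R I : Finset α} (hR : ∀ x ∈ R, x ≠ v → σ x ∈ R) (hI : ∀ x ∈ I, x ≠ v → σ x ∈ I)
    (hcard : R.card = I.card) {z : α} (hz : z ∈ R) (hzI : z ∉ I) :
    σ z ∈ R ∧ σ z ∉ I ∧ σ z ≠ z := by
  have hpar := (odd_card_iff_of_involutive hσ hfix hR).symm.trans
    (hcard ▸ odd_card_iff_of_involutive hσ hfix hI)
  have hback : ∀ {T : Finset α}, (∀ x ∈ T, x ≠ v → σ x ∈ T) → ∀ x, σ x ∈ T → σ x ≠ v → x ∈ T :=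
    fun hT x hx hxv => by
      have := hT _ hx hxv
      rwa [hσ] at this
  by_cases hzv : z = v
  · subst hzv
    have h1 : ¬ (z ∈ R ∧ (σ z ∉ R ∨ σ z = z)) := fun h => hzI (hpar.1 h).1
    have h2 : σ z ∈ R ∧ σ z ≠ z := by
      by_contra h
      exact h1 ⟨hz, by tauto⟩
    exact ⟨h2.1, fun h => hzI (hback hI z h h2.2), h2.2⟩
  · have h1 : σ z ≠ z := fun h => hzv (hfix z h)
    refine ⟨hR z hz hzv, fun h => ?_, h1⟩
    by_cases h2 : σ z = v
    · have h3 : σ v = z := by rw [← h2, hσ]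
      rw [h2] at h
      rcases (hpar.2 ⟨h, Or.inl (h3 ▸ hzI)⟩).2 with h4 | h4
      · exact h4 (h3 ▸ hz)
      · exact hzv (h3.symm.trans h4)
    · exact hzI (hback hI z h h2)

/-- The replacement of the pair `{q, σ q}` in a set by the pair `{p, σ p}`. -/
def IsMove (σ : α → α) (R R' : Finset α) (q p : α) : Prop :=
  ∀ x, x ∈ R' ↔ (x ∈ R ∧ x ≠ q ∧ x ≠ σ q) ∨ x = p ∨ x = σ p

/-- If a family of sets of the same size, consisting of pairs and possibly of `v`, allows the
replacement of pairs by pairs, it contains every such set. -/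
theorem mem_of_exchange [Fintype α] (hσ : Function.Involutive σ) (hfix : ∀ x, σ x = x → x = v)
    {S : Set (Finset α)} {n : ℕ} (hcard : ∀ R ∈ S, R.card = n)
    (hS : ∀ R ∈ S, ∀ x ∈ R, x ≠ v → σ x ∈ R) {W : Finset α} (hW : ∀ x ∈ W, σ x ∈ W)
    (hmove : ∀ R ∈ S, ∀ q ∈ R, σ q ∈ R → σ q ≠ q → ∀ p, p ∉ R → σ p ∉ R → σ p ≠ p → p ∈ W →
      q ∈ W → ∃ R' ∈ S, IsMove σ R R' q p)
    (hmove' : ∀ R ∈ S, ∀ q ∈ R, q ∉ W → ∃ p ∈ W, p ∉ R ∧ ∃ R' ∈ S, IsMove σ R R' q p)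
    {I : Finset α} (hIn : I.card = n) (hI : ∀ x ∈ I, x ≠ v → σ x ∈ I) (hIW : I ⊆ W)
    (hne : S.Nonempty) : I ∈ S := by
  -- a member with as much as possible in `W` and in common with `I` is equal to `I`
  obtain ⟨R, hR, hmax⟩ := Set.exists_max_image S
    (fun R => (R ∩ W).card + (R ∩ I).card) (Set.toFinite S) hne
  have hRW : R ⊆ W := fun q hq => by
    by_contra hqW
    obtain ⟨p, hpW, hpR, R', hR', hm⟩ := hmove' R hR q hq hqW
    have hσq : σ q ∉ W := fun h => hqW (by have := hW _ h; rwa [hσ] at this)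
    have h1 : R ∩ W ⊂ R' ∩ W := by
      refine Finset.ssubset_iff_of_subset ?_ |>.2 ⟨p, Finset.mem_inter.2
        ⟨(hm p).2 (Or.inr (Or.inl rfl)), hpW⟩, fun h => hpR (Finset.mem_inter.1 h).1⟩
      intro x hx
      obtain ⟨hxR, hxW⟩ := Finset.mem_inter.1 hx
      exact Finset.mem_inter.2 ⟨(hm x).2 (Or.inl ⟨hxR, fun h => hqW (h ▸ hxW),
        fun h => hσq (h ▸ hxW)⟩), hxW⟩
    have h2 : R ∩ I ⊆ R' ∩ I := by
      intro x hx
      obtain ⟨hxR, hxI⟩ := Finset.mem_inter.1 hx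
      exact Finset.mem_inter.2 ⟨(hm x).2 (Or.inl ⟨hxR, fun h => hqW (h ▸ hIW hxI),
        fun h => hσq (h ▸ hIW hxI)⟩), hxI⟩
    have h3 := hmax R' hR'
    have h4 := Finset.card_lt_card h1
    have h5 := Finset.card_le_card h2
    omega
  by_contra hIS
  have hRI : R.card = I.card := (hcard R hR).trans hIn.symm
  have hne' : R ≠ I := fun h => hIS (h ▸ hR)
  obtain ⟨z, hz, hzI⟩ : ∃ z ∈ R, z ∉ I := Finset.not_subset.1 fun h =>
    hne' (Finset.eq_of_subset_of_card_le h hRI.ge)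
  obtain ⟨w, hw, hwR⟩ : ∃ w ∈ I, w ∉ R := Finset.not_subset.1 fun h =>
    hne' (Finset.eq_of_subset_of_card_le h hRI.le).symm
  obtain ⟨hz1, hz2, hz3⟩ := pair_mem_sdiff hσ hfix (hS R hR) hI hRI hz hzI
  obtain ⟨hw1, hw2, hw3⟩ := pair_mem_sdiff hσ hfix hI (hS R hR) hRI.symm hw hwR
  obtain ⟨R', hR', hm⟩ := hmove R hR z hz hz1 hz3 w hwR hw2 hw3 (hIW hw) (hRW hz)
  have hR'W : R' ⊆ W := fun x hx => by
    rcases (hm x).1 hx with h | h | h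
    · exact hRW h.1
    · exact h ▸ hIW hw
    · exact h ▸ hIW hw1
  have h1 : R ∩ I ⊂ R' ∩ I := by
    refine Finset.ssubset_iff_of_subset ?_ |>.2 ⟨w, Finset.mem_inter.2
      ⟨(hm w).2 (Or.inr (Or.inl rfl)), hw⟩, fun h => hwR (Finset.mem_inter.1 h).1⟩
    intro x hx
    obtain ⟨hxR, hxI⟩ := Finset.mem_inter.1 hx
    exact Finset.mem_inter.2 ⟨(hm x).2 (Or.inl ⟨hxR, fun h => hzI (h ▸ hxI),
      fun h => hz2 (h ▸ hxI)⟩), hxI⟩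
  have h2 := hmax R' hR'
  have h3 := Finset.card_lt_card h1
  simp only [Finset.inter_eq_left.2 hRW, Finset.inter_eq_left.2 hR'W, hcard R hR,
    hcard R' hR'] at h2
  omega

end Exchange

/-! ### Invariant primitive tensors -/

section Invariants

variable {X : CType} {l : ℕ} {k : Type*} [Field k] {i : ℕ}

theorem val_pairing_typeA (p : Fin (dim .A l)) : ((pairing .A l p : Fin (dim .A l)) : ℕ) =
    if (p : ℕ) % 2 = 0 then (if (p : ℕ) + 1 < l + 1 then (p : ℕ) + 1 else p)
      else (p : ℕ) - 1 :=
  (eq_pairing_typeA _ _).1 rfl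

theorem pairing_involutive : Function.Involutive (pairing X l) := fun p => by
  cases X
  · have h1 := val_pairing_typeA p
    have h2 := val_pairing_typeA (pairing .A l p)
    have h3 := p.2
    simp only [dim] at h3
    apply Fin.ext
    split_ifs at h1 h2 <;> omega
  · exact Fin.rev_rev p
  · exact Fin.rev_rev p

theorem pairing_eq_rev (hX : X ≠ .A) (p : Fin (dim X l)) : pairing X l p = p.rev := by
  cases X
  · exact absurd rfl hX
  all_goals rfl

theorem eq_fixedIdx_of_pairing_eq {p : Fin (dim X l)} (h : pairing X l p = p) :
    (p : ℕ) = fixedIdx X l ∧ X ≠ .C := by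
  have h3 := p.2
  cases X
  · have h1 := val_pairing_typeA p
    rw [h] at h1
    simp only [dim] at h3
    refine ⟨?_, by simp⟩
    simp only [fixedIdx]
    split_ifs at h1 <;> omega
  all_goals
    rw [Fin.ext_iff, pairing_eq_rev (by simp), Fin.val_rev] at h
    simp only [dim] at h h3
    simp only [fixedIdx, ne_eq, reduceCtorEq, not_false_eq_true, not_true, and_true, and_false]
    omega

theorem pairCoef_pairing (p : Fin (dim X l)) :
    pairCoef k X l (pairing X l p) = - pairCoef k X l p := by
  have h3 := p.2
  cases X
  · have h1 := val_pairing_typeA p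
    simp only [dim] at h3
    simp only [pairCoef]
    generalize ((pairing .A l p : Fin (dim .A l)) : ℕ) = x at *
    split_ifs at * <;> first | (exfalso; omega) | simp
  all_goals
    rw [pairing_eq_rev (by simp)]
    simp only [pairCoef, Fin.val_rev]
    simp only [dim] at *
    split_ifs <;> first | (exfalso; omega) | simp

theorem pairMat_apply (x y : Fin (dim X l)) :
    pairMat X l k x y = if y = pairing X l x then pairCoef k X l x else 0 := rfl

/-- The infinitesimal condition for a root vector to belong to the Lie algebra of `H`. -/
theorem derAct_eq_zero_of_invariant [CharZero k] {A : Matrix (Fin (dim X l)) (Fin (dim X l)) k}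
    (hA : IsRootLike X l A) (hAv : A *ᵥ e X l k (fixedIdx X l) = 0)
    (hAK : A * pairMat X l k + pairMat X l k * Aᵀ = 0) {y : Tup k (dim X l) i}
    (hy : ∀ h ∈ modelSubgroup k X l, tact (mat h) y = y) : derAct A y = 0 := by
  refine derAct_eq_zero A y fun t => hy (expEl hA t) ((mem_modelSubgroup_iff _).2 ⟨?_, ?_⟩)
  · rw [mat_expEl, uexp, Matrix.add_mulVec, Matrix.add_mulVec, Matrix.smul_mulVec,
      Matrix.smul_mulVec, ← Matrix.mulVec_mulVec, hAv, Matrix.mulVec_zero, smul_zero, smul_zero,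
      add_zero, add_zero, Matrix.one_mulVec]
  · rw [mat_expEl]
    have h1 : A * pairMat X l k = - (pairMat X l k * Aᵀ) := eq_neg_of_add_eq_zero_left hAK
    have h2 : A * A * pairMat X l k = pairMat X l k * (A * A)ᵀ := by
      rw [Matrix.mul_assoc, h1, mul_neg, ← Matrix.mul_assoc, h1, neg_mul, neg_neg,
        Matrix.transpose_mul, Matrix.mul_assoc]
    have h3 : uexp A t * pairMat X l k = pairMat X l k * (uexp A (-t))ᵀ := by
      simp only [uexp, Matrix.transpose_add, Matrix.transpose_smul, add_mul, mul_add,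
        Matrix.transpose_one, one_mul, mul_one, smul_mul_assoc, mul_smul_comm, h1, h2]
      module
    have h4 := uexp_mul_neg hA.cube (-t)
    rw [neg_neg] at h4
    rw [h3, Matrix.mul_assoc, ← Matrix.transpose_mul, h4, Matrix.transpose_one, mul_one]

theorem single_mul_pairMat (a b : Fin (dim X l)) (c : k) (x y : Fin (dim X l)) :
    (Matrix.single a b c * pairMat X l k + pairMat X l k * (Matrix.single a b c)ᵀ) x y =
      c * pairCoef k X l b * ((if x = a ∧ y = pairing X l b then 1 else 0) -
        if y = a ∧ x = pairing X l b then 1 else 0) := by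
  have h1 : (Matrix.single a b c * pairMat X l k) x y =
      if x = a ∧ y = pairing X l b then c * pairCoef k X l b else 0 := by
    by_cases hx : x = a
    · subst hx
      rw [Matrix.single_mul_apply_same, pairMat_apply, mul_ite, mul_zero]
      exact if_congr (by simp) rfl rfl
    · rw [Matrix.single_mul_apply_of_ne _ _ _ _ _ hx, if_neg (fun h => hx h.1)]
  have h2 : (pairMat X l k * (Matrix.single a b c)ᵀ) x y =
      if y = a ∧ x = pairing X l b then - (c * pairCoef k X l b) else 0 := by
    rw [Matrix.transpose_single]
    by_cases hy : y = a
    · subst hy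
      rw [Matrix.mul_single_apply_same, pairMat_apply, ite_mul, zero_mul]
      have h3 : b = pairing X l x ↔ x = pairing X l b :=
        ⟨fun h => by rw [h, pairing_involutive], fun h => by rw [h, pairing_involutive]⟩
      rw [if_congr h3 rfl rfl]
      by_cases hx : x = pairing X l b
      · rw [if_pos hx, if_pos ⟨rfl, hx⟩, hx, pairCoef_pairing]
        ring
      · rw [if_neg hx, if_neg (fun h => hx h.2)]
    · rw [Matrix.mul_single_apply_of_ne _ _ _ _ _ hy, if_neg (fun h => hy h.1)]
  rw [Matrix.add_apply, h1, h2]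
  split_ifs <;> ring

end Invariants

section UniqueInvariant

variable {X : CType} {l : ℕ} {k : Type*} [Field k] {i : ℕ}

/-- The tuples on which an invariant tensor does not vanish contain the two members of a pair
together, by invariance under the torus of `H`. -/
theorem mem_range_of_invariant_of_ne [CharZero k] {y : Tup k (dim X l) i} (hsk : IsSkew y)
    (hy : ∀ h ∈ modelSubgroup k X l, tact (mat h) y = y) {g : Fin i → Fin (dim X l)}
    (hg : y g ≠ 0) {p : Fin (dim X l)} (hp : pairing X l p ≠ p) (hpv : (p : ℕ) ≠ fixedIdx X l)
    (hpv' : (pairing X l p : ℕ) ≠ fixedIdx X l) (hpg : p ∈ Set.range g) :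
    pairing X l p ∈ Set.range g := by
  have h2 : (2 : k) ≠ 0 := two_ne_zero
  have ht : IsToral X l p (pairing X l p) := ⟨hp.symm, fun hX => pairing_eq_rev hX p⟩
  have hH : torusEl ht h2 ∈ modelSubgroup k X l := by
    rw [mem_modelSubgroup_iff, mat_torusEl]
    constructor
    · funext x
      rw [Matrix.mulVec_diagonal, e]
      split_ifs with hx
      · have h3 : x ≠ p := fun h => hpv (h ▸ hx)
        have h4 : x ≠ pairing X l p := fun h => hpv' (h ▸ hx)
        simp [torusEntry, h3, h4]
      · rw [mul_zero]
    · ext x z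
      rw [Matrix.diagonal_transpose, Matrix.mul_diagonal, Matrix.diagonal_mul, pairMat_apply]
      split_ifs with hz
      · subst hz
        have h3 : pairing X l x = p ↔ x = pairing X l p :=
          ⟨fun h => by rw [← h, pairing_involutive], fun h => by rw [h, pairing_involutive]⟩
        have h4 : pairing X l x = pairing X l p ↔ x = p := pairing_involutive.injective.eq_iff
        simp only [torusEntry, h3, h4]
        by_cases h5 : x = p
        · subst h5
          simp only [if_true, if_neg hp.symm]
          field_simp
        · by_cases h6 : x = pairing X l p
          · simp only [if_pos h6, if_neg h5]
            field_simp
          · simp [h5, h6]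
      · rw [mul_zero, zero_mul]
  by_contra hc
  have h3 := congrFun (hy _ hH) g
  rw [mat_torusEl, tact_diagonal, prod_torusEntry (hsk.injective hg), if_pos hpg, if_neg hc,
    mul_one] at h3
  have h4 : y g = 0 := by linear_combination h3
  exact hg h4

theorem mulVec_e_eq_zero {A : Matrix (Fin (dim X l)) (Fin (dim X l)) k}
    (hA : ∀ x z : Fin (dim X l), (z : ℕ) = fixedIdx X l → A x z = 0) :
    A *ᵥ e X l k (fixedIdx X l) = 0 := by
  funext x
  rw [Matrix.mulVec, dotProduct, Pi.zero_apply]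
  refine Finset.sum_eq_zero fun z _ => ?_
  rw [e]
  split_ifs with hz
  · rw [hA x z hz, zero_mul]
  · rw [mul_zero]

/-- A tuple on which an invariant tensor does not vanish contains the fixed index if it contains
its partner. -/
theorem fixedIdx_mem_range_of_invariant [CharZero k] {y : Tup k (dim X l) i} (hsk : IsSkew y)
    (hy : ∀ h ∈ modelSubgroup k X l, tact (mat h) y = y) {g : Fin i → Fin (dim X l)}
    (hg : y g ≠ 0) {v : Fin (dim X l)} (hv : (v : ℕ) = fixedIdx X l)
    (hvg : pairing X l v ∈ Set.range g) : v ∈ Set.range g := by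
  by_contra hc
  have hne : pairing X l v ≠ v := fun h => hc (h ▸ hvg)
  have hrev : X ≠ .A → v.rev ≠ v := fun hX h => hne ((pairing_eq_rev hX v).trans h)
  obtain ⟨c, hc0, hAc⟩ : ∃ c : k, c ≠ 0 ∧
      rootMat (k := k) v (pairing X l v) = Matrix.single v (pairing X l v) c := by
    by_cases hX : X = .A
    · subst hX
      refine ⟨1, one_ne_zero, ?_⟩
      rw [rootMat_eq]
      simp [formSign]
    · have hC : X = .C := by
        cases X
        · exact absurd rfl hX
        · refine absurd ?_ hne
          apply Fin.ext
          rw [pairing_eq_rev hX, Fin.val_rev, hv]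
          simp only [fixedIdx, dim]
          omega
        · rfl
      subst hC
      refine ⟨2, two_ne_zero, ?_⟩
      rw [rootMat_eq, pairing_eq_rev hX, formSign_rev .C l k hX, Fin.rev_rev]
      ext x z
      simp only [formParity, Matrix.sub_apply, Matrix.single_apply]
      split_ifs <;> norm_num
  have hroot : IsRootLike X l (rootMat (k := k) v (pairing X l v)) :=
    rootMat_isRootLike hne.symm fun hX => ⟨hrev hX, by
      rw [pairing_eq_rev hX, Fin.rev_rev]
      exact (hrev hX).symm⟩
  rw [hAc] at hroot
  have h1 := derAct_eq_zero_of_invariant hroot (mulVec_e_eq_zero fun x z hz => by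
      have : z = v := Fin.ext (hz.trans hv.symm)
      simp [this, hne])
    (by
      ext x z
      rw [single_mul_pairMat, pairing_involutive]
      simp [and_comm]) hy
  obtain ⟨a, ha⟩ := hvg
  have h2 := congrFun h1 (Function.update g a v)
  rw [derAct_single_of_mem y (update_injective (hsk.injective hg) a hc) a
    (Function.update_self _ _ _), Function.update_idem, ← ha, Function.update_eq_self] at h2
  exact (mul_ne_zero hc0 hg) h2

theorem pairing_mem_range_of_invariant [CharZero k] {y : Tup k (dim X l) i} (hsk : IsSkew y)
    (hy : ∀ h ∈ modelSubgroup k X l, tact (mat h) y = y) {g : Fin i → Fin (dim X l)}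
    (hg : y g ≠ 0) {p : Fin (dim X l)} (hpg : p ∈ Set.range g) (hpv : (p : ℕ) ≠ fixedIdx X l) :
    pairing X l p ∈ Set.range g := by
  by_cases h1 : pairing X l p = p
  · rwa [h1]
  by_cases h2 : (pairing X l p : ℕ) = fixedIdx X l
  · exact fixedIdx_mem_range_of_invariant hsk hy hg h2 (by rwa [pairing_involutive])
  · exact mem_range_of_invariant_of_ne hsk hy hg h1 hpv h2 hpg

theorem mem_range_update_update_iff {N : ℕ} {g : Fin i → Fin N} (hg : Function.Injective g)
    {a b : Fin i} (hab : a ≠ b) {q q' : Fin N} (ha : g a = q) (hb : g b = q') (p p' x : Fin N) :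
    x ∈ Set.range (Function.update (Function.update g b p) a p') ↔
      (x ∈ Set.range g ∧ x ≠ q ∧ x ≠ q') ∨ x = p' ∨ x = p := by
  subst ha hb
  constructor
  · rintro ⟨c, rfl⟩
    by_cases hca : c = a
    · subst hca
      rw [Function.update_self]
      exact Or.inr (Or.inl rfl)
    · by_cases hcb : c = b
      · subst hcb
        rw [Function.update_of_ne hca, Function.update_self]
        exact Or.inr (Or.inr rfl)
      · rw [Function.update_of_ne hca, Function.update_of_ne hcb]
        exact Or.inl ⟨⟨c, rfl⟩, fun h => hca (hg h), fun h => hcb (hg h)⟩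
  · rintro (⟨⟨c, rfl⟩, h1, h2⟩ | rfl | rfl)
    · refine ⟨c, ?_⟩
      rw [Function.update_of_ne fun h => h1 (congrArg g h),
        Function.update_of_ne fun h => h2 (congrArg g h)]
    · exact ⟨a, Function.update_self _ _ _⟩
    · exact ⟨b, by rw [Function.update_of_ne hab.symm, Function.update_self]⟩

/-- The relation between the coordinates of an invariant tensor at two tuples that differ by the
replacement of a pair `q, σ q` by a pair `p, σ p`. -/
theorem mul_apply_eq_of_invariant [CharZero k] {y : Tup k (dim X l) i} (hsk : IsSkew y)
    (hy : ∀ h ∈ modelSubgroup k X l, tact (mat h) y = y) {p q : Fin (dim X l)} {c : k}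
    (hroot : IsRootLike X l
      (Matrix.single p (pairing X l q) 1 - Matrix.single q (pairing X l p) c))
    (hK : pairCoef k X l q = - (c * pairCoef k X l p))
    (hp : (pairing X l p : ℕ) ≠ fixedIdx X l) (hq : (pairing X l q : ℕ) ≠ fixedIdx X l)
    {g : Fin i → Fin (dim X l)} (hg : y g ≠ 0) {a b : Fin i} (hab : a ≠ b) (ha : g a = q)
    (hb : g b = pairing X l q) (hpg : p ∉ Set.range g) :
    y g = c * y (Function.update (Function.update g b p) a (pairing X l p)) := by
  have h1 : derAct (Matrix.single p (pairing X l q) 1 - Matrix.single q (pairing X l p) c) y =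
      0 := by
    refine derAct_eq_zero_of_invariant hroot (mulVec_e_eq_zero fun x z hz => ?_) ?_ hy
    · rw [← hz, Ne, ← Fin.ext_iff] at hp hq
      simp [hp, hq]
    · have h2 : ∀ A B C : Matrix (Fin (dim X l)) (Fin (dim X l)) k,
          (A - B) * C + C * (A - B)ᵀ = (A * C + C * Aᵀ) - (B * C + C * Bᵀ) := fun A B C => by
        rw [Matrix.transpose_sub]
        noncomm_ring
      rw [h2]
      ext x z
      rw [Matrix.sub_apply, single_mul_pairMat, single_mul_pairMat, pairCoef_pairing,
        pairCoef_pairing, pairing_involutive, pairing_involutive, hK]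
      simp only [and_comm, Matrix.zero_apply]
      ring
  have hinj := update_injective (hsk.injective hg) b hpg
  have h3 := congrFun h1 (Function.update g b p)
  rw [derAct_sub, Pi.sub_apply, derAct_single_of_mem y hinj b (Function.update_self _ _ _),
    derAct_single_of_mem y hinj a (by rw [Function.update_of_ne hab, ha]), Function.update_idem,
    ← hb, Function.update_eq_self] at h3
  rw [Pi.zero_apply] at h3
  linear_combination h3

/-- The replacement of pairs, for the tuples on which an invariant tensor does not vanish. -/
theorem exists_move_of_invariant [CharZero k] {y : Tup k (dim X l) i} (hsk : IsSkew y)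
    (hy : ∀ h ∈ modelSubgroup k X l, tact (mat h) y = y) {p q : Fin (dim X l)} {c : k}
    (hroot : IsRootLike X l
      (Matrix.single p (pairing X l q) 1 - Matrix.single q (pairing X l p) c))
    (hK : pairCoef k X l q = - (c * pairCoef k X l p))
    (hp : (pairing X l p : ℕ) ≠ fixedIdx X l) (hq : (pairing X l q : ℕ) ≠ fixedIdx X l)
    {g : Fin i → Fin (dim X l)} (hg : y g ≠ 0) {a b : Fin i} (hab : a ≠ b) (ha : g a = q)
    (hb : g b = pairing X l q) (hpg : p ∉ Set.range g) :
    ∃ g', y g' ≠ 0 ∧ ∀ x, x ∈ Set.range g' ↔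
      (x ∈ Set.range g ∧ x ≠ q ∧ x ≠ pairing X l q) ∨ x = p ∨ x = pairing X l p := by
  have h1 := mul_apply_eq_of_invariant hsk hy hroot hK hp hq hg hab ha hb hpg
  rw [h1] at hg
  exact ⟨_, right_ne_zero_of_mul hg, fun x => (mem_range_update_update_iff
    (hsk.injective (h1 ▸ hg)) hab ha hb p _ x).trans (by tauto)⟩

theorem isRootLike_typeC {p q : Fin (dim .C l)} (hp : (p : ℕ) < l) (hq : (q : ℕ) < l) :
    IsRootLike .C l (Matrix.single p (pairing .C l q) (1 : k) -
      Matrix.single q (pairing .C l p) (-1)) := by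
  have hX : CType.C ≠ .A := by simp
  have hp' := rev_ge_of_lt hX hp
  have hq' := rev_ge_of_lt hX hq
  have h1 := rootMat_isRootLike (X := .C) (l := l) (k := k) (a := p) (b := q.rev)
    (fun h => by rw [← h] at hq'; omega) fun _ => ⟨rev_ne_self hX hp, by
      rw [Fin.rev_rev]
      exact (rev_ne_self hX hq).symm⟩
  have h2 : formSign k .C l p * formSign k .C l q.rev = -1 := by
    rw [formSign, formSign, if_pos hp, if_neg (by omega), one_mul]
  rwa [rootMat_eq, Fin.rev_rev, h2, ← pairing_eq_rev hX, ← pairing_eq_rev hX] at h1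

/-- The indices of the pairs on which the form `K` is nonzero. -/
def IsPaired (X : CType) (l : ℕ) (x : Fin (dim X l)) : Prop :=
  X = .C → (x : ℕ) < (l + 1) / 2 ∨ 2 * l ≤ x + (l + 1) / 2

theorem isPaired_pairing {x : Fin (dim X l)} (hx : IsPaired X l x) :
    IsPaired X l (pairing X l x) := fun hX => by
  have h1 := hx hX
  subst hX
  have := x.2
  rw [pairing_eq_rev (by simp), Fin.val_rev]
  simp only [dim] at *
  omega

/-- Two different pairs can be ordered so that the Lie algebra of `H` contains a root vector that
exchanges them. -/
theorem exists_root_of_pairs {p q : Fin (dim X l)} (hp : pairing X l p ≠ p)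
    (hq : pairing X l q ≠ q) (hpq : p ≠ q) (hpq' : p ≠ pairing X l q) (hpW : IsPaired X l p)
    (hqW : IsPaired X l q) :
    ∃ p' q', ∃ c : k, (p' = p ∨ p' = pairing X l p) ∧ (q' = q ∨ q' = pairing X l q) ∧
      IsRootLike X l (Matrix.single p' (pairing X l q') 1 -
        Matrix.single q' (pairing X l p') c) ∧
      pairCoef k X l q' = - (c * pairCoef k X l p') ∧
      (pairing X l p' : ℕ) ≠ fixedIdx X l ∧ (pairing X l q' : ℕ) ≠ fixedIdx X l := by
  have hor : ∀ P : Fin (dim X l) → Prop, ∀ x, P x ∨ P (pairing X l x) →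
      ∃ x', (x' = x ∨ x' = pairing X l x) ∧ P x' := fun P x h => by
    rcases h with h | h
    · exact ⟨x, Or.inl rfl, h⟩
    · exact ⟨_, Or.inr rfl, h⟩
  have hdis : ∀ p' q', (p' = p ∨ p' = pairing X l p) → (q' = q ∨ q' = pairing X l q) →
      p' ≠ q' ∧ p' ≠ pairing X l q' ∧ pairing X l p' ≠ p' ∧ pairing X l q' ≠ q' := by
    have hinj := (pairing_involutive (X := X) (l := l)).injective
    rintro p' q' (rfl | rfl) (rfl | rfl) <;>
    (try simp only [pairing_involutive _, hinj.ne_iff]) <;>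
    refine ⟨?_, ?_, ?_, ?_⟩ <;> first | assumption | (apply Ne.symm; assumption) | skip
    all_goals exact fun h => hpq' (by rw [← h, pairing_involutive])
  have hp3 := p.2
  have hq3 := q.2
  cases X
  · have key : ∀ x, pairing .A l x ≠ x → ∃ x', (x' = x ∨ x' = pairing .A l x) ∧
        (x' : ℕ) % 2 = 1 := fun x hx => by
      refine hor (fun x' => (x' : ℕ) % 2 = 1) x ?_
      have h1 := val_pairing_typeA x
      have h2 : ((pairing .A l x : Fin (dim .A l)) : ℕ) ≠ x := fun h => hx (Fin.ext h)
      split_ifs at h1 <;> omega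
    obtain ⟨p', hp', hpo⟩ := key p hp
    obtain ⟨q', hq', hqo⟩ := key q hq
    obtain ⟨h1, h2, h3, h4⟩ := hdis p' q' hp' hq'
    have h5 : pairing .A l p' ≠ q' := fun h => h2 (by rw [← h, pairing_involutive])
    have hfix : ∀ x : Fin (dim .A l), (x : ℕ) % 2 = 1 →
        ((pairing .A l x : Fin (dim .A l)) : ℕ) ≠ fixedIdx .A l := fun x hx => by
      have h1 := val_pairing_typeA x
      have := x.2
      simp only [dim] at this
      simp only [fixedIdx]
      rw [if_neg (by omega)] at h1
      omega
    refine ⟨p', q', -1, hp', hq', ⟨?_, by simp [form]⟩, ?_, hfix _ hpo, hfix _ hqo⟩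
    · have : (Matrix.single p' (pairing .A l q') (1 : k) - Matrix.single q' (pairing .A l p') (-1)) *
          (Matrix.single p' (pairing .A l q') (1 : k) - Matrix.single q' (pairing .A l p') (-1)) =
          0 := by
        simp [mul_sub, sub_mul, h2.symm, h3, h4, h5]
      rw [this, mul_zero]
    · simp [pairCoef, hpo, hqo]
  · have hX : CType.B ≠ .A := by simp
    have hval : ∀ x : Fin (dim .B l), ((pairing .B l x : Fin (dim .B l)) : ℕ) = 2 * l - x :=
      fun x => by
        rw [pairing_eq_rev hX, Fin.val_rev]
        simp only [dim]
        omega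
    have hne : ∀ x : Fin (dim .B l), pairing .B l x ≠ x → (x : ℕ) ≠ l := fun x hx h =>
      hx (Fin.ext (by rw [hval]; omega))
    have hp1 := hne p hp
    have hq1 := hne q hq
    have hp2 := hval p
    have hq2 := hval q
    obtain ⟨p', hp', hpl⟩ := hor (fun x => (x : ℕ) < l) p (by simp only [dim] at hp3; omega)
    obtain ⟨q', hq', hql⟩ := hor (fun x => l < (x : ℕ)) q (by simp only [dim] at hp3 hq3; omega)
    obtain ⟨h1, h2, h3, h4⟩ := hdis p' q' hp' hq'
    have hroot := rootMat_isRootLike (X := .B) (l := l) (k := k) (a := p') (b := q'.rev)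
      (by rwa [pairing_eq_rev hX] at h2) fun _ => ⟨by rwa [pairing_eq_rev hX] at h3, by
        rw [Fin.rev_rev]
        rw [pairing_eq_rev hX] at h4
        exact h4.symm⟩
    have hpv := hval p'
    have hqv := hval q'
    rw [rootMat_eq, Fin.rev_rev, ← pairing_eq_rev hX, ← pairing_eq_rev hX, formSign, formSign,
      mul_one] at hroot
    refine ⟨p', q', 1, hp', hq', hroot, ?_, ?_, ?_⟩
    · simp only [pairCoef]
      rw [if_neg (by omega), if_pos hql, if_pos hpl, one_mul]
    · simp only [fixedIdx]
      omega
    · have := q'.2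
      simp only [dim] at this
      simp only [fixedIdx]
      omega
  · have hX : CType.C ≠ .A := by simp
    have hval : ∀ x : Fin (dim .C l), ((pairing .C l x : Fin (dim .C l)) : ℕ) = 2 * l - 1 - x :=
      fun x => by
        rw [pairing_eq_rev hX, Fin.val_rev]
        simp only [dim]
        omega
    have hp2 := hval p
    have hq2 := hval q
    simp only [dim] at hp3 hq3
    obtain ⟨p', hp', hpl⟩ := hor (fun x => (x : ℕ) < l) p (by omega)
    obtain ⟨q', hq', hql⟩ := hor (fun x => (x : ℕ) < l) q (by omega)
    have hκ : ∀ x x' : Fin (dim .C l), IsPaired .C l x → (x' = x ∨ x' = pairing .C l x) →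
        (x' : ℕ) < l → pairCoef k .C l x' = 1 := fun x x' hx hx' hxl => by
      have h1 : IsPaired .C l x' := by
        rcases hx' with rfl | rfl
        · exact hx
        · exact isPaired_pairing hx
      have h2 := h1 rfl
      exact if_pos (by omega)
    have hpv := hval p'
    have hqv := hval q'
    refine ⟨p', q', -1, hp', hq', isRootLike_typeC hpl hql, ?_, ?_, ?_⟩
    · rw [hκ p p' hpW hp' hpl, hκ q q' hqW hq' hql]
      ring
    · simp only [fixedIdx]
      omega
    · simp only [fixedIdx]
      omega

end UniqueInvariant

/-! ### Uniqueness of the dual modules -/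

section Determined

variable {X : CType} {l : ℕ} {k : Type*} [Field k] {i : ℕ}

/-- In type `C`, the vanishing of the contractions with the form implies that a pair outside of
`W₁` can be replaced by a pair in `W₁`. -/
theorem exists_replacement_typeC [CharZero k] {y : Tup k (dim .C l) i} (hyp : y ∈ prim .C l k i)
    (hy : ∀ h ∈ modelSubgroup k .C l, tact (mat h) y = y) {g : Fin i → Fin (dim .C l)}
    (hg : y g ≠ 0) {a b : Fin i} (hab : a ≠ b) (hb : g b = pairing .C l (g a))
    (hal : (g a : ℕ) < l) (haW : ¬ IsPaired .C l (g a)) :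
    ∃ p, IsPaired .C l p ∧ p ∉ Set.range g ∧
      y (Function.update (Function.update g a p) b (pairing .C l p)) ≠ 0 := by
  have hX : CType.C ≠ .A := by simp
  have hsk := prim_skew hyp
  have hinj := hsk.injective hg
  have hva : (g a : ℕ) ≠ fixedIdx .C l := fun h => haW fun _ => by
    rw [h]
    simp only [fixedIdx] at *
    omega
  by_contra! hc
  set T : Fin (dim .C l) → k := fun x =>
    y (Function.update (Function.update g a x) b (pairing .C l x)) with hT
  have hval : ∀ x : Fin (dim .C l), ((pairing .C l x : Fin (dim .C l)) : ℕ) = 2 * l - 1 - x :=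
    fun x => by
      rw [pairing_eq_rev hX, Fin.val_rev]
      simp only [dim]
      omega
  have hTrev : ∀ x, T (pairing .C l x) = - T x := fun x => by
    simp only [hT]
    rw [pairing_involutive, hsk.swap hab]
  have hTq : T (g a) = y g := by
    simp only [hT]
    rw [← hb, Function.update_eq_self, Function.update_eq_self]
  -- a summand of the contraction is zero or equal to the summand of the pair `g a, g b`
  have hlt : ∀ x : Fin (dim .C l), (x : ℕ) < l → T x = 0 ∨ T x = y g := fun x hx => by
    by_cases hxa : x = g a
    · exact Or.inr (hxa ▸ hTq)
    by_cases hxg : x ∈ Set.range g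
    · obtain ⟨c, rfl⟩ := hxg
      have hca : c ≠ a := fun h => hxa (congrArg g h)
      have hcb : c ≠ b := fun h => by
        have h1 := hval (g a)
        rw [h, hb] at hx
        omega
      refine Or.inl (hsk.eq_zero hca ?_)
      rw [Function.update_of_ne hcb, Function.update_of_ne hca, Function.update_of_ne hab,
        Function.update_self]
    by_cases hxW : IsPaired .C l x
    · exact Or.inl (hc x hxW hxg)
    have hκ : ∀ z : Fin (dim .C l), (z : ℕ) < l → ¬ IsPaired .C l z → pairCoef k .C l z = 0 :=
      fun z hz hzW => by
        have h1 : ¬ ((z : ℕ) < (l + 1) / 2 ∨ 2 * l ≤ z + (l + 1) / 2) := fun h => hzW fun _ => h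
        rw [not_or] at h1
        rw [pairCoef, if_neg h1.1, if_neg h1.2]
    have h1 := mul_apply_eq_of_invariant hsk hy (isRootLike_typeC hx hal)
      (by rw [hκ x hx hxW, hκ _ hal haW, mul_zero, neg_zero])
      (by rw [hval]; simp only [fixedIdx]; omega) (by rw [hval]; simp only [fixedIdx]; omega)
      hg hab rfl hb hxg
    refine Or.inr ?_
    rw [Function.update_comm hab.symm, hsk.swap hab] at h1
    rw [h1, hT]
    ring
  have hall : ∀ x : Fin (dim .C l), formSign k .C l x * T x = 0 ∨
      formSign k .C l x * T x = y g := fun x => by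
    by_cases hx : (x : ℕ) < l
    · rw [formSign, if_pos hx, one_mul]
      exact hlt x hx
    · have h1 := hlt (pairing .C l x) (by
        have h1 := hval x
        have := x.2
        simp only [dim] at this
        omega)
      rw [hTrev] at h1
      rw [formSign, if_neg hx, neg_one_mul]
      exact h1
  have hsum := prim_contraction hyp g hab
  classical
  have hsum' : ∑ x, formSign k .C l x * T x =
      ∑ x, if formSign k .C l x * T x = 0 then 0 else y g :=
    Finset.sum_congr rfl fun x _ => by
      split_ifs with h
      · exact h
      · exact (hall x).resolve_left h
  have h1 : ∑ x, formSign k .C l x * T x = 0 := by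
    rw [← hsum]
    rfl
  rw [hsum'] at h1
  simp only [← ite_not (_ = (0 : k))] at h1
  rw [← Finset.sum_filter, Finset.sum_const, nsmul_eq_mul] at h1
  refine (mul_ne_zero (Nat.cast_ne_zero.2 (Finset.card_ne_zero.2 ⟨g a, ?_⟩)) hg) h1
  rw [Finset.mem_filter, hTq, formSign, if_pos hal, one_mul]
  exact ⟨Finset.mem_univ _, hg⟩

/-- The tuples of distinct indices that consist of pairs on which `K` does not vanish and, in odd
degree, of the fixed index. -/
structure IsAdapted (X : CType) (l : ℕ) {i : ℕ} (f : Fin i → Fin (dim X l)) : Prop where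
  injective : Function.Injective f
  closed : ∀ a, (f a : ℕ) ≠ fixedIdx X l → pairing X l (f a) ∈ Set.range f
  isPaired : ∀ a, IsPaired X l (f a)

/-- An invariant primitive tensor is determined by one coordinate. -/
theorem eq_zero_of_invariant [CharZero k] (hl : 1 ≤ l) {f₀ : Fin i → Fin (dim X l)}
    (hf₀ : IsAdapted X l f₀) {y : Tup k (dim X l) i} (hyp : y ∈ prim X l k i)
    (hy : ∀ h ∈ modelSubgroup k X l, tact (mat h) y = y) (h0 : y f₀ = 0) : y = 0 := by
  classical
  by_contra hne
  have hsk := prim_skew hyp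
  obtain ⟨v, hv⟩ : ∃ v : Fin (dim X l), (v : ℕ) = fixedIdx X l :=
    ⟨⟨fixedIdx X l, by cases X <;> simp only [fixedIdx, dim] <;> omega⟩, rfl⟩
  have hv' : ∀ x : Fin (dim X l), x ≠ v ↔ (x : ℕ) ≠ fixedIdx X l := fun x => by
    rw [Ne, Fin.ext_iff, hv]
  let S : Set (Finset (Fin (dim X l))) := {R | ∃ g, y g ≠ 0 ∧ R = Finset.univ.image g}
  have hmemS : ∀ g, y g ≠ 0 → Finset.univ.image g ∈ S := fun g hg => ⟨g, hg, rfl⟩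
  have hr : ∀ (g : Fin i → Fin (dim X l)) x, x ∈ Finset.univ.image g ↔ x ∈ Set.range g :=
    fun g x => by simp
  have hmem : Finset.univ.image f₀ ∈ S := by
    refine mem_of_exchange (σ := pairing X l) (v := v) (n := i)
      (W := Finset.univ.filter (IsPaired X l)) pairing_involutive
      (fun x hx => Fin.ext ((eq_fixedIdx_of_pairing_eq hx).1.trans hv.symm)) ?_ ?_ ?_ ?_ ?_ ?_ ?_
      ?_ ?_
    · rintro _ ⟨g, hg, rfl⟩
      rw [Finset.card_image_of_injective _ (hsk.injective hg), Finset.card_univ, Fintype.card_fin]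
    · rintro _ ⟨g, hg, rfl⟩ x hx hxv
      rw [hr] at hx ⊢
      exact pairing_mem_range_of_invariant hsk hy hg hx ((hv' x).1 hxv)
    · intro x hx
      simp only [Finset.mem_filter, Finset.mem_univ, true_and] at hx ⊢
      exact isPaired_pairing hx
    · rintro _ ⟨g, hg, rfl⟩ q hq hq' hqq p hp hp' hpp hpW hqW
      simp only [Finset.mem_filter, Finset.mem_univ, true_and] at hpW hqW
      rw [hr] at hq hq' hp hp'
      obtain ⟨p', q', c, hp1, hq1, hroot, hK, hpf, hqf⟩ := exists_root_of_pairs (k := k) hpp hqq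
        (fun h => hp (h ▸ hq)) (fun h => hp (h ▸ hq')) hpW hqW
      have hq2 : (q' ∈ Set.range g ∧ pairing X l q' ∈ Set.range g) ∧ q' ≠ pairing X l q' := by
        rcases hq1 with rfl | rfl
        · exact ⟨⟨hq, hq'⟩, hqq.symm⟩
        · rw [pairing_involutive]
          exact ⟨⟨hq', hq⟩, hqq⟩
      have hp2 : p' ∉ Set.range g := by
        rcases hp1 with rfl | rfl <;> assumption
      obtain ⟨⟨⟨a, ha⟩, b, hb⟩, hq3⟩ := hq2
      obtain ⟨g', hg', hm⟩ := exists_move_of_invariant hsk hy hroot hK hpf hqf hg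
        (fun h => hq3 (ha.symm.trans ((congrArg g h).trans hb))) ha hb hp2
      refine ⟨_, hmemS g' hg', fun x => ?_⟩
      rw [hr, hr, hm]
      rcases hp1 with rfl | rfl <;> rcases hq1 with rfl | rfl <;>
        simp only [pairing_involutive _] <;> tauto
    · rintro _ ⟨g, hg, rfl⟩ q hq hqW
      simp only [Finset.mem_filter, Finset.mem_univ, true_and] at hqW
      have hX : X = .C := by
        by_contra h
        exact hqW fun h' => absurd h' h
      subst hX
      rw [hr] at hq
      have hqv : (q : ℕ) ≠ fixedIdx .C l := fun h => hqW fun _ => by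
        simp only [fixedIdx] at h
        omega
      have hq' := pairing_mem_range_of_invariant hsk hy hg hq hqv
      have hval : ((pairing .C l q : Fin (dim .C l)) : ℕ) = 2 * l - 1 - q := by
        rw [pairing_eq_rev (by simp), Fin.val_rev]
        simp only [dim]
        omega
      obtain ⟨q', hq1, hql⟩ : ∃ q', (q' = q ∨ q' = pairing .C l q) ∧ (q' : ℕ) < l := by
        have := q.2
        simp only [dim] at this
        by_cases h : (q : ℕ) < l
        · exact ⟨q, Or.inl rfl, h⟩
        · exact ⟨_, Or.inr rfl, by omega⟩
      have hq2 : (q' ∈ Set.range g ∧ pairing .C l q' ∈ Set.range g) ∧ ¬ IsPaired .C l q' := by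
        rcases hq1 with rfl | rfl
        · exact ⟨⟨hq, hq'⟩, hqW⟩
        · rw [pairing_involutive]
          exact ⟨⟨hq', hq⟩, fun h => hqW (by
            have := isPaired_pairing h
            rwa [pairing_involutive] at this)⟩
      obtain ⟨⟨⟨a, ha⟩, b, hb⟩, hqW'⟩ := hq2
      subst ha
      have hab : a ≠ b := fun h => by
        rw [← h] at hb
        exact absurd (eq_fixedIdx_of_pairing_eq hb.symm).2 (by simp)
      obtain ⟨p, hpW, hpg, hp⟩ := exists_replacement_typeC hyp hy hg hab hb hql hqW'
      refine ⟨p, by simpa using hpW, by rwa [hr], _, hmemS _ hp, fun x => ?_⟩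
      rw [hr, hr, mem_range_update_update_iff (hsk.injective hg) hab.symm hb rfl]
      rcases hq1 with h | h
      · rw [← h]
        tauto
      · have : q = pairing .C l (g a) := by rw [h, pairing_involutive]
        rw [this, pairing_involutive]
        tauto
    · rw [Finset.card_image_of_injective _ hf₀.injective, Finset.card_univ, Fintype.card_fin]
    · intro x hx hxv
      rw [hr] at hx ⊢
      obtain ⟨a, rfl⟩ := hx
      exact hf₀.closed a ((hv' _).1 hxv)
    · intro x hx
      rw [hr] at hx
      obtain ⟨a, rfl⟩ := hx
      simpa using hf₀.isPaired a
    · obtain ⟨g, hg⟩ := Function.ne_iff.1 hne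
      exact ⟨_, hmemS g hg⟩
  obtain ⟨g, hg, hgf⟩ := hmem
  obtain ⟨τ, rfl⟩ := exists_perm (f₀ := f₀) (hsk.injective hg) fun j => by
    rw [← hr, hgf, hr]
    exact ⟨j, rfl⟩
  rw [hsk, h0, mul_zero] at hg
  exact hg rfl

theorem exists_isAdapted (X : CType) (hi : i ≤ l) :
    ∃ f : Fin i → Fin (dim X l), IsAdapted X l f := by
  have hmk : ∀ f : Fin i → Fin (dim X l), (∀ a b, (f a : ℕ) = f b → (a : ℕ) = b) →
      (∀ a : Fin i, (f a : ℕ) ≠ fixedIdx X l → ∃ b : ℕ, ∃ hb : b < i,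
        pairing X l (f a) = f ⟨b, hb⟩) → (∀ a, IsPaired X l (f a)) → IsAdapted X l f :=
    fun f h1 h2 h3 => ⟨fun a b h => Fin.ext (h1 a b (congrArg Fin.val h)), fun a ha => by
      obtain ⟨b, hb, h⟩ := h2 a ha
      exact ⟨_, h.symm⟩, h3⟩
  -- the partner of the position `a`
  have hpart : ∀ a : Fin i, ¬ ((a : ℕ) % 2 = 0 ∧ (a : ℕ) + 1 = i) →
      (if (a : ℕ) % 2 = 0 then (a : ℕ) + 1 else a - 1) < i := fun a ha => by
    have := a.2
    split_ifs <;> omega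
  cases X
  · let f : Fin i → Fin (dim .A l) := fun a =>
      ⟨if (a : ℕ) % 2 = 0 ∧ (a : ℕ) + 1 = i then l else a, by
        have := a.2
        simp only [dim]
        split_ifs <;> omega⟩
    have hf : ∀ a, (f a : ℕ) = if (a : ℕ) % 2 = 0 ∧ (a : ℕ) + 1 = i then l else a := fun a => rfl
    refine ⟨f, hmk f (fun a b h => ?_) (fun a ha => ?_) fun a h => nomatch h⟩
    · rw [hf, hf] at h
      have := a.2
      have := b.2
      split_ifs at h <;> omega
    · have h1 : ¬ ((a : ℕ) % 2 = 0 ∧ (a : ℕ) + 1 = i) := fun h => ha ((hf a).trans (if_pos h))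
      refine ⟨_, hpart a h1, Fin.ext ?_⟩
      rw [val_pairing_typeA, hf, hf, if_neg h1]
      dsimp only
      have := a.2
      split_ifs <;> omega
  · let f : Fin i → Fin (dim .B l) := fun a =>
      ⟨if (a : ℕ) % 2 = 0 then (if (a : ℕ) + 1 = i then l else a / 2) else 2 * l - a / 2, by
        have := a.2
        simp only [dim]
        split_ifs <;> omega⟩
    have hf : ∀ a, (f a : ℕ) = if (a : ℕ) % 2 = 0 then (if (a : ℕ) + 1 = i then l
      else (a : ℕ) / 2) else 2 * l - (a : ℕ) / 2 := fun a => rfl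
    refine ⟨f, hmk f (fun a b h => ?_) (fun a ha => ?_) fun a h => nomatch h⟩
    · rw [hf, hf] at h
      have := a.2
      have := b.2
      split_ifs at h <;> omega
    · have h1 : ¬ ((a : ℕ) % 2 = 0 ∧ (a : ℕ) + 1 = i) := fun h => ha ((hf a).trans (by
        rw [if_pos h.1, if_pos h.2]
        rfl))
      refine ⟨_, hpart a h1, Fin.ext ?_⟩
      rw [pairing_eq_rev (by simp), Fin.val_rev, hf, hf]
      simp only [dim]
      have := a.2
      split_ifs <;> omega
  · let f : Fin i → Fin (dim .C l) := fun a =>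
      ⟨if (a : ℕ) % 2 = 0 then (if (a : ℕ) + 1 = i then 0 else a / 2 + i % 2)
        else 2 * l - 1 - a / 2 - i % 2, by
        have := a.2
        simp only [dim]
        split_ifs <;> omega⟩
    have hf : ∀ a, (f a : ℕ) = if (a : ℕ) % 2 = 0 then (if (a : ℕ) + 1 = i then 0
      else (a : ℕ) / 2 + i % 2) else 2 * l - 1 - (a : ℕ) / 2 - i % 2 := fun a => rfl
    refine ⟨f, hmk f (fun a b h => ?_) (fun a ha => ?_) fun a _ => ?_⟩
    · rw [hf, hf] at h
      have := a.2
      have := b.2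
      split_ifs at h <;> omega
    · have h1 : ¬ ((a : ℕ) % 2 = 0 ∧ (a : ℕ) + 1 = i) := fun h => ha ((hf a).trans (by
        rw [if_pos h.1, if_pos h.2]
        rfl))
      refine ⟨_, hpart a h1, Fin.ext ?_⟩
      rw [pairing_eq_rev (by simp), Fin.val_rev, hf, hf]
      simp only [dim]
      have := a.2
      split_ifs <;> omega
    · have := hf a
      have := a.2
      split_ifs at * <;> omega

/-- The coordinate ring contains at most one copy of each of the dual modules. -/
theorem IsDualCopy.eq [CharZero k] (h1 : 1 ≤ i) (hi : i ≤ l)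
    {S S' : Subrepresentation (coordRep X l k)} (hS : IsDualCopy X l k i S)
    (hS' : IsDualCopy X l k i S') : S = S' := by
  obtain ⟨f₀, hf₀⟩ := exists_isAdapted X hi
  exact hS.unique hi (fun y hyp hy h0 => eq_zero_of_invariant (h1.trans hi) hf₀ hyp hy h0) hS'

end Determined

/-! ### Products in the coordinate ring -/

section Products

variable {X : CType} {l : ℕ} {k : Type*} [Field k] {i : ℕ}

/-- The expansion of an alternating sum along a factorisation of the tensor. -/
theorem altSum_mul {N p q : ℕ} {w : Tup k N (p + q)} {w₁ : Tup k N p} {w₂ : Tup k N q}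
    (hw : ∀ h, w h = w₁ (h ∘ Fin.castAdd q) * w₂ (h ∘ Fin.natAdd p)) (f : Fin (p + q) → Fin N) :
    ((p.factorial * q.factorial : ℕ) : k) * altSum w f =
      ∑ τ : Equiv.Perm (Fin (p + q)), ((Equiv.Perm.sign τ : ℤ) : k) *
        (altSum w₁ (f ∘ τ ∘ Fin.castAdd q) * altSum w₂ (f ∘ τ ∘ Fin.natAdd p)) := by
  have h1 : ∀ (σ : Equiv.Perm (Fin p)) (σ' : Equiv.Perm (Fin q)),
      ∑ τ : Equiv.Perm (Fin (p + q)), ((Equiv.Perm.sign τ : ℤ) : k) *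
        ((((Equiv.Perm.sign σ : ℤ) : k) * w₁ ((f ∘ τ ∘ Fin.castAdd q) ∘ σ)) *
          (((Equiv.Perm.sign σ' : ℤ) : k) * w₂ ((f ∘ τ ∘ Fin.natAdd p) ∘ σ'))) = altSum w f :=
    fun σ σ' => by
      -- a permutation of the first and of the last factors
      let ρ : Equiv.Perm (Fin (p + q)) := finSumFinEquiv.permCongr (Equiv.Perm.sumCongr σ σ')
      have hρ : Equiv.Perm.sign ρ = Equiv.Perm.sign σ * Equiv.Perm.sign σ' := by
        rw [Equiv.Perm.sign_permCongr, Equiv.Perm.sign_sumCongr]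
      rw [altSum, ← Equiv.sum_comp (Equiv.mulRight ρ) fun τ : Equiv.Perm (Fin (p + q)) =>
        ((Equiv.Perm.sign τ : ℤ) : k) * w (f ∘ τ)]
      refine Finset.sum_congr rfl fun τ _ => ?_
      have h2 : (f ∘ ⇑(τ * ρ)) ∘ Fin.castAdd q = (f ∘ τ ∘ Fin.castAdd q) ∘ σ := by
        funext a
        simp [ρ]
      have h3 : (f ∘ ⇑(τ * ρ)) ∘ Fin.natAdd p = (f ∘ τ ∘ Fin.natAdd p) ∘ σ' := by
        funext a
        simp [ρ]
      rw [Equiv.coe_mulRight, hw, h2, h3, Equiv.Perm.sign_mul, hρ]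
      push_cast
      ring
  have h4 : ∑ σ : Equiv.Perm (Fin p), ∑ σ' : Equiv.Perm (Fin q), altSum w f =
      ((p.factorial * q.factorial : ℕ) : k) * altSum w f := by
    simp only [Finset.sum_const, Finset.card_univ, Fintype.card_perm, Fintype.card_fin,
      nsmul_eq_mul]
    push_cast
    ring
  rw [← h4, ← Finset.sum_congr rfl fun σ _ => Finset.sum_congr rfl fun σ' _ => h1 σ σ',
    Finset.sum_congr rfl fun σ _ => Finset.sum_comm, Finset.sum_comm]
  refine Finset.sum_congr rfl fun τ _ => ?_
  rw [altSum, altSum, Finset.sum_mul_sum, Finset.mul_sum]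
  exact Finset.sum_congr rfl fun σ _ => by rw [Finset.mul_sum]

theorem coef_wedge_apply [CharZero k] (f : Fin i → Fin (dim X l)) (g : Gp X l k) :
    (coef X l i (wedge k f)).1 g = altSum (pairTensor (mat g * pairMat X l k * (mat g)ᵀ)
      (mat g *ᵥ e X l k (fixedIdx X l)) i) f := by
  rw [coef_apply, invTensor, tact_pairTensor, wedge_dotProduct]

theorem coef_wedge_add [CharZero k] (n : ℕ) (f : Fin (2 * n + i) → Fin (dim X l)) :
    (((2 * n).factorial * i.factorial : ℕ) : k) • coef X l (2 * n + i) (wedge k f) =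
      ∑ τ : Equiv.Perm (Fin (2 * n + i)), ((Equiv.Perm.sign τ : ℤ) : k) •
        (coef X l (2 * n) (wedge k (f ∘ τ ∘ Fin.castAdd i)) *
          coef X l i (wedge k (f ∘ τ ∘ Fin.natAdd (2 * n)))) := by
  refine Subtype.ext (funext fun g => ?_)
  have h1 := altSum_mul (k := k) (w := pairTensor (mat g * pairMat X l k * (mat g)ᵀ)
    (mat g *ᵥ e X l k (fixedIdx X l)) (2 * n + i)) (w₁ := pairTensor _ _ _)
    (w₂ := pairTensor _ _ _) (fun h => by
      rw [← pairTensor_append]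
      congr 1
      exact (Fin.append_castAdd_natAdd (f := h)).symm) f
  simp only [AddSubmonoidClass.coe_finsetSum, Finset.sum_apply]
  refine Eq.trans ?_ (h1.trans (Finset.sum_congr rfl fun τ _ => ?_))
  · rw [← coef_wedge_apply]
    rfl
  · rw [← coef_wedge_apply, ← coef_wedge_apply]
    rfl

theorem dualComponent_eq [CharZero k] (h1 : 1 ≤ i) (hi : i ≤ l) :
    dualComponent X l k i = (prim X l k i).map (coef X l i) := by
  obtain ⟨y₀, hy₀, h0⟩ := exists_coef_ne_zero (X := X) (k := k) hi
  obtain ⟨S, hS, hSm⟩ := exists_isDualCopy hi hy₀ h0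
  rw [← hSm]
  refine le_antisymm (iSup_le fun S' => ?_) (le_iSup (fun S : {S : Subrepresentation
    (coordRep X l k) // IsDualCopy X l k i S} => S.1.toSubmodule) ⟨S, hS⟩)
  rw [IsDualCopy.eq h1 hi S'.2 hS]

theorem coordRep_mem_dualComponent [CharZero k] (x : Gp X l k) {F : coordinateRing X l k}
    (h1 : 1 ≤ i) (hi : i ≤ l) (hF : F ∈ dualComponent X l k i) :
    coordRep X l k x F ∈ dualComponent X l k i := by
  rw [dualComponent_eq h1 hi] at hF ⊢
  obtain ⟨y, hy, rfl⟩ := hF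
  exact ⟨_, prim_stable _ _ hy, (coordRep_coef x y).symm⟩

/-- The product of an even and an arbitrary component contains the component of the sum of the
degrees, since the product contains the highest weight vector and is stable under the group. -/
theorem dualComponent_le_mul [CharZero k] {n : ℕ} (hn : 1 ≤ n) (h1 : 1 ≤ i)
    (hi : 2 * n + i ≤ l) :
    dualComponent X l k (2 * n + i) ≤ dualComponent X l k (2 * n) * dualComponent X l k i := by
  rw [dualComponent_eq (by omega) hi, Submodule.map_le_iff_le_comap]
  refine prim_le_of_stable hi (fun x y hy => ?_) ?_
  · rw [Submodule.mem_comap] at hy ⊢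
    rw [← coordRep_coef]
    refine Submodule.mul_induction_on hy (fun F hF F' hF' => ?_) fun F F' hF hF' => ?_
    · exact Submodule.mul_mem_mul (coordRep_mem_dualComponent x (by omega) (by omega) hF)
        (coordRep_mem_dualComponent x h1 (by omega) hF')
    · rw [map_add]
      exact Submodule.add_mem _ hF hF'
  · rw [Submodule.mem_comap]
    have hne : (((2 * n).factorial * i.factorial : ℕ) : k) ≠ 0 :=
      Nat.cast_ne_zero.2 (mul_ne_zero (Nat.factorial_ne_zero _) (Nat.factorial_ne_zero _))
    rw [← Submodule.smul_mem_iff _ hne, coef_wedge_add]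
    have hlt : ∀ a, (stdTuple X hi a : ℕ) < l := fun a => a.2.trans_le hi
    refine Submodule.sum_mem _ fun τ _ => Submodule.smul_mem _ _ (Submodule.mul_mem_mul ?_ ?_)
    · rw [dualComponent_eq (by omega) (by omega)]
      exact ⟨_, wedge_mem_prim fun a => hlt _, rfl⟩
    · rw [dualComponent_eq h1 (by omega)]
      exact ⟨_, wedge_mem_prim fun a => hlt _, rfl⟩

end Products

end ModelVariety

end

theorem mainTheorem6 {k : Type*} [Field k] [IsAlgClosed k] [CharZero k]
    (X : ModelVariety.CType) (l : ℕ) :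
    -- the modules `V_{ε_i}` are irreducible of highest weight `ε_i`, and
    -- the coordinate ring contains exactly one copy of `V_{ε_i}^*`
    (∀ i, 1 ≤ i → i ≤ l →
      Representation.IsIrreducible (V := (ModelVariety.VepsSub X l k i).toSubmodule)
        (ModelVariety.Veps X l k i) ∧
      (∃ v, ModelVariety.IsHighestWeightVector (ModelVariety.Veps X l k i)
        (ModelVariety.eps X l i) v) ∧
      ∃! S, ModelVariety.IsDualCopy X l k i S) ∧
    -- tensor powers of `V_{ε_1}`
    (∀ i, 1 ≤ i → i ≤ l →
      (∃ f : (ModelVariety.Veps X l k i).IntertwiningMap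
          (ModelVariety.tensorPow (ModelVariety.Veps X l k 1) i), Function.Injective f) ∧
      Module.finrank k ((ModelVariety.Veps X l k i).IntertwiningMap
          (ModelVariety.tensorPow (ModelVariety.Veps X l k 1) i)) = 1 ∧
      ∀ j < i, ¬ ∃ f : (ModelVariety.Veps X l k i).IntertwiningMap
          (ModelVariety.tensorPow (ModelVariety.Veps X l k 1) j), Function.Injective f) ∧
    -- products in the coordinate ring
    (∀ i, 1 ≤ i → i + 2 ≤ l →
      ModelVariety.dualComponent X l k (i + 2) ≤
        ModelVariety.dualComponent X l k 2 * ModelVariety.dualComponent X l k i) ∧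
    (∀ i, 1 ≤ i → 2 * i + 1 ≤ l →
      ModelVariety.dualComponent X l k (2 * i + 1) ≤
        ModelVariety.dualComponent X l k 1 * ModelVariety.dualComponent X l k (2 * i)) ∧
    -- the Weyl group
    (∀ i, 1 ≤ i → i + 1 ≤ l →
      ModelVariety.weylWord X l i ∈ ModelVariety.weylGroup X l ∧
      ModelVariety.weylWord X l i (ModelVariety.eps X l i) =
        ModelVariety.eps X l (i + 1) - ModelVariety.eps X l 1) := by
  refine ⟨fun i h1 hi => ⟨ModelVariety.veps_isIrreducible hi,
    ModelVariety.exists_highestWeightVector hi, ?_⟩, fun i h1 hi => ⟨?_, ?_, ?_⟩,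
    fun i h1 hi => ?_, fun i h1 hi => ?_, fun i h1 hi => ⟨ModelVariety.weylWord_mem X l i,
      ModelVariety.weylWord_eps X l i hi⟩⟩
  · obtain ⟨y, hy, hne⟩ := ModelVariety.exists_coef_ne_zero (X := X) (k := k) hi
    obtain ⟨S, hS, -⟩ := ModelVariety.exists_isDualCopy hi hy hne
    exact ⟨S, hS, fun S' hS' => ModelVariety.IsDualCopy.eq h1 hi hS' hS⟩
  · exact ⟨ModelVariety.vepsToTensorPow (h1.trans hi) i,
      ModelVariety.vepsToTensorPow_injective (h1.trans hi)⟩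
  · exact ModelVariety.finrank_intertwiningMap_tensorPow (h1.trans hi) hi
  · rintro j hj ⟨f, hf⟩
    exact ModelVariety.not_injective_tensorPow (h1.trans hi) hi hj f hf
  · have h := ModelVariety.dualComponent_le_mul (X := X) (k := k) (n := 1) le_rfl h1
      (by omega : 2 * 1 + i ≤ l)
    rwa [mul_one, Nat.add_comm] at h
  · have h := ModelVariety.dualComponent_le_mul (X := X) (k := k) h1 le_rfl hi
    rwa [mul_comm (ModelVariety.dualComponent X l k (2 * i))] at h
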